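/- **Setting.** Let $p\ge 1$. An instance consists of a set $\mathcal U$ of $n\ge1$ items, matroids $\mathcal M_1,\dots,\mathcal M_q$ on ground sets $\mathcal N_1,\dots,\mathcal N_q\subseteq\mathcal U$ such that every item lies in at most $p$ of the ground sets (a $p$-matchoid), and a nonnegative, monotone, submodular function $f:2^{\mathcal U}\to\mathbb R$. A set $S\subseteq\mathcal U$ is feasible if $S\cap\mathcal N_i$ is independent in $\mathcal M_i$ for every $i\in[q]$. Let $k$ be the maximum cardinality of a feasible set, $\kappa=\max_{i\in[q]}\mathrm{rk}(\mathcal M_i)$, and $\mathrm{OPT}=\max\{f(S): S \text{ feasible}\}$. In the submodular secretary problem with shortlists and $p$-matchoid constraints, the items arrive one after another in uniformly random order. A randomized algorithm knows $n$ and $k$, and decides irrevocably on each item, before the next one arrives, whether to put it on a shortlist $A$. At the end it also returns a feasible set $A^*\subseteq A$. It runs on a unit-cost random access machine with addition, subtraction, comparison, indirect addressing and uniformly random numbers. It refers to items by their arrival positions, and has access only to items that have already arrived: it can read off the list of indices $i$ with $e\in\mathcal N_i$ for such an item $e$, and it has the value oracle $S\mapsto f(S)$ and the independence oracles "is $S\cap\mathcal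 N_i$ independent in $\mathcal M_i$?", at unit cost per call; a query set is held in a set register that is built up by inserting and erasing single items at unit cost. **Theorem.** There are absolute constants $C$ and $c$ such that for every $p\ge1$ and every $\varepsilon>0$ there are an algorithm (a single program) and a constant $K=K(p,\varepsilon)$ such that, on every instance as above, 1. for every arrival order and every outcome of the random numbers, the algorithm halts within $K\,n\,\max(\kappa,1)^p$ steps, its shortlist has size $$|A|\le C\,\frac{k}{\varepsilon}\,\log^c\!\Big(2+\frac1\varepsilon\Big)=\tilde O\Big(\frac k\varepsilon\Big),$$ and the set $A^*$ that it returns is feasible with $A^*\subseteq A$; 2. its competitive ratio is at least $\frac1{p+1}\big(1-\frac1{e^{p+1}}-\varepsilon\big)$, that is, $$\mathbb E\Big[\max_{S\subseteq A,\ S\text{ feasible}} f(S)\Big]\ \ge\ \frac1{p+1}\Big(1-\frac1{e^{p+1}}-\varepsilon\Big)\mathrm{OPT},$$ and the same lower bound holds for $\mathbb E[f(A^*)]$. -/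

import Mathlib

namespace Shortlist

/-! ### The offline problem -/

/-- A `p`-matchoid constraint on the items `Fin n` together with a nonnegative monotone submodular
objective: `q` matroids, the `i`-th one on the ground set `(matroid i).E`, such that every item
lies in at most `p` of the ground sets. -/
structure Problem (p n q : ℕ) where
  matroid : Fin q → Matroid (Fin n)
  matchoid : ∀ e : Fin n, {i : Fin q | e ∈ (matroid i).E}.ncard ≤ p
  f : Finset (Fin n) → ℝ
  nonneg : ∀ S, 0 ≤ f S
  mono : ∀ S T, S ⊆ T → f S ≤ f T
  submodular : ∀ S T, f (S ∪ T) + f (S ∩ T) ≤ f S + f T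

namespace Problem

variable {p n q : ℕ} (I : Problem p n q)

/-- `S` is independent in all the matroids: the part of `S` inside the `i`-th ground set is
independent in the `i`-th matroid. -/
def Feasible (S : Finset (Fin n)) : Prop :=
  ∀ i, (I.matroid i).Indep ((S : Set (Fin n)) ∩ (I.matroid i).E)

theorem feasible_empty : I.Feasible ∅ := by
  intro i
  simp

open Classical in
/-- The feasible subsets of `A`. -/
noncomputable def feasibleIn (A : Finset (Fin n)) : Finset (Finset (Fin n)) :=
  A.powerset.filter I.Feasible

theorem feasibleIn_nonempty (A : Finset (Fin n)) : (I.feasibleIn A).Nonempty :=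
  ⟨∅, by simp [feasibleIn, I.feasible_empty]⟩

/-- The maximum of `f S` over the feasible `S ⊆ A`. -/
noncomputable def best (A : Finset (Fin n)) : ℝ :=
  (I.feasibleIn A).sup' (I.feasibleIn_nonempty A) I.f

/-- The optimal offline value. -/
noncomputable def opt : ℝ := I.best Finset.univ

/-- The parameter `k`: the maximum cardinality of a feasible set. -/
noncomputable def k : ℕ := (I.feasibleIn Finset.univ).sup Finset.card

/-- The parameter `κ`: the maximum rank of the matroids. -/
noncomputable def kappa : ℕ := Finset.univ.sup fun i => (I.matroid i).eRank.toNat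

end Problem

/-! ### The machine

A unit-cost random access machine (addition, truncated subtraction, comparison, indirect
addressing, uniform random numbers) with oracle access to the objective and to the matroids,
programmed in a structured language. A step is one basic instruction, one test, or one unfolding of a
sequence; evaluating an expression in an instruction takes constant time, as a program contains only
finitely many expressions. The machine has

* number registers `reg x` and arrays `arr a i j` (`a` is the name of the array), initially `0`,
* registers `val v` for values of `f`, which can only be copied and compared,
* registers `set S` for sets of items, which can only be changed by inserting or erasing a single
  item and which are the arguments of the oracle calls.

A program refers to items only by their positions `0, 1, …` in the order of arrival, and every
operation on an item that has not arrived yet is void. -/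

/-- Number expressions. `deg e` is the number of ground sets that contain the item at position `e`,
and `mat e j` is the index of the `j`-th one of them (counted from `0`). -/
inductive Expr
  | lit (c : ℕ)
  | reg (x : ℕ)
  | arr (a : ℕ) (i j : Expr)
  | add (a b : Expr)
  | sub (a b : Expr)
  | deg (e : Expr)
  | mat (e j : Expr)

/-- Tests: comparison of numbers, comparison of values of `f`, and the independence oracle
(is the part of `set S` inside the `i`-th ground set independent in the `i`-th matroid?). -/
inductive Cond
  | lt (a b : Expr)
  | vlt (v w : ℕ)
  | indep (i : Expr) (S : ℕ)

/-- Programs.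
* `assign x e`: `reg x := e`;
* `store a i j e`: `arr a i j := e`;
* `rand x e`: `reg x :=` a fresh uniformly random element of `{0, …, e}`;
* `arrive`: the next item arrives;
* `select`: put the item that arrived last on the shortlist;
* `insert S e`, `erase S e`: insert the item at position `e` into `set S`, or erase it;
* `query v S`: `val v := f (set S)` (the value oracle);
* `copy v w`: `val v := val w`. -/
inductive Prog
  | skip
  | assign (x : ℕ) (e : Expr)
  | store (a : ℕ) (i j e : Expr)
  | rand (x : ℕ) (e : Expr)
  | arrive
  | select
  | insert (S : ℕ) (e : Expr)
  | erase (S : ℕ) (e : Expr)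
  | query (v S : ℕ)
  | copy (v w : ℕ)
  | seq (P Q : Prog)
  | ite (c : Cond) (P Q : Prog)
  | loop (c : Cond) (P : Prog)

/-- States of the machine; `arrived` is the number of items that have arrived so far. -/
structure State (n : ℕ) where
  arrived : ℕ
  shortlist : Finset (Fin n)
  reg : ℕ → ℕ
  arr : ℕ → ℕ → ℕ → ℕ
  val : ℕ → ℝ
  set : ℕ → Finset (Fin n)

/-- A configuration: the stack of programs that are still to be executed, and the state. The machine
has halted when the stack is empty. -/
abbrev Config (n : ℕ) := List Prog × State n

/-- The initial state: `n` and `k` are in the registers `0` and `1`. -/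
def State.init (n k : ℕ) : State n where
  arrived := 0
  shortlist := ∅
  reg := fun x => if x = 0 then n else if x = 1 then k else 0
  arr := fun _ _ _ => 0
  val := fun _ => 0
  set := fun _ => ∅

section Semantics

variable {p n q : ℕ} (I : Problem p n q) (σ : Equiv.Perm (Fin n))

/-- The item at position `t` of the arrival order `σ`, if it has arrived, as a set with at most one
element. -/
def itemAt (s : State n) (t : ℕ) : Finset (Fin n) :=
  if h : t < n then if t < s.arrived then {σ ⟨t, h⟩} else ∅ else ∅

open Classical in
/-- The increasing list of the indices of the ground sets that meet `S`. -/
noncomputable def matroidsOf (S : Finset (Fin n)) : List ℕ :=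
  ((List.finRange q).filter fun i => ∃ e ∈ S, e ∈ (I.matroid i).E).map Fin.val

noncomputable def Expr.eval (s : State n) : Expr → ℕ
  | .lit c => c
  | .reg x => s.reg x
  | .arr a i j => s.arr a (i.eval s) (j.eval s)
  | .add a b => a.eval s + b.eval s
  | .sub a b => a.eval s - b.eval s
  | .deg e => (matroidsOf I (itemAt σ s (e.eval s))).length
  | .mat e j => (matroidsOf I (itemAt σ s (e.eval s))).getD (j.eval s) 0

def Cond.holds (s : State n) : Cond → Prop
  | .lt a b => a.eval I σ s < b.eval I σ s
  | .vlt v w => s.val v < s.val w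
  | .indep i S => ∃ h : i.eval I σ s < q,
      (I.matroid ⟨i.eval I σ s, h⟩).Indep
        ((s.set S : Set (Fin n)) ∩ (I.matroid ⟨i.eval I σ s, h⟩).E)

open Classical in
/-- One step of the machine, at unit cost. -/
noncomputable def step : Config n → PMF (Config n)
  | ([], s) => PMF.pure ([], s)
  | (.skip :: K, s) => PMF.pure (K, s)
  | (.assign x e :: K, s) =>
      PMF.pure (K, { s with reg := Function.update s.reg x (e.eval I σ s) })
  | (.store a i j e :: K, s) =>
      PMF.pure (K, { s with
        arr := fun a' i' j' =>
          if a' = a ∧ i' = i.eval I σ s ∧ j' = j.eval I σ s then e.eval I σ s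
          else s.arr a' i' j' })
  | (.rand x e :: K, s) =>
      (PMF.uniformOfFintype (Fin (e.eval I σ s + 1))).map fun r =>
        (K, { s with reg := Function.update s.reg x r.val })
  | (.arrive :: K, s) => PMF.pure (K, { s with arrived := min (s.arrived + 1) n })
  | (.select :: K, s) =>
      PMF.pure (K, { s with
        shortlist := if s.arrived = 0 then s.shortlist
          else s.shortlist ∪ itemAt σ s (s.arrived - 1) })
  | (.insert S e :: K, s) =>
      PMF.pure (K, { s with
        set := Function.update s.set S (s.set S ∪ itemAt σ s (e.eval I σ s)) })
  | (.erase S e :: K, s) =>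
      PMF.pure (K, { s with
        set := Function.update s.set S (s.set S \ itemAt σ s (e.eval I σ s)) })
  | (.query v S :: K, s) =>
      PMF.pure (K, { s with val := Function.update s.val v (I.f (s.set S)) })
  | (.copy v w :: K, s) =>
      PMF.pure (K, { s with val := Function.update s.val v (s.val w) })
  | (.seq P Q :: K, s) => PMF.pure (P :: Q :: K, s)
  | (.ite c P Q :: K, s) => PMF.pure ((if c.holds I σ s then P else Q) :: K, s)
  | (.loop c P :: K, s) => PMF.pure (if c.holds I σ s then P :: .loop c P :: K else K, s)

/-- The law of the configuration after `T` steps. -/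
noncomputable def runFor : ℕ → Config n → PMF (Config n)
  | 0, c => PMF.pure c
  | T + 1, c => (step I σ c).bind (runFor T)

/-- The law of the configuration after `T` steps of the program `P` when the items arrive in the
order `σ`. -/
noncomputable def run (P : Prog) (T : ℕ) : PMF (Config n) :=
  runFor I σ T ([P], State.init n I.k)

end Semantics

section Outcome

variable {p n q : ℕ} (I : Problem p n q) (P : Prog) (T : ℕ)

/-- The result of a configuration: the shortlist and the returned set (in the set register `0`). -/
def Config.result (c : Config n) : Finset (Fin n) × Finset (Fin n) :=
  (c.2.shortlist, c.2.set 0)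

/-- The law of the result after `T` steps, for a uniformly random arrival order. -/
noncomputable def law : PMF (Finset (Fin n) × Finset (Fin n)) :=
  (PMF.uniformOfFintype (Equiv.Perm (Fin n))).bind fun σ => (run I σ P T).map Config.result

/-- The expected value of the best feasible subset of the shortlist. -/
noncomputable def algValue : ℝ := ∑ r, (law I P T r).toReal * I.best r.1

/-- The expected value of the returned set. -/
noncomputable def outValue : ℝ := ∑ r, (law I P T r).toReal * I.f r.2

end Outcome

end Shortlist

/-! The algorithm assigns the arrival positions at random to `m` windows. It keeps a feasible set
`S`; in each window it finds the item whose insertion into `S`, after the deletion of at most one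
item for every matroid of the new item, gives the largest value. The items of a window that are the
best so far, apart from those of an initial sample, go on the shortlist. After the window the best
item of an earlier, randomly chosen window is offered to `S` again. In the end the part of `S` that
is on the shortlist is returned. -/

namespace Shortlist

/-! ### Matroid exchange by Hall's theorem -/

section Exchange

/-! Let `k` be positive and `ε < 1`; otherwise a trivial program suffices. Choose `a` with `4 / ε ≤
2 ^ a ≤ 8 / ε`, put `η = 2 ^ (-a)`, and use `m = 2 ^ a * k` windows. Sorting `n` independent uniform
draws and dealing them to the arrivals puts every item into an independent uniform window
(`sum_windowOf`).

For a feasible `S` and an optimal set `O`, Hall's theorem gives in each matroid an injective choice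
of the element of `S` that has to leave when an item of `O \ S` enters. An element of `S` lies in at
most `p` ground sets, so it leaves at most `p` times, and submodularity yields `sum_gain_ge`: the
best swaps for the items of `O \ S` together gain at least `OPT - (p + 1) * f S`.

An adaptive solution destroys the uniformity of the windows of earlier items. Two facts repair this.
Given the list of the best items of the past windows, the windows of the items are still
independent, because this event is a product of conditions on the single items (`hist_eq_iff`); an
item that was never picked then falls into the current window with probability at least `1 / m`. An
item that was picked has a known window, and the second chance hits this window with probability
exactly `1 / m`. So each item of `O` is available with probability at least `1 / m`. After a
reweighting to mean exactly `1 / m` the availabilities are pairwise independent or disjoint, and a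
second-order inclusion-exclusion bound shows that a window earns on average at least `(1 - k / m) /
m * (OPT - (p + 1) * f S)` (`step_progress`). Solving the recursion gives `OPT / (p + 1) * (1 - exp
(-(1 - η) * (p + 1)))` (`ideal_bound`).

The shortlist needs only the records of each window after a sample of a `1 / D` fraction of it. A
random order has a logarithmic number of them: `2` to the power of the number of records has mean at
most `D`, so a bound of `L` per window fails with probability at most `D / 2 ^ (L + 1)`. With `D = 2
^ a` and `L = 2 * a - 1` the best item of a window is missed with probability at most `2 * η`. The
order inside a window is independent of the partition into windows, hence of the ideal solution, and
dropping the missed items costs in expectation at most the fraction `2 * η` of its value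
(`sum_shortlisted_ge`). Ties are broken by random priorities, which fail to be injective with
probability at most `η`. All losses together are at most `4 * η ≤ ε` (`ratio_bound`), and the
shortlist has at most `m * L` items.

The rest verifies the program. The best swap for an item is found by `p` nested loops over the parts
of `S` in the matroids of the item, each part having at most `κ` elements; there are at most `n + m`
such searches, and `m ≤ 2 ^ a * n`. -/

theorem exists_exchange {α : Type*} [DecidableEq α] (M : Matroid α) (S O : Finset α)
    (hS : M.Indep (S : Set α)) (hO : M.Indep (O : Set α)) :
    ∃ φ : α → Option α,
      (∀ e ∈ O \ S, ∀ u, φ e = some u → u ∈ S) ∧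
      (∀ e ∈ O \ S, M.Indep (insert e ((S : Set α) \ {u | φ e = some u}))) ∧
      ∀ e ∈ O \ S, ∀ e' ∈ O \ S, ∀ u, φ e = some u → φ e' = some u → e = e' := by
  classical
  -- Only items that cannot simply be added need a partner. The candidates `t e` are the elements of
  -- `S` whose removal makes room for `e`.
  let X := {e // e ∈ O \ S ∧ ¬ M.Indep (insert e (S : Set α))}
  let t : X → Finset α := fun e => S.filter fun u => M.Indep (insert e.1 ((S : Set α) \ {u}))
  -- The candidates contain the fundamental circuit of `e` minus `e`, which spans `e`.
  have hcl : ∀ e : X, e.1 ∈ M.closure (t e : Set α) := by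
    rintro ⟨e, he, hd⟩
    obtain ⟨heO, heS⟩ := Finset.mem_sdiff.1 he
    have heS' : e ∉ (S : Set α) := by simpa using heS
    have heE : e ∈ M.E := hO.subset_ground (by simpa using heO)
    have hec : e ∈ M.closure (S : Set α) := by
      by_contra h
      exact hd ((hS.insert_indep_iff_of_notMem heS').2 ⟨heE, h⟩)
    have hC := hS.fundCircuit_isCircuit hec heS'
    refine M.closure_subset_closure ?_
      (hC.mem_closure_sdiff_singleton_of_mem (M.mem_fundCircuit e S))
    intro u hu
    have huS : u ∈ (S : Set α) := by
      rcases M.fundCircuit_subset_insert e S hu.1 with h | h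
      · exact absurd h hu.2
      · exact h
    have := (hS.mem_fundCircuit_iff hec heS').1 hu.1
    simp only [t, Finset.coe_filter, Set.mem_ofPred_eq]
    refine ⟨by simpa using huS, ?_⟩
    rwa [← Set.insert_sdiff_singleton_comm (fun h => hu.2 (by simp [h]))] at this
  -- Hall's condition: `Y` is independent, being part of `O`, and is spanned by its candidates, so
  -- it has at most as many elements as there are candidates.
  have hall : ∀ Y : Finset X, Y.card ≤ (Y.biUnion t).card := by
    intro Y
    have h1 : M.Indep ((Y.map (Function.Embedding.subtype _) : Finset α) : Set α) :=
      hO.subset (by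
        intro x hx
        simp only [Finset.coe_map, Set.mem_image] at hx
        obtain ⟨y, -, rfl⟩ := hx
        exact (Finset.mem_sdiff.1 y.2.1).1)
    have h2 : ((Y.map (Function.Embedding.subtype _) : Finset α) : Set α) ⊆
        M.closure ((Y.biUnion t : Finset α) : Set α) := by
      intro x hx
      simp only [Finset.coe_map, Set.mem_image] at hx
      obtain ⟨y, hy, rfl⟩ := hx
      refine M.closure_subset_closure ?_ (hcl y)
      exact_mod_cast Finset.subset_biUnion_of_mem t hy
    have h3 := (h1.encard_le_eRk_of_subset h2).trans
      ((M.eRk_closure_eq _).le.trans (M.eRk_le_encard _))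
    rw [Set.encard_coe_eq_coe_finsetCard, Set.encard_coe_eq_coe_finsetCard,
      Finset.card_map] at h3
    exact_mod_cast h3
  obtain ⟨g, hg, hgt⟩ := (Finset.all_card_le_biUnion_card_iff_exists_injective t).1 hall
  refine ⟨fun e => if h : e ∈ O \ S ∧ ¬ M.Indep (insert e (S : Set α)) then some (g ⟨e, h⟩)
    else none, ?_, ?_, ?_⟩
  · intro e he u hu
    dsimp only at hu
    split_ifs at hu with h
    have := hgt ⟨e, h⟩
    rw [Option.some.inj hu] at this
    exact (Finset.mem_filter.1 this).1
  · intro e he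
    by_cases h : e ∈ O \ S ∧ ¬ M.Indep (insert e (S : Set α))
    · have := (Finset.mem_filter.1 (hgt ⟨e, h⟩)).2
      simp only [dif_pos h]
      refine this.subset (Set.insert_subset_insert ?_)
      intro x hx
      exact ⟨hx.1, fun hh => hx.2 (congrArg some hh.symm)⟩
    · have h' : M.Indep (insert e (S : Set α)) := by
        by_contra h'
        exact h ⟨he, h'⟩
      exact h'.subset (Set.insert_subset_insert Set.sdiff_subset)
  · intro e he e' he' u hu hu'
    simp only at hu hu'
    split_ifs at hu hu' with h h'
    have := hg ((Option.some.inj hu).trans (Option.some.inj hu').symm)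
    exact congrArg Subtype.val this

end Exchange

/-! ### Submodular inequalities for exchanges -/

section Submodular

variable {α : Type*} [DecidableEq α] {f : Finset α → ℝ}
  (hsub : ∀ S T, f (S ∪ T) + f (S ∩ T) ≤ f S + f T)
include hsub

theorem marginal_antitone {S T : Finset α} (h : S ⊆ T) {a : α} (ha : a ∉ T) :
    f (insert a T) - f T ≤ f (insert a S) - f S := by
  have h1 := hsub (insert a S) T
  have e1 : insert a S ∪ T = insert a T := by
    rw [Finset.insert_union, Finset.union_eq_right.2 h]
  have e2 : insert a S ∩ T = S := by
    rw [Finset.insert_inter_of_notMem ha, Finset.inter_eq_left.2 h]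
  rw [e1, e2] at h1
  linarith

theorem union_le_sum_marginal (S O : Finset α) :
    f (S ∪ O) - f S ≤ ∑ e ∈ O \ S, (f (insert e S) - f S) := by
  suffices h : ∀ X : Finset α, Disjoint X S →
      f (X ∪ S) - f S ≤ ∑ e ∈ X, (f (insert e S) - f S) by
    have := h (O \ S) Finset.sdiff_disjoint
    rwa [Finset.sdiff_union_self_eq_union, Finset.union_comm] at this
  intro X
  induction X using Finset.induction_on with
  | empty => simp
  | insert a X ha ih =>
    intro hd
    rw [Finset.disjoint_insert_left] at hd
    rw [Finset.sum_insert ha, Finset.insert_union]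
    have := marginal_antitone hsub (Finset.subset_union_right : S ⊆ X ∪ S)
      (a := a) (by simp [ha, hd.1])
    linarith [ih hd.2]

/-- Build up `S` element by element. A new element `a` raises the removal loss by at most its
marginal value for each of the at most `p` sets `U e` that contain it. For the other sets the loss
does not grow, by diminishing returns. -/
theorem sum_removal_le {ι : Type*} (mono : ∀ S T, S ⊆ T → f S ≤ f T) (O : Finset ι) (p : ℕ)
    (U : ι → Finset α) (S : Finset α) (hU : ∀ u ∈ S, (O.filter fun e => u ∈ U e).card ≤ p) :
    ∑ e ∈ O, (f S - f (S \ U e)) ≤ p * (f S - f ∅) := by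
  classical
  induction S using Finset.induction_on with
  | empty => simp
  | insert a S ha ih =>
    have hm : 0 ≤ f (insert a S) - f S := sub_nonneg.2 (mono _ _ (Finset.subset_insert a S))
    have key : ∀ e ∈ O, f (insert a S) - f (insert a S \ U e) ≤
        (f S - f (S \ U e)) + if a ∈ U e then f (insert a S) - f S else 0 := by
      intro e _
      split_ifs with h
      · rw [Finset.insert_sdiff_of_mem _ h]
        linarith
      · rw [Finset.insert_sdiff_of_notMem _ h]
        have := marginal_antitone hsub (Finset.sdiff_subset : S \ U e ⊆ S) ha
        linarith
    refine (Finset.sum_le_sum key).trans ?_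
    rw [Finset.sum_add_distrib, ← Finset.sum_filter, Finset.sum_const, nsmul_eq_mul]
    have h1 := ih fun u hu => hU u (Finset.mem_insert_of_mem hu)
    have h2 : ((O.filter fun e => a ∈ U e).card : ℝ) ≤ p := by
      exact_mod_cast hU a (Finset.mem_insert_self a S)
    nlinarith [mul_le_mul_of_nonneg_right h2 hm]

/-- Inserting `e` after a removal gains at least as much as inserting it into `S`. The insertions
sum to at least `f O - f S`, while all removals together cost at most `p * f S`, where `f ∅` is
dropped as nonnegative. -/
theorem sum_exchange_ge (mono : ∀ S T, S ⊆ T → f S ≤ f T) (p : ℕ) (S O : Finset α)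
    (h0 : 0 ≤ f ∅) (U : α → Finset α)
    (hU : ∀ u ∈ S, ((O \ S).filter fun e => u ∈ U e).card ≤ p) :
    f O - (p + 1) * f S ≤ ∑ e ∈ O \ S, (f (insert e (S \ U e)) - f S) := by
  have h1 := union_le_sum_marginal hsub S O
  have h2 := sum_removal_le hsub mono (O \ S) p U S hU
  have h3 : ∑ e ∈ O \ S, (f (insert e S) - f S) - ∑ e ∈ O \ S, (f S - f (S \ U e)) ≤
      ∑ e ∈ O \ S, (f (insert e (S \ U e)) - f S) := by
    rw [← Finset.sum_sub_distrib]
    refine Finset.sum_le_sum fun e he => ?_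
    have := marginal_antitone hsub (Finset.sdiff_subset : S \ U e ⊆ S)
      (Finset.mem_sdiff.1 he).2
    linarith
  have h4 := mono O (S ∪ O) Finset.subset_union_right
  have h5 : (0 : ℝ) ≤ p := Nat.cast_nonneg p
  nlinarith [mul_nonneg h5 h0]

end Submodular

/-! ### The best swap for an item -/

section Swaps

variable {p n q : ℕ} (I : Problem p n q)

/-- The indices of the ground sets that contain `e`, in increasing order. -/
noncomputable def mats (e : Fin n) : List ℕ := matroidsOf I {e}

/-- The part of `S` inside the `l`-th ground set. -/
noncomputable def listIn (S : List (Fin n)) (l : ℕ) : List (Fin n) :=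
  S.filter fun u => l ∈ mats I u

/-- Replace the items `u 0, …, u (p - 1)` of `S` by `e`. -/
def swapped (p : ℕ) (S : List (Fin n)) (e : Fin n) (u : ℕ → Option (Fin n)) : List (Fin n) :=
  S.filter (fun x => ∀ j < p, u j ≠ some x) ++ [e]

/-- The list after a swap, if there is one. -/
def applySwap (p : ℕ) (S : List (Fin n)) (e : Fin n) :
    Option (ℕ → Option (Fin n)) → List (Fin n)
  | none => S
  | some u => swapped p S e u

/-- The value after a swap, if there is one. -/
noncomputable def swapVal (S : List (Fin n)) (e : Fin n)
    (o : Option (ℕ → Option (Fin n))) : ℝ :=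
  I.f (applySwap p S e o).toFinset

open Classical in
/-- Update the best swap found so far by the swap `u`. -/
noncomputable def trySwap (S : List (Fin n)) (e : Fin n) (u : ℕ → Option (Fin n))
    (o : Option (ℕ → Option (Fin n))) : Option (ℕ → Option (Fin n)) :=
  if I.Feasible (swapped p S e u).toFinset ∧ swapVal I S e o < I.f (swapped p S e u).toFinset
  then some u else o

/-- Run through all choices of the entries `u 0, …, u (j - 1)`. -/
noncomputable def searchSwap (S : List (Fin n)) (e : Fin n) : ℕ → (ℕ → Option (Fin n)) →
    Option (ℕ → Option (Fin n)) → Option (ℕ → Option (Fin n))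
  | 0, u, o => trySwap I S e u o
  | j + 1, u, o =>
      (none :: (listIn I S ((mats I e).getD j 0)).map some).foldl
        (fun o x => searchSwap S e j (Function.update u j x) o) o

/-- The best swap that brings `e` into `S`. -/
noncomputable def bestSwap (S : List (Fin n)) (e : Fin n) : Option (ℕ → Option (Fin n)) :=
  searchSwap I S e p (fun _ => none) none

/-- The result of the best swap that brings `e` into `S`. -/
noncomputable def swapTo (S : List (Fin n)) (e : Fin n) : List (Fin n) :=
  applySwap p S e (bestSwap I S e)

/-- The value of the best swap that brings `e` into `S`. -/
noncomputable def gain (S : List (Fin n)) (e : Fin n) : ℝ := I.f (swapTo I S e).toFinset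

variable {I}

theorem mem_matroidsOf {A : Finset (Fin n)} {l : ℕ} :
    l ∈ matroidsOf I A ↔ ∃ h : l < q, ∃ e ∈ A, e ∈ (I.matroid ⟨l, h⟩).E := by
  simp only [matroidsOf, List.mem_map, List.mem_filter, List.mem_finRange, true_and,
    decide_eq_true_eq]
  constructor
  · rintro ⟨i, h, rfl⟩
    exact ⟨i.2, h⟩
  · rintro ⟨h, h'⟩
    exact ⟨⟨l, h⟩, h', rfl⟩

theorem mem_mats {e : Fin n} {l : ℕ} :
    l ∈ mats I e ↔ ∃ h : l < q, e ∈ (I.matroid ⟨l, h⟩).E := by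
  simp [mats, mem_matroidsOf]

theorem matroidsOf_nodup (A : Finset (Fin n)) : (matroidsOf I A).Nodup :=
  ((List.nodup_finRange q).filter _).map Fin.val_injective

theorem length_mats_le (e : Fin n) : (mats I e).length ≤ p := by
  classical
  refine le_trans ?_ (I.matchoid e)
  have hnd : (mats I e).Nodup := matroidsOf_nodup _
  rw [← List.toFinset_card_of_nodup hnd, ← Set.ncard_coe_finset,
    ← Set.ncard_image_of_injective _ Fin.val_injective]
  refine Set.ncard_le_ncard ?_ (Set.toFinite _)
  intro l hl
  obtain ⟨h, h'⟩ := mem_mats.1 (List.mem_toFinset.1 hl)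
  exact ⟨⟨l, h⟩, h', rfl⟩

theorem Problem.Feasible.subset {S T : Finset (Fin n)} (hT : I.Feasible T) (h : S ⊆ T) :
    I.Feasible S := fun i =>
  (hT i).subset (Set.inter_subset_inter_left _ (by exact_mod_cast h))

/-- It suffices to test the matroids of the new item. -/
theorem feasible_insert_iff {S : Finset (Fin n)} (hS : I.Feasible S) (e : Fin n) :
    I.Feasible (insert e S) ↔ ∀ j < p, ∀ l, (mats I e)[j]? = some l → ∃ h : l < q,
      (I.matroid ⟨l, h⟩).Indep (((insert e S : Finset (Fin n)) : Set (Fin n)) ∩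
        (I.matroid ⟨l, h⟩).E) := by
  constructor
  · intro h j _ l hl
    obtain ⟨h', _⟩ := mem_mats.1 (List.mem_of_getElem? hl)
    exact ⟨h', h _⟩
  · intro h i
    by_cases hi : e ∈ (I.matroid i).E
    · obtain ⟨j, hj⟩ := List.mem_iff_getElem?.1 (mem_mats (I := I).2 ⟨i.2, hi⟩)
      have hjp : j < p := lt_of_lt_of_le
        (List.getElem?_eq_some_iff.1 hj).1 (length_mats_le e)
      exact (h j hjp _ hj).2
    · refine (hS i).subset ?_
      rintro x ⟨hx, hxE⟩
      rcases Finset.mem_insert.1 (by exact_mod_cast hx) with rfl | hx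
      · exact absurd hxE hi
      · exact ⟨by exact_mod_cast hx, hxE⟩

/-- The list enumerates an independent set of the `l`-th matroid, or is empty if there is no such
matroid. This bounds the number of choices in each of the nested loops of the search. -/
theorem listIn_length_le {S : List (Fin n)} (hn : S.Nodup) (hS : I.Feasible S.toFinset) (l : ℕ) :
    (listIn I S l).length ≤ I.kappa := by
  by_cases h : l < q
  · have h1 := (hS ⟨l, h⟩).encard_le_eRank
    have h2 : ((listIn I S l).toFinset : Set (Fin n)) =
        (S.toFinset : Set (Fin n)) ∩ (I.matroid ⟨l, h⟩).E := by
      ext x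
      simp [listIn, mem_mats, h]
    have hnd : (listIn I S l).Nodup := hn.filter _
    rw [← h2, Set.encard_coe_eq_coe_finsetCard, List.toFinset_card_of_nodup hnd] at h1
    have h3 : (I.matroid ⟨l, h⟩).eRank ≠ ⊤ :=
      (Matroid.eRank_ne_top_iff _).2 inferInstance
    have h4 : (listIn I S l).length ≤ (I.matroid ⟨l, h⟩).eRank.toNat := by
      rw [← ENat.natCast_toNat h3] at h1
      exact_mod_cast h1
    exact h4.trans (Finset.le_sup (f := fun i => (I.matroid i).eRank.toNat)
      (Finset.mem_univ (⟨l, h⟩ : Fin q)))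
  · have : listIn I S l = [] := by
      rw [listIn, List.filter_eq_nil_iff]
      intro x _
      simp [mem_mats, h]
    simp [this]

theorem swapVal_le_trySwap (S : List (Fin n)) (e : Fin n) (u o) :
    swapVal I S e o ≤ swapVal I S e (trySwap I S e u o) := by
  unfold trySwap
  split_ifs with h
  · exact h.2.le
  · exact le_rfl

theorem swapVal_le_foldl {ι : Type*} (S : List (Fin n)) (e : Fin n)
    (F : Option (ℕ → Option (Fin n)) → ι → Option (ℕ → Option (Fin n)))
    (hF : ∀ o x, swapVal I S e o ≤ swapVal I S e (F o x)) (l : List ι) (o) :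
    swapVal I S e o ≤ swapVal I S e (l.foldl F o) := by
  induction l generalizing o with
  | nil => exact le_rfl
  | cons a l ih => exact (hF o a).trans (ih _)

theorem swapVal_le_searchSwap (S : List (Fin n)) (e : Fin n) (j : ℕ) (u o) :
    swapVal I S e o ≤ swapVal I S e (searchSwap I S e j u o) := by
  induction j generalizing u o with
  | zero => exact swapVal_le_trySwap S e u o
  | succ j ih => exact swapVal_le_foldl S e _ (fun o x => ih _ o) _ _

theorem swapped_congr {S : List (Fin n)} {e : Fin n} {u u' : ℕ → Option (Fin n)}
    (h : ∀ j < p, u j = u' j) : swapped p S e u = swapped p S e u' := by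
  unfold swapped
  congr 1
  refine List.filter_congr fun x _ => ?_
  rw [decide_eq_decide]
  exact forall₂_congr fun j hj => by rw [h j hj]

/-- The search passes through the branch whose entries are those of `v`, and what it tries
afterwards never lowers the recorded value. At level `j` the entries from `j` on are already fixed
and agree with `v`. -/
theorem le_searchSwap {S : List (Fin n)} {e : Fin n} {v : ℕ → Option (Fin n)}
    (hv : ∀ j < p, ∀ x, v j = some x → x ∈ listIn I S ((mats I e).getD j 0))
    (hf : I.Feasible (swapped p S e v).toFinset) (j : ℕ) (hj : j ≤ p)
    (u : ℕ → Option (Fin n)) (hu : ∀ i, j ≤ i → i < p → u i = v i) (o) :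
    I.f (swapped p S e v).toFinset ≤ swapVal I S e (searchSwap I S e j u o) := by
  induction j generalizing u o with
  | zero =>
    have h := swapped_congr (S := S) (e := e) (fun i hi => hu i (Nat.zero_le i) hi)
    rw [← h] at hf ⊢
    simp only [searchSwap, trySwap]
    split_ifs with hh
    · exact le_rfl
    · exact not_lt.1 fun h' => hh ⟨hf, h'⟩
  | succ j ih =>
    have hmem : v j ∈ none :: (listIn I S ((mats I e).getD j 0)).map some := by
      cases hvj : v j with
      | none => simp
      | some x => simpa using hv j hj x hvj
    -- Split the loop at the choice `v j`: the choices before it only change the accumulator, those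
    -- after it only improve the value.
    obtain ⟨l1, l2, hl⟩ := List.append_of_mem hmem
    rw [searchSwap, hl, List.foldl_append, List.foldl_cons]
    refine le_trans ?_ (swapVal_le_foldl S e _
      (fun o x => swapVal_le_searchSwap S e j _ o) _ _)
    refine ih (by omega) _ (fun i hi hip => ?_) _
    rcases eq_or_lt_of_le hi with rfl | hlt
    · simp
    · rw [Function.update_of_ne (by omega)]
      exact hu i hlt hip

theorem foldl_invariant {ι β : Type*} (P : β → Prop) (F : β → ι → β)
    (hF : ∀ b x, P b → P (F b x)) (l : List ι) (b : β) (hb : P b) : P (l.foldl F b) := by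
  induction l generalizing b with
  | nil => exact hb
  | cons a l ih => exact ih _ (hF _ _ hb)

theorem searchSwap_feasible {S : List (Fin n)} {e : Fin n} (j : ℕ) (u o)
    (ho : I.Feasible (applySwap p S e o).toFinset) :
    I.Feasible (applySwap p S e (searchSwap I S e j u o)).toFinset := by
  induction j generalizing u o with
  | zero =>
    simp only [searchSwap, trySwap]
    split_ifs with h
    · exact h.1
    · exact ho
  | succ j ih =>
    exact foldl_invariant (fun o => I.Feasible (applySwap p S e o).toFinset) _
      (fun o x ho => ih _ o ho) _ _ ho

theorem swapTo_feasible {S : List (Fin n)} (hS : I.Feasible S.toFinset) (e : Fin n) :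
    I.Feasible (swapTo I S e).toFinset :=
  searchSwap_feasible _ _ _ hS

theorem applySwap_subset (S : List (Fin n)) (e : Fin n) (o) :
    applySwap p S e o ⊆ e :: S := by
  cases o with
  | none => exact List.subset_cons_self _ _
  | some u =>
    intro x hx
    simp only [applySwap, swapped, List.mem_append, List.mem_filter, List.mem_singleton] at hx
    rcases hx with h | rfl
    · exact List.mem_cons_of_mem _ h.1
    · exact List.mem_cons_self

theorem applySwap_nodup {S : List (Fin n)} (hS : S.Nodup) {e : Fin n} (he : e ∉ S) (o) :
    (applySwap p S e o).Nodup := by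
  cases o with
  | none => exact hS
  | some u =>
    refine (hS.filter _).append (List.nodup_singleton _) ?_
    intro x hx hx'
    rw [List.mem_singleton] at hx'
    subst hx'
    exact he (List.mem_filter.1 hx).1

theorem le_gain (S : List (Fin n)) (e : Fin n) : I.f S.toFinset ≤ gain I S e :=
  swapVal_le_searchSwap S e p _ none

theorem le_gain_of_swap {S : List (Fin n)} {e : Fin n} {v : ℕ → Option (Fin n)}
    (hv : ∀ j < p, ∀ x, v j = some x → x ∈ listIn I S ((mats I e).getD j 0))
    (hf : I.Feasible (swapped p S e v).toFinset) :
    I.f (swapped p S e v).toFinset ≤ gain I S e :=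
  le_searchSwap hv hf p le_rfl _ (fun i h h' => absurd h (by omega)) _

/-- Apply the exchange lemma inside each ground set and remove for `e` its partners in all of its
matroids. The result is feasible and is one of the swaps compared by the search. Injectivity in each
matroid and the `p`-matchoid property bound how often an element of `S` is removed. -/
theorem sum_gain_ge {S : List (Fin n)} (hS : I.Feasible S.toFinset) {O : Finset (Fin n)}
    (hO : I.Feasible O) :
    I.f O - (p + 1) * I.f S.toFinset ≤
      ∑ e ∈ O \ S.toFinset, (gain I S e - I.f S.toFinset) := by
  classical
  set T := S.toFinset with hT
  have hex : ∀ i : Fin q, ∃ φ : Fin n → Option (Fin n),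
      (∀ e ∈ O \ T, e ∈ (I.matroid i).E → ∀ u, φ e = some u → u ∈ T ∧ u ∈ (I.matroid i).E) ∧
      (∀ e ∈ O \ T, e ∈ (I.matroid i).E → (I.matroid i).Indep
        (insert e (((T : Set (Fin n)) ∩ (I.matroid i).E) \ {u | φ e = some u}))) ∧
      ∀ e ∈ O \ T, e ∈ (I.matroid i).E → ∀ e' ∈ O \ T, e' ∈ (I.matroid i).E →
        ∀ u, φ e = some u → φ e' = some u → e = e' := by
    intro i
    have c1 : ∀ A : Finset (Fin n), ((A.filter (· ∈ (I.matroid i).E) : Finset (Fin n)) :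
        Set (Fin n)) = (A : Set (Fin n)) ∩ (I.matroid i).E := by
      intro A; ext x; simp
    obtain ⟨φ, h1, h2, h3⟩ := exists_exchange (I.matroid i) (T.filter (· ∈ (I.matroid i).E))
      (O.filter (· ∈ (I.matroid i).E)) (by rw [c1]; exact hS i) (by rw [c1]; exact hO i)
    have hm : ∀ e ∈ O \ T, e ∈ (I.matroid i).E →
        e ∈ O.filter (· ∈ (I.matroid i).E) \ T.filter (· ∈ (I.matroid i).E) := by
      intro e he hE
      rw [Finset.mem_sdiff] at he
      simp [he.1, he.2, hE]
    refine ⟨φ, fun e he hE u hu => ?_, fun e he hE => ?_, fun e he hE e' he' hE' u hu hu' =>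
      h3 e (hm e he hE) e' (hm e' he' hE') u hu hu'⟩
    · simpa using h1 e (hm e he hE) u hu
    · simpa [c1] using h2 e (hm e he hE)
  choose φ h1 h2 h3 using hex
  let v : Fin n → ℕ → Option (Fin n) := fun e j =>
    ((mats I e)[j]?).bind fun l => if h : l < q then φ ⟨l, h⟩ e else none
  have hv : ∀ e j u, v e j = some u → ∃ i : Fin q, (mats I e)[j]? = some i.1 ∧
      e ∈ (I.matroid i).E ∧ φ i e = some u := by
    intro e j u h
    simp only [v, Option.bind_eq_some_iff] at h
    obtain ⟨l, hl, hl'⟩ := h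
    obtain ⟨hlq, hE⟩ := mem_mats.1 (List.mem_of_getElem? hl)
    rw [dif_pos hlq] at hl'
    exact ⟨⟨l, hlq⟩, hl, hE, hl'⟩
  let U : Fin n → Finset (Fin n) := fun e =>
    Finset.univ.filter fun u => ∃ j < p, v e j = some u
  have hsw : ∀ e, (swapped p S e (v e)).toFinset = insert e (T \ U e) := by
    intro e
    ext x
    simp only [swapped, List.toFinset_append, List.toFinset_filter, Finset.mem_union,
      Finset.mem_filter, List.mem_toFinset, Finset.mem_insert, Finset.mem_sdiff, U, hT,
      decide_eq_true_eq, List.mem_singleton, Finset.mem_univ, true_and, not_exists, not_and]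
    tauto
  have hfe : ∀ e ∈ O \ T, I.Feasible (swapped p S e (v e)).toFinset := by
    intro e he
    rw [hsw, feasible_insert_iff (hS.subset Finset.sdiff_subset)]
    intro j hj l hl
    obtain ⟨hlq, hE⟩ := mem_mats.1 (List.mem_of_getElem? hl)
    refine ⟨hlq, (h2 ⟨l, hlq⟩ e he hE).subset ?_⟩
    rintro x ⟨hx, hxE⟩
    rcases Finset.mem_insert.1 (by exact_mod_cast hx) with rfl | hx
    · exact Set.mem_insert _ _
    · rw [Finset.mem_sdiff] at hx
      refine Set.mem_insert_of_mem _ ⟨⟨by exact_mod_cast hx.1, hxE⟩, fun hφ => hx.2 ?_⟩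
      simp only [U, Finset.mem_filter, Finset.mem_univ, true_and]
      refine ⟨j, hj, ?_⟩
      simp only [v, hl, Option.bind_some, dif_pos hlq]
      exact hφ
  have hcount : ∀ u ∈ T, ((O \ T).filter fun e => u ∈ U e).card ≤ p := by
    intro u hu
    refine le_trans ?_ (I.matchoid u)
    rw [← Set.ncard_coe_finset]
    have hch : ∀ e ∈ (O \ T).filter fun e => u ∈ U e, ∃ i : Fin q, e ∈ (I.matroid i).E ∧
        φ i e = some u := by
      intro e he
      obtain ⟨-, he⟩ := Finset.mem_filter.1 he
      simp only [U, Finset.mem_filter, Finset.mem_univ, true_and] at he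
      obtain ⟨j, -, hj⟩ := he
      obtain ⟨i, -, hi⟩ := hv e j u hj
      exact ⟨i, hi⟩
    rcases Finset.eq_empty_or_nonempty ((O \ T).filter fun e => u ∈ U e) with h0 | ⟨e0, he0⟩
    · simp [h0]
    have : Nonempty (Fin q) := ⟨(hch e0 he0).choose⟩
    -- Map every item that removes `u` to a matroid in which `u` is its partner. This is injective,
    -- and the images are ground sets that contain `u`, of which there are at most `p`.
    choose! ψ hψ using hch
    refine Set.ncard_le_ncard_of_injOn ψ ?_ ?_ (Set.toFinite _)
    · intro e he
      exact (h1 _ e (Finset.mem_filter.1 he).1 (hψ e he).1 u (hψ e he).2).2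
    · intro e he e' he' hee
      refine h3 (ψ e) e (Finset.mem_filter.1 he).1 (hψ e he).1 e' (Finset.mem_filter.1 he').1
        ?_ u (hψ e he).2 ?_
      · rw [hee]; exact (hψ e' he').1
      · rw [hee]; exact (hψ e' he').2
  refine (sum_exchange_ge I.submodular I.mono p T O (I.nonneg _) U hcount).trans ?_
  refine Finset.sum_le_sum fun e he => sub_le_sub_right ?_ _
  rw [← hsw]
  refine le_gain_of_swap ?_ (hfe e he)
  intro j hj x hx
  obtain ⟨i, hi, hE, hφ⟩ := hv e j x hx
  have := h1 i e he hE x hφ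
  rw [List.getD_eq_getElem?_getD, hi]
  simp only [listIn, Option.getD_some, List.mem_filter, decide_eq_true_eq]
  exact ⟨by simpa [hT] using this.1, mem_mats.2 ⟨i.2, this.2⟩⟩

end Swaps

/-! ### The update of the solution after a window -/

section Next

variable {p n q : ℕ} (I : Problem p n q)

open Classical in
/-- The next solution, when the best new item is `x` and the old item `r` gets a second chance. -/
noncomputable def nextSol (S : List (Fin n)) (x r : Option (Fin n)) : List (Fin n) :=
  let c := x.elim S (swapTo I S)
  r.elim c fun e => if e ∉ S ∧ I.f c.toFinset < gain I S e then swapTo I S e else c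

variable {I}

theorem nextSol_cases (S : List (Fin n)) (x r : Option (Fin n)) :
    nextSol I S x r = S ∨ (∃ e, x = some e ∧ nextSol I S x r = swapTo I S e) ∨
      ∃ e, r = some e ∧ e ∉ S ∧ nextSol I S x r = swapTo I S e := by
  cases r with
  | none => cases x <;> simp [nextSol]
  | some e =>
    simp only [nextSol, Option.elim_some]
    split_ifs with h
    · exact Or.inr (Or.inr ⟨e, rfl, h.1, rfl⟩)
    · cases x <;> simp

theorem le_nextSol_left (S : List (Fin n)) (x r : Option (Fin n)) :
    I.f (x.elim S (swapTo I S)).toFinset ≤ I.f (nextSol I S x r).toFinset := by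
  cases r with
  | none => exact le_rfl
  | some e =>
    simp only [nextSol, Option.elim_some]
    split_ifs with h
    · exact h.2.le
    · exact le_rfl

theorem le_nextSol (S : List (Fin n)) (x r : Option (Fin n)) :
    I.f S.toFinset ≤ I.f (nextSol I S x r).toFinset := by
  refine le_trans ?_ (le_nextSol_left S x r)
  cases x with
  | none => exact le_rfl
  | some e => exact le_gain S e

theorem gain_le_nextSol_right {S : List (Fin n)} (x : Option (Fin n)) {e : Fin n} (he : e ∉ S) :
    gain I S e ≤ I.f (nextSol I S x (some e)).toFinset := by
  simp only [nextSol, Option.elim_some]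
  split_ifs with h
  · exact le_rfl
  · exact not_lt.1 fun h' => h ⟨he, h'⟩

end Next

/-! ### Resampling and a second-order inclusion-exclusion bound -/

section Averages

/-- Swapping the coordinate `W e` with the extra variable `j` is an involution of the index set. -/
theorem sum_resample {ι κ : Type*} [Fintype ι] [DecidableEq ι] [DecidableEq κ]
    (A : ι → Finset κ) (e : ι) (ψ : (ι → κ) → ℝ) :
    ∑ W ∈ Fintype.piFinset A, ∑ j ∈ A e, ψ (Function.update W e j) =
      (A e).card * ∑ W ∈ Fintype.piFinset A, ψ W := by
  rw [← Finset.sum_product', mul_comm, Finset.sum_mul]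
  have h2 : ∀ W ∈ Fintype.piFinset A, ψ W * ((A e).card : ℝ) = ∑ j ∈ A e, ψ W := by
    intro W _; simp [mul_comm]
  rw [Finset.sum_congr rfl h2, ← Finset.sum_product']
  refine Finset.sum_bij' (fun x _ => (Function.update x.1 e x.2, x.1 e))
    (fun x _ => (Function.update x.1 e x.2, x.1 e)) ?_ ?_ ?_ ?_ ?_
  · rintro ⟨W, j⟩ h
    rw [Finset.mem_product, Fintype.mem_piFinset] at h ⊢
    refine ⟨fun a => ?_, h.1 e⟩
    by_cases ha : a = e
    · subst ha; simpa using h.2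
    · simpa [ha] using h.1 a
  · rintro ⟨W, j⟩ h
    rw [Finset.mem_product, Fintype.mem_piFinset] at h ⊢
    refine ⟨fun a => ?_, h.1 e⟩
    by_cases ha : a = e
    · subst ha; simpa using h.2
    · simpa [ha] using h.1 a
  · rintro ⟨W, j⟩ _; simp
  · rintro ⟨W, j⟩ _; simp
  · rintro ⟨W, j⟩ _; simp

/-- In a product space, conditioning on `W e = i` amounts to setting this coordinate to `i` and
leaving the others alone. -/
theorem sum_condition {ι κ : Type*} [Fintype ι] [DecidableEq ι] [DecidableEq κ]
    (A : ι → Finset κ) (e : ι) (i : κ) (hi : i ∈ A e) (φ : (ι → κ) → ℝ) :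
    ∑ W ∈ Fintype.piFinset A, (if W e = i then ((A e).card : ℝ) * φ W else 0) =
      ∑ W ∈ Fintype.piFinset A, φ (Function.update W e i) := by
  have := sum_resample A e fun W => if W e = i then φ W else 0
  rw [Finset.mul_sum] at this
  simp only [Function.update_self, Finset.sum_ite_eq', if_pos hi, mul_ite, mul_zero] at this
  exact this.symm

theorem sum_resample_univ {ι κ : Type*} [Fintype ι] [DecidableEq ι] [Fintype κ] [DecidableEq κ]
    (e : ι) (ψ : (ι → κ) → ℝ) :
    ∑ W : ι → κ, ∑ j, ψ (Function.update W e j) = Fintype.card κ * ∑ W : ι → κ, ψ W := by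
  have := sum_resample (fun _ => (Finset.univ : Finset κ)) e ψ
  rwa [Fintype.piFinset_univ] at this

/-- With `s` the sum of the weights, the term of `e` is `g e * Y e * (1 - (s - Y e))`, and the last
factor is at most `1 / max 1 s`. So the whole sum is at most `Γ` times a total weight `s / max 1 s ≤
1`. -/
theorem sum_le_of_weights {ι : Type*} [DecidableEq ι] (O : Finset ι) (Y g : ι → ℝ) (Γ : ℝ)
    (hΓ : 0 ≤ Γ) (hY0 : ∀ e ∈ O, 0 ≤ Y e) (hY1 : ∀ e ∈ O, Y e ≤ 1) (hg : ∀ e ∈ O, 0 ≤ g e)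
    (hYg : ∀ e ∈ O, Y e ≠ 0 → g e ≤ Γ) :
    ∑ e ∈ O, g e * (Y e - ∑ e' ∈ O.erase e, Y e * Y e') ≤ Γ := by
  set s := ∑ e ∈ O, Y e with hs
  have hM : 0 < max 1 s := lt_of_lt_of_le one_pos (le_max_left _ _)
  have key : ∀ e ∈ O, g e * (Y e - ∑ e' ∈ O.erase e, Y e * Y e') ≤ Y e * (Γ / max 1 s) := by
    intro e he
    rw [← Finset.mul_sum, Finset.sum_erase_eq_sub he, ← hs]
    by_cases hz : Y e = 0
    · simp [hz]
    have hge := hYg e he hz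
    have h0 := hY0 e he
    have h1 := hY1 e he
    have hle : Y e ≤ s := Finset.single_le_sum hY0 he
    have hc : 1 - (s - Y e) ≤ 1 / max 1 s := by
      rw [le_div_iff₀ hM]
      rcases le_total s 1 with h | h
      · rw [max_eq_left h]; linarith
      -- As `Y e ≤ 1`, it suffices that `(2 - s) * s ≤ 1`.
      · rw [max_eq_right h]; nlinarith [sq_nonneg (s - 1)]
    have e1 : g e * (Y e - Y e * (s - Y e)) = Y e * (g e * (1 - (s - Y e))) := by ring
    rw [e1]
    refine mul_le_mul_of_nonneg_left ?_ h0
    rw [div_eq_mul_one_div]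
    exact (mul_le_mul_of_nonneg_left hc (hg e he)).trans
      (mul_le_mul_of_nonneg_right hge (by positivity))
  refine (Finset.sum_le_sum key).trans ?_
  rw [← Finset.sum_mul, ← hs, mul_div_assoc', div_le_iff₀ hM, mul_comm]
  exact mul_le_mul_of_nonneg_left (le_max_right _ _) hΓ

/-- The average of a quantity that dominates every `g e` with `Y e ≠ 0`, when the `Y e` have
mean `1 / m` and are pairwise independent or disjoint. -/
theorem sum_ge_of_pairwise {Ω ι : Type*} [DecidableEq ι] (s : Finset Ω) (O : Finset ι)
    (Y : ι → Ω → ℝ) (g : ι → ℝ) (Γ : Ω → ℝ) (N c : ℝ) (hΓ : ∀ ω ∈ s, 0 ≤ Γ ω)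
    (hY0 : ∀ e ∈ O, ∀ ω ∈ s, 0 ≤ Y e ω) (hY1 : ∀ e ∈ O, ∀ ω ∈ s, Y e ω ≤ 1)
    (hg : ∀ e ∈ O, 0 ≤ g e) (hYg : ∀ e ∈ O, ∀ ω ∈ s, Y e ω ≠ 0 → g e ≤ Γ ω)
    (h1 : ∀ e ∈ O, ∑ ω ∈ s, Y e ω = N)
    (h2 : ∀ e ∈ O, ∀ e' ∈ O, e' ≠ e → ∑ ω ∈ s, Y e ω * Y e' ω ≤ c) (hc : 0 ≤ c) :
    (N - O.card * c) * ∑ e ∈ O, g e ≤ ∑ ω ∈ s, Γ ω := by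
  have h3 : ∑ ω ∈ s, ∑ e ∈ O, g e * (Y e ω - ∑ e' ∈ O.erase e, Y e ω * Y e' ω) ≤
      ∑ ω ∈ s, Γ ω := by
    refine Finset.sum_le_sum fun ω hω => ?_
    exact sum_le_of_weights O (fun e => Y e ω) g (Γ ω) (hΓ ω hω) (fun e he => hY0 e he ω hω)
      (fun e he => hY1 e he ω hω) hg (fun e he => hYg e he ω hω)
  refine le_trans ?_ h3
  rw [Finset.sum_comm, Finset.mul_sum]
  refine Finset.sum_le_sum fun e he => ?_
  rw [← Finset.mul_sum, mul_comm]
  refine mul_le_mul_of_nonneg_left ?_ (hg e he)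
  rw [Finset.sum_sub_distrib, h1 e he, Finset.sum_comm]
  have h4 : ∑ e' ∈ O.erase e, ∑ ω ∈ s, Y e ω * Y e' ω ≤ ∑ e' ∈ O.erase e, c :=
    Finset.sum_le_sum fun e' he' =>
      h2 e he e' (Finset.mem_of_mem_erase he') (Finset.ne_of_mem_erase he')
  rw [Finset.sum_const, nsmul_eq_mul] at h4
  have h5 : ((O.erase e).card : ℝ) ≤ O.card := by
    exact_mod_cast Finset.card_le_card (Finset.erase_subset e O)
  nlinarith [mul_le_mul_of_nonneg_right h5 hc]

end Averages

/-! ### The ideal process and its histories -/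

section Ideal

variable {p n q : ℕ} (I : Problem p n q)

/-- The entry of a history (latest entry first) with index `x`. -/
def entry (h : List (Option (Fin n))) (x : ℕ) : Option (Fin n) := (h.reverse[x]?).join

/-- The solution after a history (latest entry first), where window `i` gives the entry `R i` of
the history a second chance. -/
noncomputable def sol (R : ℕ → ℕ) : List (Option (Fin n)) → List (Fin n)
  | [] => []
  | x :: h => nextSol I (sol R h) x (entry h (R h.length))

/-- Comparison by gain, with ties broken by the priorities `v`. -/
def Worse (v : Fin n → ℕ) (S : List (Fin n)) (e x : Fin n) : Prop :=
  gain I S e < gain I S x ∨ (gain I S e = gain I S x ∧ v e < v x)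

open Classical in
/-- The best item of `B`. -/
noncomputable def pick (v : Fin n → ℕ) (S : List (Fin n)) (B : Finset (Fin n)) :
    Option (Fin n) :=
  if h : ∃ x ∈ B, ∀ e ∈ B, e ≠ x → Worse I v S e x then some h.choose else none

/-- The history when item `e` belongs to window `W e`. -/
noncomputable def hist {m : ℕ} (v : Fin n → ℕ) (R : ℕ → ℕ) (W : Fin n → Fin m) :
    ℕ → List (Option (Fin n))
  | 0 => []
  | i + 1 => pick I v (sol I R (hist v R W i)) (Finset.univ.filter fun e => (W e : ℕ) = i) ::
      hist v R W i

open Classical in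
/-- The windows that are compatible with a history. -/
noncomputable def compat (m : ℕ) (v : Fin n → ℕ) (R : ℕ → ℕ) :
    List (Option (Fin n)) → Fin n → Finset (Fin m)
  | [], _ => Finset.univ
  | o :: h, e => (compat m v R h e).filter fun j => (o = some e → (j : ℕ) = h.length) ∧
      ((j : ℕ) = h.length → ∃ x, o = some x ∧ (e ≠ x → Worse I v (sol I R h) e x))

variable {I} {v : Fin n → ℕ} {m : ℕ}

theorem entry_cons_lt {h : List (Option (Fin n))} {o : Option (Fin n)} {x : ℕ}
    (hx : x < h.length) : entry (o :: h) x = entry h x := by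
  simp [entry, List.getElem?_append_left, hx]

theorem entry_length (h : List (Option (Fin n))) (o : Option (Fin n)) :
    entry (o :: h) h.length = o := by
  simp [entry]

theorem entry_of_le {h : List (Option (Fin n))} {x : ℕ} (hx : h.length ≤ x) :
    entry h x = none := by
  simp [entry, hx]

theorem exists_entry_iff {h : List (Option (Fin n))} {e : Fin n} :
    some e ∈ h ↔ ∃ x, entry h x = some e := by
  rw [← List.mem_reverse, List.mem_iff_getElem?]
  simp [entry, Option.join_eq_some_iff]

theorem lt_of_entry {h : List (Option (Fin n))} {e : Fin n} {x : ℕ}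
    (hx : entry h x = some e) : x < h.length := by
  by_contra hh
  rw [entry_of_le (not_lt.1 hh)] at hx
  simp at hx

theorem Worse.asymm {S : List (Fin n)} {e x : Fin n} (h : Worse I v S e x) :
    ¬ Worse I v S x e := by
  rintro (h' | ⟨h', h''⟩) <;> rcases h with h | ⟨h, h2⟩
  · exact lt_asymm h h'
  · exact h'.ne h.symm
  · exact h.ne h'.symm
  · exact lt_asymm h2 h''

theorem worse_total (hv : Function.Injective v) {S : List (Fin n)} {e x : Fin n} (h : e ≠ x) :
    Worse I v S e x ∨ Worse I v S x e := by
  rcases lt_trichotomy (gain I S e) (gain I S x) with h1 | h1 | h1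
  · exact Or.inl (Or.inl h1)
  · rcases lt_or_gt_of_ne (hv.ne h) with h2 | h2
    · exact Or.inl (Or.inr ⟨h1, h2⟩)
    · exact Or.inr (Or.inr ⟨h1.symm, h2⟩)
  · exact Or.inr (Or.inl h1)

theorem Worse.trans {S : List (Fin n)} {a b c : Fin n} (h : Worse I v S a b)
    (h' : Worse I v S b c) : Worse I v S a c := by
  rcases h with h | ⟨h, h2⟩ <;> rcases h' with h' | ⟨h', h2'⟩
  · exact Or.inl (h.trans h')
  · exact Or.inl (h' ▸ h)
  · exact Or.inl (h ▸ h')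
  · exact Or.inr ⟨h.trans h', h2.trans h2'⟩

theorem Worse.gain_le {S : List (Fin n)} {e x : Fin n} (h : Worse I v S e x) :
    gain I S e ≤ gain I S x := by
  rcases h with h | ⟨h, -⟩
  · exact h.le
  · exact h.le

theorem pick_eq_some_iff {S : List (Fin n)} {B : Finset (Fin n)} {x : Fin n} :
    pick I v S B = some x ↔ x ∈ B ∧ ∀ e ∈ B, e ≠ x → Worse I v S e x := by
  unfold pick
  constructor
  · intro h
    split_ifs at h with hh
    rw [← Option.some.inj h]
    exact hh.choose_spec
  · intro h
    have hh : ∃ x ∈ B, ∀ e ∈ B, e ≠ x → Worse I v S e x := ⟨x, h⟩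
    rw [dif_pos hh]
    congr 1
    by_contra hne
    exact (hh.choose_spec.2 x h.1 (Ne.symm hne)).asymm (h.2 _ hh.choose_spec.1 hne)

theorem pick_eq_none_iff (hv : Function.Injective v) {S : List (Fin n)} {B : Finset (Fin n)} :
    pick I v S B = none ↔ B = ∅ := by
  constructor
  · contrapose!
    intro hB
    suffices h : ∃ x ∈ B, ∀ e ∈ B, e ≠ x → Worse I v S e x by
      obtain ⟨x, hx⟩ := h
      rw [pick_eq_some_iff.2 hx]
      simp
    induction hB using Finset.Nonempty.cons_induction with
    | singleton a => exact ⟨a, by simp⟩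
    | cons a s ha hs ih =>
      obtain ⟨x, hx, hmax⟩ := ih
      have hax : a ≠ x := fun h => ha (h ▸ hx)
      rcases worse_total (I := I) hv (S := S) hax with h | h
      · refine ⟨x, Finset.mem_cons_of_mem hx, fun e he hne => ?_⟩
        rcases Finset.mem_cons.1 he with rfl | he
        · exact h
        · exact hmax e he hne
      · refine ⟨a, Finset.mem_cons_self a s, fun e he hne => ?_⟩
        rcases Finset.mem_cons.1 he with rfl | he
        · exact absurd rfl hne
        · by_cases hex : e = x
          · exact hex ▸ h
          · exact (hmax e he hex).trans h
  · rintro rfl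
    simp [pick]

theorem length_hist (R : ℕ → ℕ) (W : Fin n → Fin m) (i : ℕ) : (hist I v R W i).length = i := by
  induction i with
  | zero => rfl
  | succ i ih => simp [hist, ih]

/-- This is where independence survives conditioning. Once the earlier picks are given, the solution
is determined, and the next pick restricts every item separately: the picked item lies in this
window, and any other item lies elsewhere or is worse. So the assignments with a given history form
a product set. Injective priorities make the pick of a nonempty window well defined. -/
theorem hist_eq_iff (hv : Function.Injective v) (R : ℕ → ℕ) (W : Fin n → Fin m)
    (h : List (Option (Fin n))) :
    hist I v R W h.length = h ↔ ∀ e, W e ∈ compat I m v R h e := by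
  classical
  induction h with
  | nil => simp [hist, compat]
  | cons o h ih =>
    simp only [List.length_cons, hist, List.cons.injEq]
    have hstep : hist I v R W h.length = h → (pick I v (sol I R (hist I v R W h.length))
        (Finset.univ.filter fun e => (W e : ℕ) = h.length) = o ↔
        ∀ e, (o = some e → (W e : ℕ) = h.length) ∧ ((W e : ℕ) = h.length →
          ∃ x, o = some x ∧ (e ≠ x → Worse I v (sol I R h) e x))) := by
      intro hh
      rw [hh]
      cases o with
      | none =>
        rw [pick_eq_none_iff hv, Finset.filter_eq_empty_iff]
        simp
      | some x =>
        rw [pick_eq_some_iff]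
        simp only [Finset.mem_filter, Finset.mem_univ, true_and, Option.some.injEq]
        constructor
        · rintro ⟨h1, h2⟩ e
          exact ⟨fun hxe => hxe ▸ h1, fun he => ⟨x, rfl, h2 e he⟩⟩
        · intro hh
          refine ⟨(hh x).1 rfl, fun e he hne => ?_⟩
          obtain ⟨y, rfl, hy⟩ := (hh e).2 he
          exact hy hne
    constructor
    · rintro ⟨h1, h2⟩ e
      simp only [compat, Finset.mem_filter]
      exact ⟨ih.1 h2 e, (hstep h2).1 h1 e⟩
    · intro hh
      have h2 := ih.2 fun e => (Finset.mem_filter.1 (hh e)).1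
      exact ⟨(hstep h2).2 fun e => (Finset.mem_filter.1 (hh e)).2, h2⟩

/-- Past picks only exclude past windows for an item that was never picked, so the current window
keeps at least its original share among the possible ones. -/
theorem mem_compat {R : ℕ → ℕ} {h : List (Option (Fin n))} {e : Fin n} (he : some e ∉ h)
    {j : Fin m} (hj : h.length ≤ j) : j ∈ compat I m v R h e := by
  classical
  induction h with
  | nil => simp [compat]
  | cons o h ih =>
    simp only [List.mem_cons, not_or, List.length_cons] at he hj
    simp only [compat, Finset.mem_filter]
    exact ⟨ih he.2 (by omega), fun h' => absurd h'.symm he.1, fun h' => by omega⟩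

/-- The history reveals the windows of its items; in particular no item occurs in it twice. -/
theorem window_of_entry {R : ℕ → ℕ} {h : List (Option (Fin n))} {W : Fin n → Fin m}
    (hW : ∀ e, W e ∈ compat I m v R h e) {e : Fin n} {x : ℕ} (hx : entry h x = some e) :
    (W e : ℕ) = x := by
  classical
  induction h with
  | nil => simp [entry] at hx
  | cons o h ih =>
    have h1 : ∀ e, W e ∈ compat I m v R h e := fun e => (Finset.mem_filter.1 (hW e)).1
    rcases lt_or_eq_of_le (Nat.le_of_lt_succ (lt_of_entry hx)) with hlt | rfl
    · exact ih h1 (by rwa [entry_cons_lt hlt] at hx)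
    · rw [entry_length] at hx
      exact (Finset.mem_filter.1 (hW e)).2.1 hx

theorem sol_feasible (R : ℕ → ℕ) (h : List (Option (Fin n))) :
    I.Feasible (sol I R h).toFinset := by
  induction h with
  | nil => simpa [sol] using I.feasible_empty
  | cons o h ih =>
    rw [sol]
    rcases nextSol_cases (I := I) (sol I R h) o (entry h (R h.length)) with
      hh | ⟨e, -, hh⟩ | ⟨e, -, -, hh⟩ <;> rw [hh]
    · exact ih
    · exact swapTo_feasible ih e
    · exact swapTo_feasible ih e

theorem sol_subset (R : ℕ → ℕ) (h : List (Option (Fin n))) :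
    ∀ e ∈ sol I R h, some e ∈ h := by
  induction h with
  | nil => simp [sol]
  | cons o h ih =>
    intro e he
    rw [sol] at he
    rcases nextSol_cases (I := I) (sol I R h) o (entry h (R h.length)) with
      hh | ⟨y, hy, hh⟩ | ⟨y, hy, -, hh⟩ <;> rw [hh] at he
    · exact List.mem_cons_of_mem _ (ih e he)
    · rcases List.mem_cons.1 (applySwap_subset _ _ _ he) with rfl | he
      · exact hy ▸ List.mem_cons_self
      · exact List.mem_cons_of_mem _ (ih e he)
    · rcases List.mem_cons.1 (applySwap_subset _ _ _ he) with rfl | he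
      · exact List.mem_cons_of_mem _ (exists_entry_iff.2 ⟨_, hy⟩)
      · exact List.mem_cons_of_mem _ (ih e he)

theorem sol_congr {R R' : ℕ → ℕ} {h : List (Option (Fin n))}
    (hR : ∀ i < h.length, R i = R' i) : sol I R h = sol I R' h := by
  induction h with
  | nil => rfl
  | cons o h ih =>
    simp only [List.length_cons] at hR
    rw [sol, sol, ih fun i hi => hR i (by omega), hR _ (Nat.lt_succ_self _)]

/-- The past does not depend on the second-chance choice of the current window, which may therefore
be averaged over separately. -/
theorem hist_congr {R R' : ℕ → ℕ} (W : Fin n → Fin m) {i : ℕ} (hR : ∀ j < i, R j = R' j) :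
    hist I v R W i = hist I v R' W i := by
  induction i with
  | zero => rfl
  | succ i ih =>
    have h1 := ih fun j hj => hR j (by omega)
    have h2 : sol I R (hist I v R W i) = sol I R' (hist I v R W i) :=
      sol_congr fun j hj => hR j (by rw [length_hist] at hj; omega)
    rw [hist, hist, h2, h1]

end Ideal

/-! ### Expected progress of the ideal solution -/

section Progress

variable {p n q : ℕ} {I : Problem p n q} {v : Fin n → ℕ} {m : ℕ}

theorem exists_opt (I : Problem p n q) : ∃ O, I.Feasible O ∧ O.card ≤ I.k ∧ I.f O = I.opt := by
  classical
  obtain ⟨O, hO, h⟩ := Finset.exists_mem_eq_sup' (I.feasibleIn_nonempty Finset.univ) I.f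
  refine ⟨O, ?_, Finset.le_sup (f := Finset.card) hO, h.symm⟩
  simp only [Problem.feasibleIn, Finset.mem_filter] at hO
  exact hO.2

/-- Conditioned on the history `h`, the pair of the second-chance choice `x` and the window
assignment `W` is uniform on a product set. Each item of an optimal set has a weight of mean `1 / m`
that is nonzero only when the item is available to the next update, and `sum_ge_of_pairwise` turns
this into the progress. The assignment `W0` witnesses that `h` can occur, which makes the windows of
its items unique. -/
theorem step_progress (hv : Function.Injective v) (R : ℕ → ℕ) (h : List (Option (Fin n)))
    (hm : h.length < m) (hk : I.k ≤ m) (W0 : Fin n → Fin m)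
    (hW0 : ∀ e, W0 e ∈ compat I m v R h e) :
    (1 - (I.k : ℝ) / m) * ((Fintype.piFinset (compat I m v R h)).card *
      (I.opt - (p + 1) * I.f (sol I R h).toFinset)) ≤
    ∑ x : Fin m, ∑ W ∈ Fintype.piFinset (compat I m v R h),
      (I.f (nextSol I (sol I R h) (pick I v (sol I R h)
        (Finset.univ.filter fun e => (W e : ℕ) = h.length)) (entry h x)).toFinset -
        I.f (sol I R h).toFinset) := by
  classical
  set A := compat I m v R h with hA
  set S := sol I R h with hS
  have hm0 : (0 : ℝ) < m := by exact_mod_cast (Nat.zero_le _).trans_lt hm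
  let i : Fin m := ⟨h.length, hm⟩
  obtain ⟨O, hO, hOk, hOf⟩ := exists_opt I
  let N : ℝ := (Fintype.piFinset A).card
  have hN : 0 ≤ N := Nat.cast_nonneg _
  let s : Finset (Fin m × (Fin n → Fin m)) := Finset.univ ×ˢ Fintype.piFinset A
  -- A picked item is available when `x` points to its entry. An item not yet picked is available
  -- when it falls into window `i`, which has probability `1 / (A e).card`; the factor `(A e).card /
  -- m ≤ 1` lowers the mean to `1 / m`.
  let Z : Fin n → Fin m → (Fin n → Fin m) → ℝ := fun e x W =>
    if some e ∈ h then (if entry h x = some e then 1 else 0)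
    else if W e = i then ((A e).card : ℝ) * (1 / m) else 0
  let Y : Fin n → Fin m × (Fin n → Fin m) → ℝ := fun e ω => Z e ω.1 ω.2
  let g : Fin n → ℝ := fun e => if e ∈ S then 0 else gain I S e - I.f S.toFinset
  have hcard : ∀ e, ((A e).card : ℝ) ≤ m := by
    intro e
    exact_mod_cast (Finset.card_le_univ (A e)).trans (by simp)
  have hone : ∀ e, some e ∈ h → ∑ x : Fin m, (if entry h x = some e then (1 : ℝ) else 0) = 1 := by
    intro e he
    obtain ⟨x, hx⟩ := exists_entry_iff.1 he
    have hxm : x < m := (lt_of_entry hx).trans hm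
    rw [Finset.sum_eq_single (⟨x, hxm⟩ : Fin m), if_pos hx]
    · intro b _ hb
      rw [if_neg]
      intro hb'
      exact hb (Fin.ext ((window_of_entry hW0 hb').symm.trans (window_of_entry hW0 hx)))
    · simp
  have hcond : ∀ e, some e ∉ h → ∀ φ : (Fin n → Fin m) → ℝ,
      ∑ W ∈ Fintype.piFinset A, (if W e = i then ((A e).card : ℝ) * (1 / m) else 0) * φ W =
        (1 / m) * ∑ W ∈ Fintype.piFinset A, φ (Function.update W e i) := by
    intro e he φ
    rw [← sum_condition A e i (mem_compat he le_rfl) φ, Finset.mul_sum]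
    refine Finset.sum_congr rfl fun W _ => ?_
    split_ifs <;> ring
  have hmean : ∀ e, some e ∉ h →
      ∑ W ∈ Fintype.piFinset A, (if W e = i then ((A e).card : ℝ) * (1 / m) else 0) = N / m := by
    intro e he
    have := hcond e he fun _ => 1
    simp only [mul_one, Finset.sum_const, nsmul_eq_mul] at this
    rw [this]
    simp only [N]; ring
  have h1 : ∀ e ∈ O, ∑ ω ∈ s, Y e ω = N := by
    intro e _
    rw [Finset.sum_product]
    change ∑ x, ∑ W ∈ Fintype.piFinset A, Z e x W = N
    by_cases he : some e ∈ h
    · simp only [Z, if_pos he, Finset.sum_const, nsmul_eq_mul]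
      rw [← Finset.mul_sum, hone e he, mul_one]
    · simp only [Z, if_neg he, hmean e he, Finset.sum_const, nsmul_eq_mul, Finset.card_univ,
        Fintype.card_fin]
      field_simp
  have h2 : ∀ e ∈ O, ∀ e' ∈ O, e' ≠ e → ∑ ω ∈ s, Y e ω * Y e' ω ≤ N / m := by
    intro e _ e' _ hne
    rw [Finset.sum_product]
    change ∑ x, ∑ W ∈ Fintype.piFinset A, Z e x W * Z e' x W ≤ N / m
    -- Two picked items are distinct entries, so their weights are never nonzero together. In the
    -- other cases the weights depend on different coordinates of `(x, W)` and are independent.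
    by_cases he : some e ∈ h <;> by_cases he' : some e' ∈ h
    · refine le_trans (le_of_eq ?_) (by positivity : (0 : ℝ) ≤ N / m)
      refine Finset.sum_eq_zero fun x _ => Finset.sum_eq_zero fun W _ => ?_
      simp only [Z, if_pos he, if_pos he']
      split_ifs with a b <;> simp
      rw [a] at b
      exact hne (Option.some.inj b).symm
    · simp only [Z, if_pos he, if_neg he', ← Finset.mul_sum, hmean e' he', ← Finset.sum_mul,
        hone e he, one_mul, le_refl]
    · simp only [Z, if_neg he, if_pos he', ← Finset.mul_sum, hmean e he, ← Finset.sum_mul,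
        hone e' he', mul_one, le_refl]
    · simp only [Z, if_neg he, if_neg he']
      have : ∀ W : Fin n → Fin m, Function.update W e i e' = W e' :=
        fun W => Function.update_of_ne hne _ _
      simp only [hcond e he, this, hmean e' he', Finset.sum_const, nsmul_eq_mul,
        Finset.card_univ, Fintype.card_fin]
      refine le_of_eq ?_
      field_simp
  have hmain := sum_ge_of_pairwise s O Y g (fun ω =>
      I.f (nextSol I S (pick I v S
        (Finset.univ.filter fun e => (ω.2 e : ℕ) = h.length)) (entry h ω.1)).toFinset -
        I.f S.toFinset) N (N / m)
    (fun ω _ => sub_nonneg.2 (le_nextSol _ _ _)) ?_ ?_ ?_ ?_ h1 h2 (by positivity)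
  · have hsum : I.opt - (p + 1) * I.f S.toFinset ≤ ∑ e ∈ O, g e := by
      rw [← hOf]
      refine (sum_gain_ge (sol_feasible R h) hO).trans (le_of_eq ?_)
      simp only [g, Finset.sum_ite, Finset.sum_const_zero, zero_add]
      refine Finset.sum_congr ?_ fun _ _ => rfl
      ext x
      simp [hS]
    have hkm : (0 : ℝ) ≤ 1 - I.k / m := by
      rw [sub_nonneg, div_le_one hm0]
      exact_mod_cast hk
    have hg0 : 0 ≤ ∑ e ∈ O, g e := Finset.sum_nonneg fun e _ => by
      simp only [g]
      split_ifs
      · exact le_rfl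
      · exact sub_nonneg.2 (le_gain _ _)
    rw [Finset.sum_product] at hmain
    refine le_trans ?_ hmain
    calc _ ≤ (1 - (I.k : ℝ) / m) * (N * ∑ e ∈ O, g e) := by gcongr
      _ = (N - I.k * (N / m)) * ∑ e ∈ O, g e := by ring
      _ ≤ _ := by
        have : (O.card : ℝ) ≤ I.k := by exact_mod_cast hOk
        gcongr
  · intro e _ ω _
    simp only [Y, Z]
    split_ifs <;> positivity
  · intro e _ ω _
    simp only [Y, Z]
    split_ifs
    · exact le_rfl
    · exact zero_le_one
    · rw [mul_one_div, div_le_one hm0]; exact hcard e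
    · exact zero_le_one
  · intro e _
    simp only [g]
    split_ifs
    · exact le_rfl
    · exact sub_nonneg.2 (le_gain _ _)
  · intro e _ ω hω hY
    simp only [g]
    split_ifs with heS
    · exact sub_nonneg.2 (le_nextSol _ _ _)
    refine sub_le_sub_right ?_ _
    by_cases he : some e ∈ h
    · simp only [Y, Z, if_pos he] at hY
      have hx : entry h ω.1 = some e := by
        by_contra hx
        exact hY (if_neg hx)
      rw [hx]
      exact gain_le_nextSol_right _ heS
    · simp only [Y, Z, if_neg he] at hY
      have hx : ω.2 e = i := by
        by_contra hx
        exact hY (if_neg hx)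
      -- If `e` lies in the window, the best item of the window gains at least as much, and the
      -- second chance cannot undo this.
      refine le_trans ?_ (le_nextSol_left _ _ _)
      have hmem : e ∈ Finset.univ.filter fun e => (ω.2 e : ℕ) = h.length := by
        simp [hx, i]
      cases hp : pick I v S (Finset.univ.filter fun e => (ω.2 e : ℕ) = h.length) with
      | none =>
        rw [(pick_eq_none_iff hv).1 hp] at hmem
        simp at hmem
      | some y =>
        by_cases hye : e = y
        · rw [hye]; exact le_rfl
        · exact ((pick_eq_some_iff.1 hp).2 e hmem hye).gain_le

/-- The reintroduction choices as a function on all natural numbers. -/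
def toNatFun {m : ℕ} (R : Fin m → Fin m) (i : ℕ) : ℕ := if h : i < m then R ⟨i, h⟩ else 0

theorem hist_progress (hv : Function.Injective v) (hm : 0 < m) (hk : I.k ≤ m) (i : ℕ)
    (hi : i < m) :
    (1 - (I.k : ℝ) / m) / m * ∑ R : Fin m → Fin m, ∑ W : Fin n → Fin m,
      (I.opt - (p + 1) * I.f (sol I (toNatFun R) (hist I v (toNatFun R) W i)).toFinset) ≤
    ∑ R : Fin m → Fin m, ∑ W : Fin n → Fin m,
      (I.f (sol I (toNatFun R) (hist I v (toNatFun R) W (i + 1))).toFinset -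
        I.f (sol I (toNatFun R) (hist I v (toNatFun R) W i)).toFinset) := by
  classical
  have hm0 : (0 : ℝ) < m := by exact_mod_cast hm
  have hupd : ∀ (R : Fin m → Fin m) (x : Fin m), ∀ j < i,
      toNatFun (Function.update R ⟨i, hi⟩ x) j = toNatFun R j := by
    intro R x j hj
    simp only [toNatFun]
    split_ifs with h
    · rw [Function.update_of_ne]
      intro hh
      exact hj.ne (congrArg Fin.val hh)
    · rfl
  have hupd' : ∀ (R : Fin m → Fin m) (x : Fin m),
      toNatFun (Function.update R ⟨i, hi⟩ x) i = x := by
    intro R x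
    simp [toNatFun, hi]
  -- The coordinate `R i` becomes the free variable `x` of `step_progress`.
  have hres := sum_resample_univ (⟨i, hi⟩ : Fin m) fun R : Fin m → Fin m =>
    ∑ W : Fin n → Fin m,
      (I.f (sol I (toNatFun R) (hist I v (toNatFun R) W (i + 1))).toFinset -
        I.f (sol I (toNatFun R) (hist I v (toNatFun R) W i)).toFinset)
  rw [Fintype.card_fin] at hres
  rw [div_mul_eq_mul_div, div_le_iff₀ hm0, mul_comm _ (m : ℝ), ← hres, Finset.mul_sum]
  refine Finset.sum_le_sum fun R _ => ?_
  set r := toNatFun R with hr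
  have hrw : ∀ (x : Fin m) (W : Fin n → Fin m),
      I.f (sol I (toNatFun (Function.update R ⟨i, hi⟩ x))
        (hist I v (toNatFun (Function.update R ⟨i, hi⟩ x)) W (i + 1))).toFinset -
      I.f (sol I (toNatFun (Function.update R ⟨i, hi⟩ x))
        (hist I v (toNatFun (Function.update R ⟨i, hi⟩ x)) W i)).toFinset =
      I.f (nextSol I (sol I r (hist I v r W i)) (pick I v (sol I r (hist I v r W i))
        (Finset.univ.filter fun e => (W e : ℕ) = (hist I v r W i).length))
        (entry (hist I v r W i) x)).toFinset - I.f (sol I r (hist I v r W i)).toFinset := by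
    intro x W
    have e1 : hist I v (toNatFun (Function.update R ⟨i, hi⟩ x)) W i = hist I v r W i :=
      hist_congr W (hupd R x)
    have e2 : sol I (toNatFun (Function.update R ⟨i, hi⟩ x)) (hist I v r W i) =
        sol I r (hist I v r W i) :=
      sol_congr fun j hj => hupd R x j (by rwa [length_hist] at hj)
    rw [hist, sol, e1, e2, length_hist, hupd']
  simp only [hrw]
  rw [Finset.sum_comm, Finset.mul_sum]
  -- Group the assignments by their history before window `i`; each group is a product set, so the
  -- one-window estimate applies to it.
  rw [← Finset.sum_fiberwise_of_maps_to (t := Finset.univ.image fun W => hist I v r W i)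
    (g := fun W => hist I v r W i) (fun W _ => Finset.mem_image_of_mem _ (Finset.mem_univ W)),
    ← Finset.sum_fiberwise_of_maps_to (t := Finset.univ.image fun W => hist I v r W i)
    (g := fun W => hist I v r W i) (fun W _ => Finset.mem_image_of_mem _ (Finset.mem_univ W))]
  refine Finset.sum_le_sum fun h hh => ?_
  obtain ⟨W0, -, rfl⟩ := Finset.mem_image.1 hh
  set h := hist I v r W0 i with hh'
  have hlen : h.length = i := length_hist r W0 i
  have hfib : (Finset.univ.filter fun W : Fin n → Fin m => hist I v r W i = h) =
      Fintype.piFinset (compat I m v r h) := by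
    ext W
    rw [Finset.mem_filter, Fintype.mem_piFinset, ← hist_eq_iff hv, hlen]
    simp
  have hW0 : ∀ e, W0 e ∈ compat I m v r h e := by
    rw [← hist_eq_iff hv, hlen]
  have hst := step_progress hv r h (by omega) hk W0 hW0
  rw [Finset.sum_comm] at hst
  rw [hfib]
  have hmem : ∀ W ∈ Fintype.piFinset (compat I m v r h), hist I v r W i = h := by
    intro W hW
    rw [← hfib] at hW
    exact (Finset.mem_filter.1 hW).2
  rw [← Finset.mul_sum, Finset.sum_congr rfl (g := fun _ =>
    I.opt - (p + 1) * I.f (sol I r h).toFinset) (fun W hW => by rw [hmem W hW]),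
    Finset.sum_const, nsmul_eq_mul]
  refine hst.trans (le_of_eq ?_)
  refine Finset.sum_congr rfl fun W hW => ?_
  rw [hmem W hW]

/-- The deficit `B - y * a i` shrinks in each step by the factor `1 - c * y ≤ exp (-(c * y))` while
it is nonnegative. Once it is negative it stays so by monotonicity, which avoids any assumption on
the sign of `1 - c * y`. -/
theorem recursion_bound (a : ℕ → ℝ) (c y B : ℝ) (hy : 0 < y) (hB : 0 ≤ B)
    (h0 : 0 ≤ a 0) (m : ℕ) (hmono : ∀ i < m, a i ≤ a (i + 1))
    (hstep : ∀ i < m, c * (B - y * a i) ≤ a (i + 1) - a i) :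
    B / y * (1 - Real.exp (-(m * (c * y)))) ≤ a m := by
  have key : ∀ i ≤ m, B - y * a i ≤ B * Real.exp (-(i * (c * y))) := by
    intro i
    induction i with
    | zero => intro _; simp; positivity
    | succ i ih =>
      intro hi
      have h1 := ih (by omega)
      have h2 := hstep i (by omega)
      have h3 := hmono i (by omega)
      rcases le_total (B - y * a i) 0 with h | h
      · have : B - y * a (i + 1) ≤ 0 := by nlinarith
        exact this.trans (by positivity)
      · have h4 : B - y * a (i + 1) ≤ (B - y * a i) * (1 - c * y) := by nlinarith
        have h5 : 1 - c * y ≤ Real.exp (-(c * y)) := by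
          have := Real.add_one_le_exp (-(c * y)); linarith
        calc B - y * a (i + 1) ≤ (B - y * a i) * (1 - c * y) := h4
          _ ≤ (B - y * a i) * Real.exp (-(c * y)) := by gcongr
          _ ≤ B * Real.exp (-(i * (c * y))) * Real.exp (-(c * y)) := by gcongr
          _ = B * Real.exp (-((i + 1 : ℕ) * (c * y))) := by
            rw [mul_assoc, ← Real.exp_add]; congr 2; push_cast; ring
  have := key m le_rfl
  rw [div_mul_eq_mul_div, div_le_iff₀ hy]
  linarith

/-- The average value of the ideal solution. -/
theorem ideal_bound (hv : Function.Injective v) (hm : 0 < m) (hk : I.k ≤ m) :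
    (Fintype.card (Fin m → Fin m) * Fintype.card (Fin n → Fin m) : ℝ) *
      (I.opt / (p + 1) * (1 - Real.exp (-((1 - I.k / m) * (p + 1))))) ≤
    ∑ R : Fin m → Fin m, ∑ W : Fin n → Fin m,
      I.f (sol I (toNatFun R) (hist I v (toNatFun R) W m)).toFinset := by
  have hm0 : (0 : ℝ) < m := by exact_mod_cast hm
  have hkm : (0 : ℝ) ≤ 1 - I.k / m := by
    rw [sub_nonneg, div_le_one hm0]
    exact_mod_cast hk
  set T : ℝ := Fintype.card (Fin m → Fin m) * Fintype.card (Fin n → Fin m) with hT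
  have hopt : 0 ≤ I.opt := by
    obtain ⟨O, -, -, h⟩ := exists_opt I
    exact h ▸ I.nonneg O
  have := recursion_bound (fun i => ∑ R : Fin m → Fin m, ∑ W : Fin n → Fin m,
      I.f (sol I (toNatFun R) (hist I v (toNatFun R) W i)).toFinset)
    ((1 - (I.k : ℝ) / m) / m) (p + 1) (T * I.opt) (by positivity)
    (by positivity) (Finset.sum_nonneg fun R _ => Finset.sum_nonneg fun W _ => I.nonneg _) m
    (fun i _ => Finset.sum_le_sum fun R _ => Finset.sum_le_sum fun W _ => le_nextSol _ _ _) ?_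
  · refine le_trans (le_of_eq ?_) this
    have e1 : (m : ℝ) * ((1 - I.k / m) / m * (p + 1)) = (1 - I.k / m) * (p + 1) := by
      field_simp
    rw [e1]
    ring
  · intro i hi
    have h := hist_progress hv hm hk i hi
    simp only [Finset.sum_sub_distrib, ← Finset.mul_sum] at h
    simp only [Finset.sum_const, nsmul_eq_mul, Finset.card_univ] at h
    rw [hT, mul_assoc]
    exact h

end Progress

/-! ### Records of a random order -/

section Records

open Classical in
/-- The number of indices `i < s` such that all the later values are worse than the value at
`i`. -/
noncomputable def recs {α : Type*} (lt : α → α → Prop) {w : ℕ} (s : ℕ) (x : Fin w → α) : ℕ :=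
  (Finset.univ.filter fun i : Fin w => (i : ℕ) < s ∧ ∀ j, i < j → lt (x j) (x i)).card

theorem recs_succ {α : Type*} (lt : α → α → Prop) {w : ℕ} (s : ℕ) (x : Fin (w + 1) → α)
    [Decidable (∀ j : Fin w, lt (x j.succ) (x 0))] :
    recs lt (s + 1) x = (if ∀ j : Fin w, lt (x j.succ) (x 0) then 1 else 0) +
      recs lt s (fun i : Fin w => x i.succ) := by
  classical
  simp only [recs, Finset.card_filter]
  rw [Fin.sum_univ_succ]
  congr 1
  · congr 1
    simp only [Fin.val_zero, Nat.zero_lt_succ, true_and, eq_iff_iff]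
    constructor
    · intro h j; exact h _ (Fin.succ_pos j)
    · intro h j hj
      obtain ⟨i, rfl⟩ := Fin.exists_succ_eq.2 hj.ne'
      exact h i
  · refine Finset.sum_congr rfl fun i _ => ?_
    congr 1
    simp only [Fin.val_succ, add_lt_add_iff_right, eq_iff_iff]
    refine and_congr_right fun _ => ?_
    constructor
    · intro h j hj; exact h _ (Fin.succ_lt_succ_iff.2 hj)
    · intro h j hj
      obtain ⟨k, rfl⟩ := Fin.exists_succ_eq.2 (lt_of_le_of_lt (Fin.zero_le _) hj).ne'
      exact h k (Fin.succ_lt_succ_iff.1 hj)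

/-- The exponential moment of the number of records of a random order. -/
theorem sum_two_pow_recs_le {α : Type*} (lt : α → α → Prop) (hlt : ∀ a b, lt a b → ¬ lt b a)
    (w : ℕ) : ∀ (s : ℕ) (x : Fin w → α), s ≤ w →
    (∑ τ : Equiv.Perm (Fin w), 2 ^ recs lt s (x ∘ τ)) * (w - s + 1) ≤ (w + 1).factorial := by
  classical
  induction w with
  | zero =>
    intro s x hs
    obtain rfl : s = 0 := by omega
    simp [recs]
  | succ w ih =>
    intro s x hs
    cases s with
    | zero => simp [recs, Fintype.card_perm, Nat.factorial_succ (w + 1), mul_comm]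
    | succ s =>
      -- Index `0` contributes a factor `2` only if it receives the top value. There is at most one
      -- such value, so the sum of the factors over the `w + 1` possible values is at most `w + 2`,
      -- and the product of the averages telescopes.
      let top : Fin (w + 1) → Prop := fun a => ∀ b, b ≠ a → lt (x b) (x a)
      have htop : (∑ a : Fin (w + 1), if top a then 2 else 1) ≤ w + 2 := by
        have : ∀ a, (if top a then 2 else 1) = 1 + if top a then 1 else 0 := by
          intro a; split_ifs <;> rfl
        simp only [this, Finset.sum_add_distrib, Finset.sum_const, Finset.card_univ,
          Fintype.card_fin, smul_eq_mul, mul_one]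
        have h2 : (∑ a : Fin (w + 1), if top a then 1 else 0) = (Finset.univ.filter top).card :=
          (Finset.card_filter _ _).symm
        have : (Finset.univ.filter top).card ≤ 1 := by
          rw [Finset.card_le_one]
          intro a ha b hb
          by_contra hne
          exact hlt _ _ ((Finset.mem_filter.1 ha).2 b (Ne.symm hne))
            ((Finset.mem_filter.1 hb).2 a hne)
        omega
      -- Split a permutation into the image `a` of `0` and a permutation of the remaining indices.
      rw [← Equiv.sum_comp Equiv.Perm.decomposeFin.symm, Fintype.sum_prod_type]
      have hterm : ∀ (a : Fin (w + 1)) (e : Equiv.Perm (Fin w)),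
          2 ^ recs lt (s + 1) (x ∘ Equiv.Perm.decomposeFin.symm (a, e)) ≤
          (if top a then 2 else 1) *
            2 ^ recs lt s ((fun i : Fin w => x (Equiv.swap 0 a i.succ)) ∘ e) := by
        intro a e
        rw [recs_succ, pow_add]
        have e1 : (fun i : Fin w => (x ∘ Equiv.Perm.decomposeFin.symm (a, e)) i.succ) =
            (fun i : Fin w => x (Equiv.swap 0 a i.succ)) ∘ e := by
          funext i
          simp
        rw [e1]
        refine Nat.mul_le_mul_right _ ?_
        by_cases ht : top a
        · rw [if_pos ht]
          split_ifs <;> norm_num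
        · rw [if_neg ht, if_neg]
          · norm_num
          · intro h
            refine ht fun b hb => ?_
            have hsurj := (Equiv.Perm.decomposeFin.symm (a, e)).surjective b
            obtain ⟨j, hj⟩ := hsurj
            have hj0 : j ≠ 0 := by
              rintro rfl
              simp at hj
              exact hb hj.symm
            obtain ⟨i, rfl⟩ := Fin.exists_succ_eq.2 hj0
            have := h i
            simp only [Function.comp_apply, hj] at this
            simpa using this
      have hws : w + 1 - (s + 1) + 1 = w - s + 1 := by omega
      rw [hws]
      calc _ ≤ (∑ a : Fin (w + 1), (if top a then 2 else 1) * ∑ e : Equiv.Perm (Fin w),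
            2 ^ recs lt s ((fun i : Fin w => x (Equiv.swap 0 a i.succ)) ∘ e)) * (w - s + 1) := by
            refine Nat.mul_le_mul_right _ (Finset.sum_le_sum fun a _ => ?_)
            rw [Finset.mul_sum]
            exact Finset.sum_le_sum fun e _ => hterm a e
        _ ≤ ∑ a : Fin (w + 1), (if top a then 2 else 1) * (w + 1).factorial := by
            rw [Finset.sum_mul]
            refine Finset.sum_le_sum fun a _ => ?_
            rw [mul_assoc]
            exact Nat.mul_le_mul_left _ (ih s _ (by omega))
        _ ≤ (w + 2) * (w + 1).factorial := by
            rw [← Finset.sum_mul]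
            exact Nat.mul_le_mul_right _ htop
        _ = _ := (Nat.factorial_succ (w + 1)).symm

theorem card_perm_apply_eq (w : ℕ) (i j : Fin w) :
    (Finset.univ.filter fun τ : Equiv.Perm (Fin w) => τ j = i).card * w = w.factorial := by
  have h : ∀ j', (Finset.univ.filter fun τ : Equiv.Perm (Fin w) => τ j' = i).card =
      (Finset.univ.filter fun τ : Equiv.Perm (Fin w) => τ j = i).card := by
    intro j'
    refine Finset.card_bij (fun τ _ => τ * Equiv.swap j j') ?_ ?_ ?_
    · intro τ hτ
      simpa using hτ
    · intro τ _ τ' _ h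
      exact mul_right_cancel h
    · intro τ hτ
      refine ⟨τ * Equiv.swap j j', ?_, ?_⟩
      · simpa using hτ
      · rw [mul_assoc, Equiv.swap_mul_self, mul_one]
  have h2 := Finset.card_eq_sum_card_fiberwise (s := (Finset.univ : Finset (Equiv.Perm (Fin w))))
    (t := (Finset.univ : Finset (Fin w))) (f := fun τ => τ.symm i) (by simp)
  rw [Finset.card_univ, Fintype.card_perm, Fintype.card_fin] at h2
  rw [h2]
  have h3 : ∀ j', (Finset.univ.filter fun τ : Equiv.Perm (Fin w) => τ.symm i = j').card =
      (Finset.univ.filter fun τ : Equiv.Perm (Fin w) => τ j = i).card := by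
    intro j'
    rw [← h j']
    congr 1
    ext τ
    simp only [Finset.mem_filter, Finset.mem_univ, true_and]
    rw [Equiv.symm_apply_eq, eq_comm]
  rw [Finset.sum_congr rfl fun j' _ => h3 j']
  simp [mul_comm]

theorem card_perm_symm_ge (w s : ℕ) (i : Fin w) :
    (Finset.univ.filter fun τ : Equiv.Perm (Fin w) => s ≤ (τ.symm i : ℕ)).card * w =
      (w - s) * w.factorial := by
  classical
  have h := Finset.card_eq_sum_card_fiberwise
    (s := Finset.univ.filter fun τ : Equiv.Perm (Fin w) => s ≤ (τ.symm i : ℕ))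
    (t := Finset.univ.filter fun j : Fin w => s ≤ (j : ℕ)) (f := fun τ => τ.symm i)
    (by intro τ hτ; simpa using hτ)
  rw [h, Finset.sum_mul]
  have h2 : ∀ j ∈ Finset.univ.filter fun j : Fin w => s ≤ (j : ℕ),
      ((Finset.univ.filter fun τ : Equiv.Perm (Fin w) => s ≤ (τ.symm i : ℕ)).filter
        fun τ => τ.symm i = j).card * w = w.factorial := by
    intro j hj
    rw [← card_perm_apply_eq w i j]
    congr 2
    ext τ
    simp only [Finset.mem_filter, Finset.mem_univ, true_and] at hj ⊢
    rw [Equiv.symm_apply_eq]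
    constructor
    · intro h; exact h.2.symm
    · intro h
      refine ⟨?_, h.symm⟩
      rw [← h, Equiv.symm_apply_apply]; exact hj
  rw [Finset.sum_congr rfl h2, Finset.sum_const, smul_eq_mul]
  congr 1
  have : (Finset.univ.filter fun j : Fin w => s ≤ (j : ℕ)).card =
      ((Finset.range w).filter fun j => s ≤ j).card := by
    rw [Finset.card_filter, Finset.card_filter, ← Fin.sum_univ_eq_sum_range
      (fun j => if s ≤ j then 1 else 0) w]
  rw [this]
  have : (Finset.range w).filter (fun j => s ≤ j) = Finset.Ico s w := by
    ext j; simp [and_comm]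
  rw [this, Nat.card_Ico]

end Records

/-! ### Online selection inside a window -/

section Scan

variable {p n q : ℕ} (I : Problem p n q)

open Classical in
/-- Process the items `it 0, …, it (r - 1)` of a window with `w` items: the best item, and the
items that are put on the shortlist. -/
noncomputable def scan (D L w : ℕ) (v : Fin n → ℕ) (S : List (Fin n)) (it : ℕ → Fin n) :
    ℕ → Option (Fin n) × List (Fin n)
  | 0 => (none, [])
  | r + 1 =>
    let c := scan D L w v S it r
    if ∀ b, c.1 = some b → Worse I v S b (it r) then
      (some (it r), if w < D * (r + 1) ∧ c.2.length < L then it r :: c.2 else c.2)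
    else c

variable {I} {D L w : ℕ} {v : Fin n → ℕ} {S : List (Fin n)} {it : ℕ → Fin n}

open Classical in
theorem scan_succ_fst (r : ℕ) : (scan I D L w v S it (r + 1)).1 =
    if ∀ b, (scan I D L w v S it r).1 = some b → Worse I v S b (it r) then some (it r)
    else (scan I D L w v S it r).1 := by
  rw [scan]
  by_cases h : ∀ b, (scan I D L w v S it r).1 = some b → Worse I v S b (it r)
  · rw [if_pos h, if_pos h]
  · rw [if_neg h, if_neg h]

theorem scan_fst_ne_none (r : ℕ) : (scan I D L w v S it (r + 1)).1 ≠ none := by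
  induction r with
  | zero => simp [scan]
  | succ r ih =>
    rw [scan_succ_fst]
    split_ifs
    · simp
    · exact ih

theorem scan_fst_mem (r : ℕ) : ∀ b, (scan I D L w v S it r).1 = some b → ∃ j < r, it j = b := by
  induction r with
  | zero => simp [scan]
  | succ r ih =>
    intro b hb
    rw [scan_succ_fst] at hb
    split_ifs at hb with h
    · exact ⟨r, Nat.lt_succ_self r, Option.some.inj hb⟩
    · obtain ⟨j, hj, h⟩ := ih b hb
      exact ⟨j, by omega, h⟩

theorem scan_snd_length_le (r : ℕ) : (scan I D L w v S it r).2.length ≤ L := by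
  induction r with
  | zero => simp [scan]
  | succ r ih =>
    rw [scan]
    split_ifs with h h'
    · simp only [List.length_cons]; omega
    · exact ih
    · exact ih

theorem scan_snd_mono {r r' : ℕ} (h : r ≤ r') :
    (scan I D L w v S it r).2 ⊆ (scan I D L w v S it r').2 := by
  induction r', h using Nat.le_induction with
  | base => exact List.Subset.refl _
  | succ k hk ih =>
    refine List.Subset.trans ih ?_
    rw [scan]
    split_ifs
    · exact List.subset_cons_self _ _
    · exact List.Subset.refl _
    · exact List.Subset.refl _

variable (hv : Function.Injective v)
include hv

theorem scan_fst_max {r : ℕ} (hit : Set.InjOn it (Set.Iio r)) :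
    ∀ b, (scan I D L w v S it r).1 = some b → ∀ j < r, it j ≠ b → Worse I v S (it j) b := by
  induction r with
  | zero => simp [scan]
  | succ r ih =>
    have ih := ih (hit.mono (Set.Iio_subset_Iio (Nat.le_succ r)))
    intro b hb j hj hne
    rw [scan_succ_fst] at hb
    split_ifs at hb with h
    · obtain rfl := Option.some.inj hb
      have hjr : j < r := by
        rcases lt_or_eq_of_le (Nat.le_of_lt_succ hj) with h | rfl
        · exact h
        · exact absurd rfl hne
      cases hc : (scan I D L w v S it r).1 with
      | none =>
        cases r with
        | zero => omega
        | succ r => exact absurd hc (scan_fst_ne_none r)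
      | some c =>
        by_cases hjc : it j = c
        · exact hjc ▸ h c hc
        · exact (ih c hc j hjr hjc).trans (h c hc)
    · rcases lt_or_eq_of_le (Nat.le_of_lt_succ hj) with hjr | rfl
      · exact ih b hb j hjr hne
      · rcases worse_total (I := I) hv (S := S) hne with h' | h'
        · exact h'
        · refine absurd (fun c hc => ?_) h
          rw [hb] at hc
          exact Option.some.inj hc ▸ h'

/-- The running maximum ends at the same item for every order of the window, so the solution depends
only on the partition into windows. The sample size and the bound `L` affect the shortlist alone. -/
theorem scan_fst_eq_pick {r : ℕ} (hit : Set.InjOn it (Set.Iio r)) :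
    (scan I D L w v S it r).1 = pick I v S ((Finset.range r).image it) := by
  cases r with
  | zero => simp [scan, pick]
  | succ r =>
    cases hc : (scan I D L w v S it (r + 1)).1 with
    | none => exact absurd hc (scan_fst_ne_none r)
    | some b =>
      symm
      rw [pick_eq_some_iff]
      obtain ⟨j, hj, rfl⟩ := scan_fst_mem _ _ hc
      refine ⟨Finset.mem_image_of_mem _ (Finset.mem_range.2 hj), fun e he hne => ?_⟩
      obtain ⟨i, hi, rfl⟩ := Finset.mem_image.1 he
      exact scan_fst_max hv hit _ hc i (Finset.mem_range.1 hi) hne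

theorem scan_better_iff {r : ℕ} (hit : Set.InjOn it (Set.Iio (r + 1))) :
    (∀ b, (scan I D L w v S it r).1 = some b → Worse I v S b (it r)) ↔
      ∀ j < r, Worse I v S (it j) (it r) := by
  have hit' := hit.mono (Set.Iio_subset_Iio (Nat.le_succ r))
  constructor
  · intro h j hj
    cases hc : (scan I D L w v S it r).1 with
    | none =>
      cases r with
      | zero => omega
      | succ r => exact absurd hc (scan_fst_ne_none r)
    | some c =>
      by_cases hjc : it j = c
      · exact hjc ▸ h c hc
      · exact (scan_fst_max hv hit' c hc j hj hjc).trans (h c hc)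
  · intro h b hb
    obtain ⟨j, hj, rfl⟩ := scan_fst_mem _ _ hb
    exact h j hj

open Classical in
theorem scan_length_le {r : ℕ} (hit : Set.InjOn it (Set.Iio r)) :
    (scan I D L w v S it r).2.length ≤ ((Finset.range r).filter fun i =>
      w < D * (i + 1) ∧ ∀ j < i, Worse I v S (it j) (it i)).card := by
  induction r with
  | zero => simp [scan]
  | succ r ih =>
    have ih := ih (hit.mono (Set.Iio_subset_Iio (Nat.le_succ r)))
    rw [Finset.range_add_one, Finset.filter_insert]
    rw [scan]
    split_ifs with h h1 h2 h2 h2 <;>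
      (try rw [Finset.card_insert_of_notMem (by simp)]) <;> (try simp only [List.length_cons]) <;>
      (try omega)
    exact absurd ⟨h1.1, (scan_better_iff hv hit).1 h⟩ h2

open Classical in
/-- The best item is shortlisted unless it is in the sample or there are too many records. -/
theorem not_mem_scan {r0 : ℕ} (hr0 : r0 < w) (hit : Set.InjOn it (Set.Iio w))
    (hmax : ∀ j < w, j ≠ r0 → Worse I v S (it j) (it r0))
    (hnot : it r0 ∉ (scan I D L w v S it w).2) :
    D * (r0 + 1) ≤ w ∨ L + 1 ≤ ((Finset.range w).filter fun i =>
      w < D * (i + 1) ∧ ∀ j < i, Worse I v S (it j) (it i)).card := by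
  by_contra hcon
  push Not at hcon
  obtain ⟨h1, h2⟩ := hcon
  have hit1 := hit.mono (Set.Iio_subset_Iio (Nat.succ_le_of_lt hr0))
  have hit' := hit.mono (Set.Iio_subset_Iio hr0.le)
  have hlen := scan_length_le (I := I) (D := D) (L := L) (w := w) (S := S) hv hit'
  -- The best item is itself a record after the sample, so if there are at most `L` such records,
  -- fewer than `L` come before it.
  have hlt : (scan I D L w v S it r0).2.length < L := by
    refine lt_of_le_of_lt hlen ?_
    refine lt_of_lt_of_le (Finset.card_lt_card ?_) (Nat.le_of_lt_succ h2)
    rw [Finset.ssubset_iff]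
    refine ⟨r0, by simp, ?_⟩
    intro i hi
    rcases Finset.mem_insert.1 hi with rfl | hi
    · simp only [Finset.mem_filter, Finset.mem_range]
      exact ⟨hr0, h1, fun j hj => hmax j (hj.trans hr0) hj.ne⟩
    · simp only [Finset.mem_filter, Finset.mem_range] at hi ⊢
      exact ⟨hi.1.trans hr0, hi.2⟩
  refine hnot (scan_snd_mono (Nat.succ_le_of_lt hr0) ?_)
  rw [scan]
  rw [if_pos ((scan_better_iff hv hit1).2 fun j hj => hmax j (hj.trans hr0) hj.ne),
    if_pos ⟨h1, hlt⟩]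
  exact List.mem_cons_self

end Scan

/-! ### The probability of missing the best item -/

section Window

variable {p n q : ℕ} {I : Problem p n q} [NeZero n]

/-- The item at position `t` of the arrival order. -/
def itemPos (σ : Equiv.Perm (Fin n)) (t : ℕ) : Fin n := σ (Fin.ofNat n t)

theorem itemPos_of_lt (σ : Equiv.Perm (Fin n)) {t : ℕ} (h : t < n) : itemPos σ t = σ ⟨t, h⟩ := by
  rw [itemPos]
  congr 1
  ext
  simp [Nat.mod_eq_of_lt h]

theorem itemPos_symm (σ : Equiv.Perm (Fin n)) (e : Fin n) : itemPos σ (σ.symm e) = e := by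
  rw [itemPos_of_lt σ (σ.symm e).2]
  simp

theorem symm_itemPos (σ : Equiv.Perm (Fin n)) {t : ℕ} (h : t < n) :
    (σ.symm (itemPos σ t) : ℕ) = t := by
  rw [itemPos_of_lt σ h]
  simp

/-- The positions of a block in reversed order. -/
def blockEquiv (b w : ℕ) (h : b + w ≤ n) : Fin w ≃ {t : Fin n // b ≤ t.1 ∧ t.1 < b + w} where
  toFun i := ⟨⟨b + (w - 1 - i), by omega⟩, by dsimp only; omega⟩
  invFun t := ⟨w - 1 - (t.1.1 - b), by have := t.2; omega⟩
  left_inv i := by ext; dsimp only; omega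
  right_inv t := by
    have := t.2
    ext; dsimp only; omega

/-- A permutation of the positions of a block. -/
def blockPerm (b w : ℕ) (h : b + w ≤ n) (τ : Equiv.Perm (Fin w)) : Equiv.Perm (Fin n) :=
  τ.extendDomain (blockEquiv b w h)

theorem itemPos_blockPerm (σ : Equiv.Perm (Fin n)) {b w : ℕ} (h : b + w ≤ n)
    (τ : Equiv.Perm (Fin w)) (i : Fin w) :
    itemPos (σ * blockPerm b w h τ) (b + (w - 1 - i)) = itemPos σ (b + (w - 1 - τ i)) := by
  rw [itemPos_of_lt _ (by omega), itemPos_of_lt _ (by omega), Equiv.Perm.mul_apply]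
  congr 1
  exact Equiv.Perm.extendDomain_apply_image τ (blockEquiv b w h) i

theorem itemPos_injOn (σ : Equiv.Perm (Fin n)) {b w : ℕ} (h : b + w ≤ n) :
    Set.InjOn (fun r => itemPos σ (b + r)) (Set.Iio w) := by
  intro r hr r' hr' hrr
  simp only [Set.mem_Iio] at hr hr'
  have := congrArg (fun e => (σ.symm e : ℕ)) hrr
  simp only [symm_itemPos σ (show b + r < n by omega), symm_itemPos σ (show b + r' < n by omega)]
    at this
  omega

open Classical in
/-- The best item of a block is not shortlisted. -/
def Missed (I : Problem p n q) (D L b w : ℕ) (v : Fin n → ℕ) (S : List (Fin n))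
    (σ : Equiv.Perm (Fin n)) : Prop :=
  ∃ e, pick I v S ((Finset.range w).image fun r => itemPos σ (b + r)) = some e ∧
    e ∉ (scan I D L w v S (fun r => itemPos σ (b + r)) w).2

theorem image_blockPerm (σ : Equiv.Perm (Fin n)) {b w : ℕ} (h : b + w ≤ n)
    (τ : Equiv.Perm (Fin w)) :
    ((Finset.range w).image fun r => itemPos (σ * blockPerm b w h τ) (b + r)) =
      (Finset.range w).image fun r => itemPos σ (b + r) := by
  ext e
  simp only [Finset.mem_image, Finset.mem_range]
  constructor
  · rintro ⟨r, hr, rfl⟩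
    have := itemPos_blockPerm σ h τ ⟨w - 1 - r, by omega⟩
    rw [show w - 1 - (w - 1 - r) = r by omega] at this
    exact ⟨w - 1 - τ ⟨w - 1 - r, by omega⟩, by omega, this.symm⟩
  · rintro ⟨r, hr, rfl⟩
    have := itemPos_blockPerm σ h τ (τ.symm ⟨w - 1 - r, by omega⟩)
    rw [Equiv.apply_symm_apply] at this
    simp only [show w - 1 - (w - 1 - r) = r by omega] at this
    exact ⟨w - 1 - τ.symm ⟨w - 1 - r, by omega⟩, by omega, this⟩

open Classical in
/-- In a random order, the best item of a block is rarely missed. -/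
theorem sum_missed_le (D L : ℕ) (hD : 0 < D) {v : Fin n → ℕ} (hv : Function.Injective v)
    (S : List (Fin n)) (σ : Equiv.Perm (Fin n)) {b w : ℕ} (h : b + w ≤ n) :
    ∑ τ : Equiv.Perm (Fin w), (if Missed I D L b w v S (σ * blockPerm b w h τ) then (1 : ℝ) else 0)
      ≤ w.factorial * (1 / D + D / 2 ^ (L + 1)) := by
  set B := (Finset.range w).image fun r => itemPos σ (b + r) with hB
  have hD0 : (0 : ℝ) < D := by exact_mod_cast hD
  cases hp : pick I v S B with
  | none =>
    have : ∀ τ, ¬ Missed I D L b w v S (σ * blockPerm b w h τ) := by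
      rintro τ ⟨e, he, -⟩
      rw [image_blockPerm, ← hB, hp] at he
      simp at he
    simp only [this, if_false, Finset.sum_const_zero]
    positivity
  | some e =>
    obtain ⟨heB, hmax⟩ := pick_eq_some_iff.1 hp
    obtain ⟨r1, hr1, hr1e⟩ := Finset.mem_image.1 heB
    rw [Finset.mem_range] at hr1
    -- The block is read backwards: an item better than all the earlier ones becomes an index all of
    -- whose successors are worse, as counted by `recs`.
    let x : Fin w → Fin n := fun i => itemPos σ (b + (w - 1 - i))
    let i0 : Fin w := ⟨w - 1 - r1, by omega⟩
    have hxi0 : x i0 = e := by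
      simp only [x, i0]
      rw [← hr1e]
      congr 2
      omega
    have hwD : w / D ≤ w := Nat.div_le_self w D
    -- The sample consists of the first `w / D` items, that is, of the reversed indices from `s` on.
    set s := w - w / D with hs
    have hit : ∀ (τ : Equiv.Perm (Fin w)) (r : ℕ) (hr : r < w),
        itemPos (σ * blockPerm b w h τ) (b + r) = x (τ ⟨w - 1 - r, by omega⟩) := by
      intro τ r hr
      have := itemPos_blockPerm σ h τ ⟨w - 1 - r, by omega⟩
      rwa [show w - 1 - (w - 1 - r) = r by omega] at this
    have hxB : ∀ i, x i ∈ B := fun i =>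
      Finset.mem_image.2 ⟨w - 1 - i, Finset.mem_range.2 (by omega), rfl⟩
    have hxinj : Function.Injective x := by
      intro i j hij
      have := itemPos_injOn σ h (show w - 1 - i.1 ∈ Set.Iio w by simp; omega)
        (show w - 1 - j.1 ∈ Set.Iio w by simp; omega) hij
      ext; omega
    have hrec : ∀ τ : Equiv.Perm (Fin w), ((Finset.range w).filter fun i => w < D * (i + 1) ∧
        ∀ j < i, Worse I v S (itemPos (σ * blockPerm b w h τ) (b + j))
          (itemPos (σ * blockPerm b w h τ) (b + i))).card =
        recs (Worse I v S) s (x ∘ τ) := by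
      intro τ
      refine Finset.card_bij' (fun r hr => (⟨w - 1 - r, by
          have := Finset.mem_range.1 (Finset.mem_filter.1 hr).1; omega⟩ : Fin w))
        (fun i _ => w - 1 - i) ?_ ?_ ?_ ?_
      · intro r hr
        simp only [Finset.mem_filter, Finset.mem_range] at hr
        obtain ⟨hr, hrD, hrj⟩ := hr
        simp only [Finset.mem_filter, Finset.mem_univ, true_and]
        constructor
        · have := (Nat.div_lt_iff_lt_mul hD).2 (by rwa [mul_comm] at hrD)
          omega
        · intro j hj
          have hj' : w - 1 - r < j.1 := hj
          have := hrj (w - 1 - j) (by omega)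
          rw [hit τ _ hr, hit τ _ (by omega)] at this
          simpa [show w - 1 - (w - 1 - j.1) = j by omega] using this
      · intro i hi
        simp only [Finset.mem_filter, Finset.mem_univ, true_and] at hi
        simp only [Finset.mem_filter, Finset.mem_range]
        refine ⟨by omega, ?_, fun j hj => ?_⟩
        · rw [mul_comm]
          refine (Nat.div_lt_iff_lt_mul hD).1 ?_
          omega
        · rw [hit τ _ (by omega), hit τ _ (by omega)]
          have := hi.2 ⟨w - 1 - j, by omega⟩ (by rw [Fin.lt_def]; simp only; omega)
          simpa [show w - 1 - (w - 1 - i.1) = i by omega] using this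
      · intro r hr
        have := Finset.mem_range.1 (Finset.mem_filter.1 hr).1
        simp only; omega
      · intro i _
        ext; simp only; omega
    -- Union bound: the best item is in the sample, or there are at least `L + 1` records, and in
    -- the second case `2 ^ recs / 2 ^ (L + 1)` is at least `1` (Markov's inequality).
    have hbound : ∀ τ : Equiv.Perm (Fin w),
        (if Missed I D L b w v S (σ * blockPerm b w h τ) then (1 : ℝ) else 0) ≤
        (if s ≤ (τ.symm i0 : ℕ) then 1 else 0) +
          ((2 ^ recs (Worse I v S) s (x ∘ τ) : ℕ) : ℝ) / 2 ^ (L + 1) := by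
      intro τ
      by_cases hmiss : Missed I D L b w v S (σ * blockPerm b w h τ)
      · rw [if_pos hmiss]
        obtain ⟨e', he', hnot⟩ := hmiss
        rw [image_blockPerm, ← hB, hp] at he'
        obtain rfl := Option.some.inj he'
        have hr0 : w - 1 - (τ.symm i0 : ℕ) < w := by omega
        have hite : itemPos (σ * blockPerm b w h τ) (b + (w - 1 - (τ.symm i0 : ℕ))) = e := by
          rw [hit τ _ hr0, ← hxi0]
          congr 1
          rw [← Equiv.eq_symm_apply]
          ext; simp only; omega
        have hnm := not_mem_scan (I := I) (D := D) (L := L) (S := S) hv hr0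
          (itemPos_injOn (σ * blockPerm b w h τ) h) ?_ (by rw [hite]; exact hnot)
        · rcases hnm with h1 | h1
          · rw [if_pos]
            · have : (0 : ℝ) ≤ ((2 ^ recs (Worse I v S) s (x ∘ τ) : ℕ) : ℝ) / 2 ^ (L + 1) := by
                positivity
              linarith
            · rw [mul_comm, ← Nat.le_div_iff_mul_le hD] at h1
              omega
          · rw [hrec τ] at h1
            have h2 : (1 : ℝ) ≤ ((2 ^ recs (Worse I v S) s (x ∘ τ) : ℕ) : ℝ) / 2 ^ (L + 1) := by
              rw [one_le_div (by positivity)]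
              exact_mod_cast Nat.pow_le_pow_right (by norm_num) h1
            have h3 : (0 : ℝ) ≤ if s ≤ (τ.symm i0 : ℕ) then 1 else 0 := by
              split_ifs <;> norm_num
            linarith
        · intro j hj hjne
          rw [hite]
          refine hmax _ ?_ ?_
          · rw [hit τ j hj]; exact hxB _
          · intro heq
            refine hjne ?_
            rw [hit τ j hj, ← hxi0] at heq
            have := hxinj heq
            rw [← Equiv.eq_symm_apply] at this
            rw [← this]; simp only; omega
      · rw [if_neg hmiss]
        have h3 : (0 : ℝ) ≤ if s ≤ (τ.symm i0 : ℕ) then 1 else 0 := by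
          split_ifs <;> norm_num
        positivity
    refine (Finset.sum_le_sum fun τ _ => hbound τ).trans ?_
    rw [Finset.sum_add_distrib, mul_add, ← Finset.sum_div]
    have hw0 : (0 : ℝ) < w := by exact_mod_cast (by omega : 0 < w)
    refine add_le_add ?_ ?_
    · have h1 := card_perm_symm_ge w s i0
      rw [← Finset.sum_filter, Finset.sum_const, nsmul_eq_mul, mul_one, mul_one_div,
        le_div_iff₀ hD0]
      have h2 : (w - s) * D ≤ w := by
        rw [hs, Nat.sub_sub_self hwD]; exact Nat.div_mul_le_self w D
      have h3 : (Finset.univ.filter fun τ : Equiv.Perm (Fin w) => s ≤ (τ.symm i0 : ℕ)).card * D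
          * w ≤ w.factorial * w := by
        calc _ = (Finset.univ.filter fun τ : Equiv.Perm (Fin w) =>
              s ≤ (τ.symm i0 : ℕ)).card * w * D := by ring
          _ = w.factorial * ((w - s) * D) := by rw [h1]; ring
          _ ≤ _ := Nat.mul_le_mul_left _ h2
      have h4 := Nat.le_of_mul_le_mul_right h3 (by omega)
      exact_mod_cast h4
    · rw [mul_div_assoc']
      refine div_le_div_of_nonneg_right ?_ (by positivity)
      have h1 := sum_two_pow_recs_le (Worse I v S) (fun a b h => h.asymm) w s x
        (hs ▸ Nat.sub_le _ _)
      -- The exponential moment is at most `(w + 1) / (w - s + 1)` on average, hence at most `D`.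
      have h2 : w + 1 ≤ D * (w - s + 1) := by
        rw [hs, Nat.sub_sub_self hwD]
        have := Nat.lt_mul_div_succ w hD
        omega
      have h3 : (∑ τ : Equiv.Perm (Fin w), 2 ^ recs (Worse I v S) s (x ∘ τ)) * (w + 1) ≤
          w.factorial * D * (w + 1) := by
        calc _ ≤ (∑ τ : Equiv.Perm (Fin w), 2 ^ recs (Worse I v S) s (x ∘ τ)) *
              (D * (w - s + 1)) := Nat.mul_le_mul_left _ h2
          _ = D * ((∑ τ : Equiv.Perm (Fin w), 2 ^ recs (Worse I v S) s (x ∘ τ)) *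
              (w - s + 1)) := by ring
          _ ≤ D * (w + 1).factorial := Nat.mul_le_mul_left _ h1
          _ = _ := by rw [Nat.factorial_succ]; ring
      have h4 := Nat.le_of_mul_le_mul_right h3 (Nat.succ_pos w)
      exact_mod_cast h4

end Window

/-! ### Random windows from sorted draws -/

section Schedule

variable {n m : ℕ} (w : Fin n → Fin m)

/-- The number of items of window `j`. -/
def winCard (j : ℕ) : ℕ := (Finset.univ.filter fun t => (w t : ℕ) = j).card

/-- The number of items before window `j`. -/
def winBase (j : ℕ) : ℕ := (Finset.univ.filter fun t => (w t : ℕ) < j).card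

/-- The window of an item: the draws `w` are sorted and dealt to the items as they arrive. -/
def windowOf (σ : Equiv.Perm (Fin n)) (e : Fin n) : Fin m := w (Tuple.sort w (σ.symm e))

theorem winBase_zero : winBase w 0 = 0 := by simp [winBase]

theorem winBase_succ (j : ℕ) : winBase w (j + 1) = winBase w j + winCard w j := by
  rw [winBase, winBase, winCard, ← Finset.card_union_of_disjoint]
  · congr 1
    ext t
    simp only [Finset.mem_filter, Finset.mem_univ, true_and, Finset.mem_union]
    omega
  · rw [Finset.disjoint_filter]
    intro t _ h
    omega

theorem winBase_top : winBase w m = n := by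
  simp [winBase]

theorem winBase_le (j : ℕ) : winBase w j ≤ n := by
  simpa [winBase] using Finset.card_le_univ (Finset.univ.filter fun t => (w t : ℕ) < j)

/-- After sorting, the draws below `j` occupy an initial segment, so a window is a block of
consecutive arrivals and can be processed online. -/
theorem sort_lt_iff (t : Fin n) (j : ℕ) :
    (w (Tuple.sort w t) : ℕ) < j ↔ (t : ℕ) < winBase w j := by
  have hmono := Tuple.monotone_sort w
  have hcard : winBase w j =
      (Finset.univ.filter fun t => (w (Tuple.sort w t) : ℕ) < j).card := by
    rw [winBase]
    refine Finset.card_bij (fun t _ => (Tuple.sort w).symm t) ?_ ?_ ?_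
    · intro a ha; simpa using ha
    · intro a _ b _ h; exact (Tuple.sort w).symm.injective h
    · intro b hb
      exact ⟨Tuple.sort w b, by simpa using hb, by simp⟩
  rw [hcard]
  constructor
  · intro h
    have : Finset.Iic t ⊆ Finset.univ.filter fun t => (w (Tuple.sort w t) : ℕ) < j := by
      intro a ha
      rw [Finset.mem_filter]
      exact ⟨Finset.mem_univ _, lt_of_le_of_lt (hmono (Finset.mem_Iic.1 ha)) h⟩
    have := Finset.card_le_card this
    rw [Fin.card_Iic] at this
    omega
  · intro h
    by_contra hcon
    have : (Finset.univ.filter fun t => (w (Tuple.sort w t) : ℕ) < j) ⊆ Finset.Iio t := by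
      intro a ha
      rw [Finset.mem_Iio]
      by_contra hle
      exact hcon (lt_of_le_of_lt (hmono (not_lt.1 hle)) (Finset.mem_filter.1 ha).2)
    have := Finset.card_le_card this
    rw [Fin.card_Iio] at this
    omega

theorem windowOf_eq_iff (σ : Equiv.Perm (Fin n)) (e : Fin n) (j : ℕ) :
    (windowOf w σ e : ℕ) = j ↔
      winBase w j ≤ σ.symm e ∧ (σ.symm e : ℕ) < winBase w j + winCard w j := by
  rw [← winBase_succ, ← sort_lt_iff w (σ.symm e) (j + 1), ← not_lt, ← sort_lt_iff w (σ.symm e) j,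
    windowOf]
  omega

theorem window_items [NeZero n] (σ : Equiv.Perm (Fin n)) (j : ℕ) :
    (Finset.univ.filter fun e => (windowOf w σ e : ℕ) = j) =
      (Finset.range (winCard w j)).image fun r => itemPos σ (winBase w j + r) := by
  ext e
  simp only [Finset.mem_filter, Finset.mem_univ, true_and, windowOf_eq_iff, Finset.mem_image,
    Finset.mem_range]
  constructor
  · rintro ⟨h1, h2⟩
    refine ⟨σ.symm e - winBase w j, by omega, ?_⟩
    rw [Nat.add_sub_cancel' h1, itemPos_symm]
  · rintro ⟨r, hr, rfl⟩
    have := winBase_le w (j + 1)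
    rw [winBase_succ] at this
    rw [symm_itemPos σ (by omega)]
    omega

/-- Shuffling the arrivals inside a block keeps the partition. Hence the order inside a window stays
uniform when the partition, and with it the ideal solution, is fixed. -/
theorem windowOf_blockPerm (σ : Equiv.Perm (Fin n)) (j : ℕ)
    (h : winBase w j + winCard w j ≤ n) (τ : Equiv.Perm (Fin (winCard w j))) :
    windowOf w (σ * blockPerm (winBase w j) (winCard w j) h τ) = windowOf w σ := by
  have key : ∀ t : Fin n, w (Tuple.sort w (blockPerm (winBase w j) (winCard w j) h τ t)) =
      w (Tuple.sort w t) := by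
    intro t
    by_cases ht : winBase w j ≤ t.1 ∧ t.1 < winBase w j + winCard w j
    · have hm : ∀ t : Fin n, winBase w j ≤ t.1 ∧ t.1 < winBase w j + winCard w j →
          (w (Tuple.sort w t) : ℕ) = j := by
        intro t ht
        have := (windowOf_eq_iff w (Equiv.refl _) t j).2 (by simpa using ht)
        simpa [windowOf] using this
      ext
      rw [hm t ht, hm]
      have := Equiv.Perm.extendDomain_apply_subtype τ
        (blockEquiv (winBase w j) (winCard w j) h) ht
      rw [blockPerm, this]
      exact (blockEquiv (winBase w j) (winCard w j) h
        (τ ((blockEquiv (winBase w j) (winCard w j) h).symm ⟨t, ht⟩))).2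
    · rw [blockPerm, Equiv.Perm.extendDomain_apply_not_subtype τ
        (blockEquiv (winBase w j) (winCard w j) h) ht]
  funext e
  rw [windowOf, windowOf, ← key]
  congr 2
  rw [← Equiv.Perm.inv_def, mul_inv_rev, Equiv.Perm.mul_apply]
  exact Equiv.apply_symm_apply _ _

/-- The windows of the items are independent and uniformly random. -/
theorem sum_windowOf (F : (Fin n → Fin m) → ℝ) :
    ∑ w : Fin n → Fin m, ∑ σ : Equiv.Perm (Fin n), F (windowOf w σ) =
      n.factorial * ∑ W : Fin n → Fin m, F W := by
  -- For fixed draws, `σ` enters through the uniform permutation `Tuple.sort w * σ⁻¹`. For each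
  -- fixed permutation `π`, the map `w ↦ w ∘ π` is a bijection.
  have h1 : ∀ w : Fin n → Fin m, ∑ σ : Equiv.Perm (Fin n), F (windowOf w σ) =
      ∑ π : Equiv.Perm (Fin n), F (w ∘ π) := by
    intro w
    refine Fintype.sum_equiv ((Equiv.inv _).trans (Equiv.mulLeft (Tuple.sort w))) _ _ ?_
    intro σ
    rfl
  rw [Finset.sum_congr rfl fun w _ => h1 w, Finset.sum_comm]
  have h2 : ∀ π : Equiv.Perm (Fin n), ∑ w : Fin n → Fin m, F (w ∘ π) = ∑ W, F W := by
    intro π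
    exact Fintype.sum_equiv (Equiv.arrowCongr π.symm (Equiv.refl _)) _ _ (fun w => rfl)
  rw [Finset.sum_congr rfl fun π _ => h2 π, Finset.sum_const, Finset.card_univ,
    Fintype.card_perm, Fintype.card_fin, nsmul_eq_mul]

end Schedule

/-! ### The online process and the loss from missed items -/

section Run

variable {p n q : ℕ} (I : Problem p n q) [NeZero n] {m : ℕ} (D L : ℕ) (v : Fin n → ℕ)
  (R : ℕ → ℕ) (σ : Equiv.Perm (Fin n)) (w : Fin n → Fin m)

/-- The history of the windows as they are processed on arrival. -/
noncomputable def runHist : ℕ → List (Option (Fin n))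
  | 0 => []
  | j + 1 => (scan I D L (winCard w j) v (sol I R (runHist j))
      (fun r => itemPos σ (winBase w j + r)) (winCard w j)).1 :: runHist j

/-- The items that are shortlisted in window `j`. -/
noncomputable def winList (j : ℕ) : List (Fin n) :=
  (scan I D L (winCard w j) v (sol I R (runHist I D L v R σ w j))
      (fun r => itemPos σ (winBase w j + r)) (winCard w j)).2

/-- The shortlist before window `j`. -/
noncomputable def runList (j : ℕ) : Finset (Fin n) :=
  (Finset.range j).biUnion fun i => (winList I D L v R σ w i).toFinset

variable {I} {D L v R σ w}

omit [NeZero n] in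
theorem winBase_add_le (w : Fin n → Fin m) (j : ℕ) : winBase w j + winCard w j ≤ n :=
  winBase_succ w j ▸ winBase_le w (j + 1)

/-- The online solution is the ideal one, including items that were not shortlisted. Only the
returned set is cut down to the shortlist. -/
theorem runHist_eq (hv : Function.Injective v) (j : ℕ) :
    runHist I D L v R σ w j = hist I v R (windowOf w σ) j := by
  induction j with
  | zero => rfl
  | succ j ih =>
    rw [runHist, hist, ih, window_items,
      scan_fst_eq_pick hv (itemPos_injOn σ (winBase_add_le w j))]

-- Insert the elements of `S` one by one and let `Δ e` be the marginal value at insertion. By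
-- diminishing returns an element that is kept still contributes at least `Δ e` when others are
-- missing, so a missing element costs only its own increment.
omit [NeZero n] in
theorem exists_increments (I : Problem p n q) (S : Finset (Fin n)) :
    ∃ Δ : Fin n → ℝ, (∀ e, 0 ≤ Δ e) ∧ ∑ e ∈ S, Δ e ≤ I.f S ∧
      ∀ A, I.f S - ∑ e ∈ S \ A, Δ e ≤ I.f (S ∩ A) := by
  classical
  induction S using Finset.induction_on with
  | empty => exact ⟨fun _ => 0, by simp, by simpa using I.nonneg ∅, by simp⟩
  | insert a S ha ih =>
    obtain ⟨Δ, h0, h1, h2⟩ := ih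
    have hne : ∀ e ∈ S, e ≠ a := fun e he h => ha (h ▸ he)
    have hsum : ∀ T ⊆ S, ∑ e ∈ T, Function.update Δ a (I.f (insert a S) - I.f S) e =
        ∑ e ∈ T, Δ e := fun T hT =>
      Finset.sum_congr rfl fun e he => Function.update_of_ne (hne e (hT he)) _ _
    refine ⟨Function.update Δ a (I.f (insert a S) - I.f S), fun e => ?_, ?_, fun A => ?_⟩
    · by_cases he : e = a
      · subst he
        rw [Function.update_self]
        exact sub_nonneg.2 (I.mono _ _ (Finset.subset_insert _ _))
      · rw [Function.update_of_ne he]; exact h0 e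
    · rw [Finset.sum_insert ha, Function.update_self, hsum S (Finset.Subset.refl _)]
      linarith
    · by_cases haA : a ∈ A
      · rw [Finset.insert_sdiff_of_mem _ haA, Finset.insert_inter_of_mem haA,
          hsum _ Finset.sdiff_subset]
        have := marginal_antitone I.submodular
          (Finset.inter_subset_left : S ∩ A ⊆ S) ha
        linarith [h2 A]
      · rw [Finset.insert_sdiff_of_notMem _ haA, Finset.insert_inter_of_notMem haA,
          Finset.sum_insert (fun h => ha (Finset.sdiff_subset h)), Function.update_self,
          hsum _ Finset.sdiff_subset]
        linarith [h2 A]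

/-- The loss that is caused by the items of the ideal solution that are not shortlisted. -/
theorem sum_shortlisted_ge (hD : 0 < D) (hv : Function.Injective v) (w : Fin n → Fin m) :
    (1 - (1 / D + D / 2 ^ (L + 1) : ℝ)) * ∑ σ : Equiv.Perm (Fin n),
      I.f (sol I R (hist I v R (windowOf w σ) m)).toFinset ≤
    ∑ σ : Equiv.Perm (Fin n), I.f ((sol I R (runHist I D L v R σ w m)).toFinset ∩
      runList I D L v R σ w m) := by
  classical
  set φ : ℝ := 1 / D + D / 2 ^ (L + 1) with hφ
  choose Δ hΔ0 hΔ1 hΔ2 using exists_increments I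
  let H : (Fin n → Fin m) → ℕ → List (Option (Fin n)) := fun W j => hist I v R W j
  let S : (Fin n → Fin m) → Finset (Fin n) := fun W => (sol I R (H W m)).toFinset
  -- The part of the value of the final solution that is due to the pick of window `j`. It depends
  -- on the partition `W` only, not on the order inside the windows.
  let δ : (Fin n → Fin m) → ℕ → ℝ := fun W j =>
    ∑ e ∈ S W, if entry (H W m) j = some e then Δ (S W) e else 0
  have hδ0 : ∀ W j, 0 ≤ δ W j := fun W j => Finset.sum_nonneg fun e _ => by
    split_ifs
    · exact hΔ0 _ e
    · exact le_rfl
  -- Every item is the pick of at most one window, so no increment is counted twice.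
  have hδ1 : ∀ W, ∑ j ∈ Finset.range m, δ W j ≤ I.f (S W) := by
    intro W
    refine le_trans ?_ (hΔ1 (S W))
    rw [Finset.sum_comm]
    refine Finset.sum_le_sum fun e he => ?_
    have hcomp : ∀ e, W e ∈ compat I m v R (H W m) e := by
      rw [← hist_eq_iff hv, length_hist]
    rw [← Finset.sum_filter, Finset.sum_const, nsmul_eq_mul]
    have : ((Finset.range m).filter fun j => entry (H W m) j = some e).card ≤ 1 := by
      rw [Finset.card_le_one]
      intro a ha b hb
      rw [← window_of_entry hcomp (Finset.mem_filter.1 ha).2,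
        ← window_of_entry hcomp (Finset.mem_filter.1 hb).2]
    have h1 : (((Finset.range m).filter fun j => entry (H W m) j = some e).card : ℝ) ≤ 1 := by
      exact_mod_cast this
    nlinarith [hΔ0 (S W) e]
  let miss : ℕ → Equiv.Perm (Fin n) → Prop := fun j σ =>
    Missed I D L (winBase w j) (winCard w j) v (sol I R (H (windowOf w σ) j)) σ
  have hentry : ∀ (W : Fin n → Fin m) (j i : ℕ), j < i → entry (H W i) j =
      pick I v (sol I R (H W j)) (Finset.univ.filter fun e => (W e : ℕ) = j) := by
    intro W j i hji
    induction i, hji using Nat.le_induction with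
    | base =>
      have := entry_length (H W j) (pick I v (sol I R (H W j))
        (Finset.univ.filter fun e => (W e : ℕ) = j))
      rw [length_hist] at this
      exact this
    | succ k hk ih =>
      rw [← ih]
      refine entry_cons_lt ?_
      rw [length_hist]
      exact hk
  -- An item of the solution that is not shortlisted was the pick of some window and was missed
  -- there.
  have hpoint : ∀ σ : Equiv.Perm (Fin n), I.f (S (windowOf w σ)) -
      ∑ j ∈ Finset.range m, (if miss j σ then 1 else 0) * δ (windowOf w σ) j ≤
      I.f ((sol I R (runHist I D L v R σ w m)).toFinset ∩ runList I D L v R σ w m) := by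
    intro σ
    set W := windowOf w σ with hW
    rw [runHist_eq hv]
    refine le_trans ?_ (hΔ2 (S W) (runList I D L v R σ w m))
    refine sub_le_sub_left ?_ _
    simp only [δ, Finset.mul_sum]
    rw [Finset.sum_comm]
    refine le_trans ?_ (Finset.sum_le_sum_of_subset_of_nonneg
      (Finset.sdiff_subset (s := S W) (t := runList I D L v R σ w m)) ?_)
    · refine Finset.sum_le_sum fun e he => ?_
      obtain ⟨heS, heA⟩ := Finset.mem_sdiff.1 he
      obtain ⟨j, hj⟩ := exists_entry_iff.1 (sol_subset R _ e (List.mem_toFinset.1 heS))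
      have hjm : j < m := by
        have := lt_of_entry hj
        rwa [length_hist] at this
      have hnn : ∀ i ∈ Finset.range m, 0 ≤ (if miss i σ then (1 : ℝ) else 0) *
          (if entry (H W m) i = some e then Δ (S W) e else 0) := by
        intro i _
        have := hΔ0 (S W) e
        split_ifs <;> simp [this]
      refine le_trans ?_ (Finset.single_le_sum hnn (Finset.mem_range.2 hjm))
      have hmiss : miss j σ := by
        refine ⟨e, ?_, fun hmem => heA ?_⟩
        · rw [← window_items, ← hentry W j m hjm]
          exact hj
        · rw [runList, Finset.mem_biUnion]
          refine ⟨j, Finset.mem_range.2 hjm, ?_⟩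
          rw [winList, runHist_eq hv, List.mem_toFinset]
          exact hmem
      have hj' : entry (H W m) j = some e := hj
      rw [if_pos hmiss, if_pos hj', one_mul]
    · intro e _ _
      refine Finset.sum_nonneg fun i _ => ?_
      have := hΔ0 (S W) e
      split_ifs <;> simp [this]
  have hswap : ∀ j, ∑ σ : Equiv.Perm (Fin n), (if miss j σ then 1 else 0) * δ (windowOf w σ) j ≤
      φ * ∑ σ : Equiv.Perm (Fin n), δ (windowOf w σ) j := by
    intro j
    have hle := winBase_add_le w j
    let c := winCard w j
    have hfac : (0 : ℝ) < c.factorial := by exact_mod_cast Nat.factorial_pos c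
    -- Average additionally over the permutations of block `j`: they change neither `δ` nor the
    -- solution before the window, so `sum_missed_le` bounds the inner sum for each fixed `σ`.
    have havg : (c.factorial : ℝ) * ∑ σ : Equiv.Perm (Fin n),
        (if miss j σ then 1 else 0) * δ (windowOf w σ) j =
        ∑ σ : Equiv.Perm (Fin n), δ (windowOf w σ) j * ∑ τ : Equiv.Perm (Fin c),
          (if Missed I D L (winBase w j) c v (sol I R (H (windowOf w σ) j))
            (σ * blockPerm (winBase w j) c hle τ) then 1 else 0) := by
      have h1 : ∀ τ : Equiv.Perm (Fin c), ∑ σ : Equiv.Perm (Fin n),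
          (if miss j σ then 1 else 0) * δ (windowOf w σ) j =
          ∑ σ : Equiv.Perm (Fin n), δ (windowOf w σ) j *
          (if Missed I D L (winBase w j) c v (sol I R (H (windowOf w σ) j))
            (σ * blockPerm (winBase w j) c hle τ) then 1 else 0) := by
        intro τ
        rw [← Equiv.sum_comp (Equiv.mulRight (blockPerm (winBase w j) c hle τ))]
        refine Finset.sum_congr rfl fun σ _ => ?_
        have hiff : miss j (σ * blockPerm (winBase w j) c hle τ) ↔
            Missed I D L (winBase w j) c v (sol I R (H (windowOf w σ) j))
              (σ * blockPerm (winBase w j) c hle τ) := by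
          simp only [miss]
          rw [windowOf_blockPerm]
        rw [Equiv.coe_mulRight, windowOf_blockPerm, mul_comm]
        congr 1
        exact if_congr hiff rfl rfl
      simp only [Finset.mul_sum]
      rw [Finset.sum_comm (s := Finset.univ (α := Equiv.Perm (Fin n)))
        (t := Finset.univ (α := Equiv.Perm (Fin c))), ← Finset.sum_congr rfl fun τ _ => h1 τ]
      rw [Finset.sum_const, Finset.card_univ, Fintype.card_perm, Fintype.card_fin, nsmul_eq_mul,
        Finset.mul_sum]
    have h2 : ∑ σ : Equiv.Perm (Fin n), δ (windowOf w σ) j * ∑ τ : Equiv.Perm (Fin c),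
          (if Missed I D L (winBase w j) c v (sol I R (H (windowOf w σ) j))
            (σ * blockPerm (winBase w j) c hle τ) then (1 : ℝ) else 0) ≤
        ∑ σ : Equiv.Perm (Fin n), δ (windowOf w σ) j * (c.factorial * φ) := by
      refine Finset.sum_le_sum fun σ _ => mul_le_mul_of_nonneg_left ?_ (hδ0 _ _)
      convert sum_missed_le (I := I) D L hD hv (sol I R (H (windowOf w σ) j)) σ hle using 1
    rw [← havg, ← Finset.sum_mul] at h2
    nlinarith
  calc (1 - φ) * ∑ σ : Equiv.Perm (Fin n), I.f (S (windowOf w σ))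
      ≤ ∑ σ : Equiv.Perm (Fin n), I.f (S (windowOf w σ)) -
        φ * ∑ σ : Equiv.Perm (Fin n), ∑ j ∈ Finset.range m, δ (windowOf w σ) j := by
        have : φ * ∑ σ : Equiv.Perm (Fin n), ∑ j ∈ Finset.range m, δ (windowOf w σ) j ≤
            φ * ∑ σ : Equiv.Perm (Fin n), I.f (S (windowOf w σ)) := by
          refine mul_le_mul_of_nonneg_left (Finset.sum_le_sum fun σ _ => hδ1 _) ?_
          positivity
        linarith
    _ ≤ ∑ σ : Equiv.Perm (Fin n), (I.f (S (windowOf w σ)) -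
        ∑ j ∈ Finset.range m, (if miss j σ then 1 else 0) * δ (windowOf w σ) j) := by
        rw [Finset.sum_sub_distrib]
        refine sub_le_sub_left ?_ _
        rw [Finset.sum_comm, Finset.sum_comm (s := Finset.univ (α := Equiv.Perm (Fin n))),
          Finset.mul_sum]
        exact Finset.sum_le_sum fun j _ => hswap j
    _ ≤ _ := Finset.sum_le_sum fun σ _ => hpoint σ

end Run

/-! ### Execution of deterministic programs -/

section Execution

variable {p n q : ℕ} (I : Problem p n q) (σ : Equiv.Perm (Fin n))

theorem runFor_add (a b : ℕ) (c : Config n) :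
    runFor I σ (a + b) c = (runFor I σ a c).bind (runFor I σ b) := by
  induction a generalizing c with
  | zero => simp [runFor]
  | succ a ih =>
    rw [Nat.succ_add, runFor, runFor, PMF.bind_bind]
    congr 1
    funext c'
    exact ih c'

theorem runFor_nil (T : ℕ) (s : State n) : runFor I σ T ([], s) = PMF.pure ([], s) := by
  induction T with
  | zero => rfl
  | succ T ih => rw [runFor, step, PMF.pure_bind, ih]

/-- `P` ends within `B` steps, in a state that satisfies `Q`. -/
def Ends (P : Prog) (s : State n) (B : ℕ) (Q : State n → Prop) : Prop :=
  ∃ t ≤ B, ∃ s', Q s' ∧ ∀ K, runFor I σ t (P :: K, s) = PMF.pure (K, s')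

/-- The effect of a program without loops and random choices. -/
noncomputable def exec : Prog → State n → State n
  | .skip, s => s
  | .assign x e, s => { s with reg := Function.update s.reg x (e.eval I σ s) }
  | .store a i j e, s => { s with
        arr := fun a' i' j' =>
          if a' = a ∧ i' = i.eval I σ s ∧ j' = j.eval I σ s then e.eval I σ s
          else s.arr a' i' j' }
  | .rand _ _, s => s
  | .arrive, s => { s with arrived := min (s.arrived + 1) n }
  | .select, s => { s with
        shortlist := if s.arrived = 0 then s.shortlist
          else s.shortlist ∪ itemAt σ s (s.arrived - 1) }
  | .insert S e, s => { s with
        set := Function.update s.set S (s.set S ∪ itemAt σ s (e.eval I σ s)) }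
  | .erase S e, s => { s with
        set := Function.update s.set S (s.set S \ itemAt σ s (e.eval I σ s)) }
  | .query v S, s => { s with val := Function.update s.val v (I.f (s.set S)) }
  | .copy v w, s => { s with val := Function.update s.val v (s.val w) }
  | .seq P Q, s => exec Q (exec P s)
  | .ite c P Q, s => open Classical in if c.holds I σ s then exec P s else exec Q s
  | .loop _ _, s => s

/-- The number of steps of a program without loops. -/
def Prog.len : Prog → ℕ
  | .seq P Q => P.len + Q.len + 1
  | .ite _ P Q => P.len + Q.len + 1
  | _ => 1

/-- No loops and no random choices. -/
def Prog.Simple : Prog → Prop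
  | .seq P Q => P.Simple ∧ Q.Simple
  | .ite _ P Q => P.Simple ∧ Q.Simple
  | .rand _ _ => False
  | .loop _ _ => False
  | _ => True

/-- A sequence of programs that depend on a parameter. -/
def each : ℕ → (ℕ → Prog) → Prog
  | 0, _ => .skip
  | j + 1, F => .seq (each j F) (F j)

variable {I σ}

theorem each_simple {F : ℕ → Prog} (h : ∀ j, (F j).Simple) (k : ℕ) : (each k F).Simple := by
  induction k with
  | zero => trivial
  | succ k ih => exact ⟨ih, h k⟩

theorem Ends.mono {P : Prog} {s : State n} {B B' : ℕ} {Q Q' : State n → Prop}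
    (h : Ends I σ P s B Q) (hB : B ≤ B') (hQ : ∀ s', Q s' → Q' s') : Ends I σ P s B' Q' := by
  obtain ⟨t, ht, s', hs', hrun⟩ := h
  exact ⟨t, ht.trans hB, s', hQ s' hs', hrun⟩

theorem Ends.seq {P P' : Prog} {s : State n} {a b : ℕ} {Q R : State n → Prop}
    (h : Ends I σ P s a Q) (h' : ∀ s', Q s' → Ends I σ P' s' b R) :
    Ends I σ (.seq P P') s (a + b + 1) R := by
  obtain ⟨t, ht, s', hs', hrun⟩ := h
  obtain ⟨t', ht', s'', hs'', hrun'⟩ := h' s' hs'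
  refine ⟨1 + t + t', by omega, s'', hs'', fun K => ?_⟩
  rw [runFor_add, runFor_add, runFor, step]
  simp [runFor, hrun, hrun']

theorem Ends.seq_le {P P' : Prog} {s : State n} {a b B : ℕ} {Q R : State n → Prop}
    (h : Ends I σ P s a Q) (h' : ∀ s', Q s' → Ends I σ P' s' b R) (hB : a + b + 1 ≤ B) :
    Ends I σ (.seq P P') s B R := (h.seq h').mono hB fun _ h => h

theorem Ends.ite_true {c : Cond} {P P' : Prog} {s : State n} {a : ℕ} {Q : State n → Prop}
    (hc : c.holds I σ s) (h : Ends I σ P s a Q) : Ends I σ (.ite c P P') s (a + 1) Q := by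
  obtain ⟨t, ht, s', hs', hrun⟩ := h
  refine ⟨1 + t, by omega, s', hs', fun K => ?_⟩
  rw [runFor_add, runFor, step]
  simp [runFor, hc, hrun]

theorem Ends.ite_false {c : Cond} {P P' : Prog} {s : State n} {a : ℕ} {Q : State n → Prop}
    (hc : ¬ c.holds I σ s) (h : Ends I σ P' s a Q) : Ends I σ (.ite c P P') s (a + 1) Q := by
  obtain ⟨t, ht, s', hs', hrun⟩ := h
  refine ⟨1 + t, by omega, s', hs', fun K => ?_⟩
  rw [runFor_add, runFor, step]
  simp [runFor, hc, hrun]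

theorem ends_of_step {P : Prog} {s s' : State n} {Q : State n → Prop} (hQ : Q s')
    (h : ∀ K, step I σ (P :: K, s) = PMF.pure (K, s')) : Ends I σ P s 1 Q :=
  ⟨1, le_rfl, s', hQ, fun K => by rw [runFor, h, PMF.pure_bind, runFor]⟩

theorem ends_exec {P : Prog} (hP : P.Simple) {s : State n} {Q : State n → Prop}
    (hQ : Q (exec I σ P s)) : Ends I σ P s P.len Q := by
  induction P generalizing s Q with
  | rand => exact hP.elim
  | loop => exact hP.elim
  | seq P P' ih ih' =>
    refine Ends.seq (ih hP.1 (Q := fun s' => s' = exec I σ P s) rfl) ?_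
    rintro s' rfl
    exact ih' hP.2 hQ
  | ite c P P' ih ih' =>
    by_cases hc : c.holds I σ s
    · rw [exec, if_pos hc] at hQ
      refine (Ends.ite_true hc (ih hP.1 hQ)).mono ?_ fun _ h => h
      simp only [Prog.len]; omega
    · rw [exec, if_neg hc] at hQ
      refine (Ends.ite_false hc (ih' hP.2 hQ)).mono ?_ fun _ h => h
      simp only [Prog.len]; omega
  | _ => exact ends_of_step hQ fun K => rfl

/-- The invariant is indexed by the iteration and decides the loop test, so it fixes the number of
iterations and thereby the running time. -/
theorem ends_loop {c : Cond} {P : Prog} (N : ℕ) (a : ℕ → ℕ) (J : ℕ → State n → Prop)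
    (hstep : ∀ i < N, ∀ s, J i s → c.holds I σ s ∧ Ends I σ P s (a i) (J (i + 1)))
    (hend : ∀ s, J N s → ¬ c.holds I σ s) (s : State n) (h0 : J 0 s) :
    Ends I σ (.loop c P) s (∑ i ∈ Finset.range N, (a i + 1) + 1) (J N) := by
  induction N generalizing a J s with
  | zero =>
    refine ends_of_step h0 fun K => ?_
    rw [step, if_neg (hend s h0)]
  | succ N ih =>
    obtain ⟨hc, t, ht, s', hs', hrun⟩ := hstep 0 (Nat.succ_pos N) s h0
    obtain ⟨t', ht', s'', hs'', hrun'⟩ := ih (fun i => a (i + 1)) (fun i => J (i + 1))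
      (fun i hi s hs => hstep (i + 1) (by omega) s hs) hend s' hs'
    refine ⟨1 + t + t', ?_, s'', hs'', fun K => ?_⟩
    · rw [Finset.sum_range_succ']
      omega
    · rw [runFor_add, runFor_add, runFor, step]
      simp [runFor, hc, hrun, hrun']

/-- Two states agree up to the registers `rs`, the arrays `as` and the values `vs`. -/
structure Agree (rs as vs : List ℕ) (s s' : State n) : Prop where
  arrived : s'.arrived = s.arrived
  shortlist : s'.shortlist = s.shortlist
  set : s'.set = s.set
  reg : ∀ x, x ∉ rs → s'.reg x = s.reg x
  arr : ∀ a, a ∉ as → s'.arr a = s.arr a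
  val : ∀ v, v ∉ vs → s'.val v = s.val v

theorem Agree.refl (rs as vs : List ℕ) (s : State n) : Agree rs as vs s s :=
  ⟨rfl, rfl, rfl, fun _ _ => rfl, fun _ _ => rfl, fun _ _ => rfl⟩

theorem Agree.trans {rs as vs : List ℕ} {s s' s'' : State n} (h : Agree rs as vs s s')
    (h' : Agree rs as vs s' s'') : Agree rs as vs s s'' :=
  ⟨h'.arrived.trans h.arrived, h'.shortlist.trans h.shortlist, h'.set.trans h.set,
    fun x hx => (h'.reg x hx).trans (h.reg x hx), fun x hx => (h'.arr x hx).trans (h.arr x hx),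
    fun x hx => (h'.val x hx).trans (h.val x hx)⟩

theorem Agree.mono {rs as vs rs' as' vs' : List ℕ} {s s' : State n} (h : Agree rs as vs s s')
    (hr : rs ⊆ rs') (ha : as ⊆ as') (hv : vs ⊆ vs') : Agree rs' as' vs' s s' :=
  ⟨h.arrived, h.shortlist, h.set, fun x hx => h.reg x fun h' => hx (hr h'),
    fun x hx => h.arr x fun h' => hx (ha h'), fun x hx => h.val x fun h' => hx (hv h')⟩

theorem itemAt_congr {s s' : State n} (h : s'.arrived = s.arrived) (t : ℕ) :
    itemAt σ s' t = itemAt σ s t := by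
  simp only [itemAt, h]

/-- The position of an item, where `n` stands for no item. -/
def code (σ : Equiv.Perm (Fin n)) : Option (Fin n) → ℕ
  | none => n
  | some x => σ.symm x

theorem itemAt_symm {s : State n} {x : Fin n} (h : (σ.symm x : ℕ) < s.arrived) :
    itemAt σ s (σ.symm x) = {x} := by
  rw [itemAt, dif_pos (σ.symm x).2, if_pos h]
  simp

/-- The position `n` never arrives, so inserting or erasing the item with the code of `none` has no
effect and no case distinction is needed. -/
theorem itemAt_code {s : State n} {o : Option (Fin n)}
    (h : ∀ x, o = some x → (σ.symm x : ℕ) < s.arrived) : itemAt σ s (code σ o) = o.toFinset := by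
  cases o with
  | none => simp [itemAt, code]
  | some x => exact itemAt_symm (h x rfl)

theorem exec_each_erase (S a k : ℕ) (s : State n) :
    exec I σ (each k fun j => .erase S (.arr a (.lit j) (.lit 0))) s =
      { s with set := Function.update s.set S (s.set S \
        (Finset.range k).biUnion fun j => itemAt σ s (s.arr a j 0)) } := by
  induction k with
  | zero => simp [each, exec]
  | succ k ih =>
    rw [each, exec, ih]
    simp only [exec, Expr.eval, Function.update_self, Function.update_idem]
    congr 2
    rw [Finset.range_add_one, Finset.biUnion_insert]
    ext x
    simp only [Finset.mem_sdiff, Finset.mem_union, itemAt]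
    tauto

theorem exec_each_insert (S a k : ℕ) (s : State n) :
    exec I σ (each k fun j => .insert S (.arr a (.lit j) (.lit 0))) s =
      { s with set := Function.update s.set S (s.set S ∪
        (Finset.range k).biUnion fun j => itemAt σ s (s.arr a j 0)) } := by
  induction k with
  | zero => simp [each, exec]
  | succ k ih =>
    rw [each, exec, ih]
    simp only [exec, Expr.eval, Function.update_self, Function.update_idem]
    congr 2
    rw [Finset.range_add_one, Finset.biUnion_insert]
    ext x
    simp only [Finset.mem_union, itemAt]
    tauto

/-- Copy a tuple. -/
def copyTuple (p a b : ℕ) : Prog :=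
  each p fun j => .store b (.lit j) (.lit 0) (.arr a (.lit j) (.lit 0))

theorem exec_copyTuple {a b : ℕ} (hab : a ≠ b) (k : ℕ) (s : State n) :
    exec I σ (copyTuple k a b) s =
      { s with arr := fun a' i j => if a' = b ∧ i < k ∧ j = 0 then s.arr a i 0
        else s.arr a' i j } := by
  unfold copyTuple
  induction k with
  | zero => simp [each, exec]
  | succ k ih =>
    rw [each, exec, ih]
    simp only [exec, Expr.eval, if_neg (fun h : a = b ∧ _ => hab h.1)]
    congr 1
    funext a' i j
    by_cases h1 : a' = b
    · by_cases h2 : j = 0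
      · rcases lt_trichotomy i k with h3 | h3 | h3
        · simp [h1, h2, h3, h3.ne, h3.trans (Nat.lt_succ_self k)]
        · simp [h1, h2, h3]
        · simp [h1, h2, h3.ne', h3.not_gt, show ¬ i < k + 1 by omega]
      · simp [h2]
    · simp [h1]

/-- Test the matroids of the item in register `8`; the result is in register `14`. -/
def testProg (p : ℕ) : Prog :=
  each p fun j => .ite (.lt (.lit j) (.deg (.reg 8)))
    (.ite (.indep (.mat (.reg 8) (.lit j)) 1) .skip (.assign 14 (.lit 0))) .skip

open Classical in
theorem exec_testProg (k : ℕ) (s : State n) (T : Finset (Fin n)) (hT : s.set 1 = T) :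
    exec I σ (testProg k) s = { s with
      reg := Function.update s.reg 14 (ite (∀ j < k, ∀ l, (matroidsOf I (itemAt σ s (s.reg 8)))[j]? = some l → ∃ h : l < q,
        (I.matroid ⟨l, h⟩).Indep ((T : Set (Fin n)) ∩ (I.matroid ⟨l, h⟩).E))
        (s.reg 14) 0) } := by
  unfold testProg
  induction k with
  | zero => simp [each, exec]
  | succ k ih =>
    rw [each, exec, ih]
    set b : ℕ := if ∀ j < k, ∀ l, (matroidsOf I (itemAt σ s (s.reg 8)))[j]? = some l →
        ∃ h : l < q, (I.matroid ⟨l, h⟩).Indep ((T : Set (Fin n)) ∩ (I.matroid ⟨l, h⟩).E)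
        then s.reg 14 else 0 with hb
    have hit : ∀ r : ℕ → ℕ, itemAt σ { s with reg := r } (s.reg 8) = itemAt σ s (s.reg 8) := fun r => rfl
    have h8 : ∀ y, Function.update s.reg 14 y 8 = s.reg 8 := fun y => by simp
    simp only [exec, Cond.holds, Expr.eval, h8, hit, hT, Function.update_idem]
    have hsplit : (∀ j < k + 1, ∀ l, (matroidsOf I (itemAt σ s (s.reg 8)))[j]? = some l →
        ∃ h : l < q, (I.matroid ⟨l, h⟩).Indep ((T : Set (Fin n)) ∩ (I.matroid ⟨l, h⟩).E)) ↔
        (∀ j < k, ∀ l, (matroidsOf I (itemAt σ s (s.reg 8)))[j]? = some l → ∃ h : l < q,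
          (I.matroid ⟨l, h⟩).Indep ((T : Set (Fin n)) ∩ (I.matroid ⟨l, h⟩).E)) ∧
        (∀ l, (matroidsOf I (itemAt σ s (s.reg 8)))[k]? = some l → ∃ h : l < q,
          (I.matroid ⟨l, h⟩).Indep ((T : Set (Fin n)) ∩ (I.matroid ⟨l, h⟩).E)) := by
      constructor
      · intro h
        exact ⟨fun j hj => h j (by omega), h k (by omega)⟩
      · rintro ⟨h, h'⟩ j hj
        rcases lt_or_eq_of_le (Nat.le_of_lt_succ hj) with hj | rfl
        · exact h j hj
        · exact h'
    by_cases h1 : k < (matroidsOf I (itemAt σ s (s.reg 8))).length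
    · have hgetD : (matroidsOf I (itemAt σ s (s.reg 8))).getD k 0 =
          (matroidsOf I (itemAt σ s (s.reg 8)))[k] := by
        rw [List.getD_eq_getElem?_getD, List.getElem?_eq_getElem h1, Option.getD_some]
      rw [if_pos h1]
      by_cases h2 : ∃ h : (matroidsOf I (itemAt σ s (s.reg 8))).getD k 0 < q,
          (I.matroid ⟨(matroidsOf I (itemAt σ s (s.reg 8))).getD k 0, h⟩).Indep
            ((T : Set (Fin n)) ∩ (I.matroid ⟨(matroidsOf I (itemAt σ s (s.reg 8))).getD k 0, h⟩).E)
      · rw [if_pos h2]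
        congr 2
        rw [hb]
        refine if_congr ?_ rfl rfl
        rw [hsplit]
        refine (and_iff_left ?_).symm
        intro l hl
        rw [List.getElem?_eq_getElem h1, Option.some.injEq] at hl
        rw [← hl, ← hgetD]
        exact h2
      · rw [if_neg h2]
        congr 2
        rw [if_neg]
        rw [hsplit]
        rintro ⟨-, h⟩
        refine h2 ?_
        rw [hgetD]
        exact h _ (List.getElem?_eq_getElem h1)
    · rw [if_neg h1]
      congr 2
      rw [hb]
      refine if_congr ?_ rfl rfl
      rw [hsplit]
      refine (and_iff_left ?_).symm
      intro l hl
      rw [List.getElem?_eq_none (not_lt.1 h1)] at hl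
      simp at hl

end Execution

/-! ### The program that searches for the best swap -/

section Search

variable {p n q : ℕ} {I : Problem p n q} {σ : Equiv.Perm (Fin n)}

theorem exec_seq (P Q : Prog) (s : State n) :
    exec I σ (.seq P Q) s = exec I σ Q (exec I σ P s) := rfl

open Classical in
theorem exec_ite (c : Cond) (P Q : Prog) (s : State n) :
    exec I σ (.ite c P Q) s = if c.holds I σ s then exec I σ P s else exec I σ Q s := rfl

theorem exec_store {a : ℕ} {i j e : Expr} {s : State n} {x y z : ℕ} (hi : i.eval I σ s = x)
    (hj : j.eval I σ s = y) (he : e.eval I σ s = z) :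
    exec I σ (.store a i j e) s = { s with
      arr := fun a' i' j' => if a' = a ∧ i' = x ∧ j' = y then z else s.arr a' i' j' } := by
  subst hi hj he
  rfl

/-- Try the swap that brings in the item in register `8` for the items in array `10`. -/
def tryProg (p : ℕ) : Prog :=
  .seq (each p fun j => .erase 1 (.arr 10 (.lit j) (.lit 0))) <|
  .seq (.insert 1 (.reg 8)) <|
  .seq (.assign 14 (.lit 1)) <|
  .seq (testProg p) <|
  .seq (.query 2 1) <|
  .seq (.ite (.lt (.lit 0) (.reg 14)) (.ite (.vlt 1 2)
    (.seq (.copy 1 2) (.seq (.assign 9 (.lit 1)) (copyTuple p 10 12))) .skip) .skip) <|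
  .seq (.erase 1 (.reg 8)) (each p fun j => .insert 1 (.arr 10 (.lit j) (.lit 0)))

theorem copyTuple_simple (p a b : ℕ) : (copyTuple p a b).Simple := by
  unfold copyTuple
  exact each_simple (fun _ => by trivial) p

theorem testProg_simple (p : ℕ) : (testProg p).Simple := by
  unfold testProg
  refine each_simple (fun _ => ?_) p
  exact ⟨⟨trivial, trivial⟩, trivial⟩

theorem tryProg_simple (p : ℕ) : (tryProg p).Simple := by
  refine ⟨each_simple (fun _ => ?_) p, trivial, trivial, testProg_simple p, trivial,
    ⟨⟨⟨trivial, trivial, copyTuple_simple p _ _⟩, trivial⟩, trivial⟩, trivial,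
    each_simple (fun _ => ?_) p⟩ <;> trivial

variable (I σ) in
/-- The swap `o` is stored in the value `v`, the flag `x` and the array `a`. -/
structure SwapRep (v x a : ℕ) (S : List (Fin n)) (e : Fin n)
    (o : Option (ℕ → Option (Fin n))) (s : State n) : Prop where
  val : s.val v = swapVal I S e o
  flag : s.reg x = if o.isSome then 1 else 0
  tuple : ∀ u, o = some u → ∀ j < p, s.arr a j 0 = code σ (u j)

/-- The set register `1` holds `S`, and register `8` the new item `e`. -/
structure SearchRep (σ : Equiv.Perm (Fin n)) (S : List (Fin n)) (e : Fin n) (s : State n) :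
    Prop where
  set : s.set 1 = S.toFinset
  reg : s.reg 8 = σ.symm e
  new : e ∉ S
  here : (σ.symm e : ℕ) < s.arrived
  arrived : ∀ x ∈ S, (σ.symm x : ℕ) < s.arrived

/-- The trial edits the set register of the current solution in place and undoes the edits
afterwards. A trial thus takes a number of steps that depends on `p` only, although it queries a set
of arbitrary size. -/
theorem exec_tryProg {S : List (Fin n)} {e : Fin n} {s : State n} (hrep : SearchRep σ S e s)
    (hS : I.Feasible S.toFinset) {u : ℕ → Option (Fin n)}
    (hu : ∀ j < p, s.arr 10 j 0 = code σ (u j) ∧ ∀ x, u j = some x → x ∈ S)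
    {o : Option (ℕ → Option (Fin n))} (ho : SwapRep I σ 1 9 12 S e o s) :
    Agree [9, 14] [12] [1, 2] s (exec I σ (tryProg p) s) ∧
      SwapRep I σ 1 9 12 S e (trySwap I S e u o) (exec I σ (tryProg p) s) := by
  classical
  set U := (Finset.range p).biUnion fun j => itemAt σ s (s.arr 10 j 0) with hU
  have hmem : ∀ x, x ∈ U ↔ ∃ j < p, u j = some x := by
    intro x
    simp only [hU, Finset.mem_biUnion, Finset.mem_range]
    refine exists_congr fun j => and_congr_right fun hj => ?_
    rw [(hu j hj).1, itemAt_code fun y hy => hrep.arrived y ((hu j hj).2 y hy)]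
    simp
  have hUS : U ⊆ S.toFinset := by
    intro x hx
    obtain ⟨j, hj, hx⟩ := (hmem x).1 hx
    exact List.mem_toFinset.2 ((hu j hj).2 x hx)
  set T := insert e (S.toFinset \ U) with hT
  have hsw : (swapped p S e u).toFinset = T := by
    ext x
    simp only [swapped, List.toFinset_append, List.toFinset_filter, Finset.mem_union,
      Finset.mem_filter, List.mem_toFinset, hT, Finset.mem_insert, Finset.mem_sdiff, hmem,
      decide_eq_true_eq, List.mem_singleton, not_exists, not_and]
    tauto
  have he : itemAt σ s (s.reg 8) = {e} := by
    rw [hrep.reg, itemAt_symm hrep.here]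
  set s1 : State n := { s with
    set := Function.update s.set 1 T, reg := Function.update s.reg 14 1 } with hs1
  have h1 : exec I σ (.assign 14 (.lit 1)) (exec I σ (.insert 1 (.reg 8))
      (exec I σ (each p fun j => .erase 1 (.arr 10 (.lit j) (.lit 0))) s)) = s1 := by
    rw [exec_each_erase, ← hU]
    simp only [exec, Expr.eval, Function.update_self, Function.update_idem]
    have hi : ∀ t, itemAt σ { s with set := Function.update s.set 1 (s.set 1 \ U) } t =
        itemAt σ s t := fun _ => rfl
    rw [hi, he, hrep.set, Finset.union_comm, ← Finset.insert_eq]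
  have hfeas := feasible_insert_iff (hS.subset (Finset.sdiff_subset (t := U))) e
  set b : ℕ := if I.Feasible T then 1 else 0 with hb
  set s2 : State n := { s with
    set := Function.update s.set 1 T, reg := Function.update s.reg 14 b } with hs2
  have h2 : exec I σ (testProg p) s1 = s2 := by
    rw [exec_testProg p s1 T (by simp [hs1])]
    simp only [hs1, hs2, Function.update_idem, Function.update_self]
    congr 2
    rw [hb]
    refine if_congr ?_ rfl rfl
    have hi : ∀ r S t, itemAt σ { s with set := S, reg := r } t =
        itemAt σ s t := fun _ _ _ => rfl
    rw [hT, hfeas, Function.update_of_ne (by norm_num), hi, he]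
    rfl
  set s3 : State n := { s2 with val := Function.update s.val 2 (I.f T) } with hs3
  have h3 : exec I σ (.query 2 1) s2 = s3 := by
    simp [exec, hs2, hs3]
  -- The undo is exact because `e` was not in `S` and the removed items were.
  have hrest : ∀ s4 : State n, s4.arrived = s.arrived → s4.reg 8 = s.reg 8 →
      s4.arr 10 = s.arr 10 → s4.set = Function.update s.set 1 T →
      exec I σ (each p fun j => .insert 1 (.arr 10 (.lit j) (.lit 0)))
        (exec I σ (.erase 1 (.reg 8)) s4) = { s4 with set := s.set } := by
    intro s4 ha hr harr hset
    rw [exec_each_insert]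
    simp only [exec, Expr.eval, Function.update_self, Function.update_idem, hr, harr, hset]
    congr 1
    have hUU : ((Finset.range p).biUnion fun j => itemAt σ
        { s4 with set := Function.update s.set 1 (T \ itemAt σ s4 (s.reg 8)) } (s.arr 10 j 0)) =
        U := by
      rw [hU]
      exact Finset.biUnion_congr rfl fun j _ => itemAt_congr (by simpa using ha) _
    rw [hUU, itemAt_congr ha, he]
    have : T \ {e} ∪ U = S.toFinset := by
      ext x
      have hx := @hUS x
      have hne : x = e → x ∉ S.toFinset := by
        rintro rfl; simpa using hrep.new
      simp only [hT, Finset.mem_union, Finset.mem_sdiff, Finset.mem_insert,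
        Finset.mem_singleton]
      tauto
    rw [this, ← hrep.set, Function.update_eq_self]
  simp only [tryProg, exec_seq, h1, h2, h3]
  have hvT : ∀ x, Function.update s.val 2 x 1 = s.val 1 := fun x => by simp
  have hr8 : ∀ x, Function.update s.reg 14 x 8 = s.reg 8 := fun x => by simp
  rw [exec_ite, exec_ite]
  have hc1 : (Cond.lt (.lit 0) (.reg 14)).holds I σ s3 ↔ I.Feasible T := by
    simp only [Cond.holds, Expr.eval, hs3, hs2, Function.update_self, hb]
    split_ifs with h <;> simp [h]
  have hc2 : (Cond.vlt 1 2).holds I σ s3 ↔ swapVal I S e o < I.f T := by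
    simp only [Cond.holds, hs3, hs2, Function.update_self, hvT, ho.val]
  have hskip : exec I σ .skip s3 = s3 := rfl
  rw [hskip]
  have hno : Agree [9, 14] [12] [1, 2] s { s3 with set := s.set } ∧
      SwapRep I σ 1 9 12 S e o { s3 with set := s.set } := by
    refine ⟨⟨rfl, rfl, rfl, fun x hx => ?_, fun _ _ => rfl, fun v hv => ?_⟩,
      ⟨?_, ?_, ho.tuple⟩⟩
    · simp only [List.mem_cons, not_or] at hx
      simp [hs3, hs2, hx]
    · simp only [List.mem_cons, not_or] at hv
      simp [hs3, hv]
    · simp [hs3, ho.val]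
    · simp [hs3, hs2, ho.flag]
  by_cases hfe : I.Feasible T
  · rw [if_pos (hc1.2 hfe)]
    by_cases hlt : swapVal I S e o < I.f T
    · rw [if_pos (hc2.2 hlt), trySwap, hsw, if_pos ⟨hfe, hlt⟩]
      rw [exec_seq, exec_seq, exec_copyTuple (by norm_num)]
      rw [hrest]
      rotate_left
      · rfl
      · simp [exec, hs3, hs2]
      · simp [exec, hs3, hs2]
      · rfl
      refine ⟨⟨rfl, rfl, rfl, fun x hx => ?_, fun a ha => ?_, fun v hv => ?_⟩, ⟨?_, ?_, ?_⟩⟩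
      · simp only [List.mem_cons, not_or] at hx
        simp [exec, hs3, hs2, hx]
      · simp only [List.mem_cons, not_or] at ha
        simp [exec, hs3, hs2, ha]
      · simp only [List.mem_cons, not_or] at hv
        simp [exec, hs3, hs2, hv]
      · simp [exec, hs3, hs2, swapVal, applySwap, hsw]
      · simp [Expr.eval, exec, hs3, hs2]
      · rintro u' hu' j hj
        obtain rfl := Option.some.inj hu'
        simp [exec, hs3, hs2, hj, (hu j hj).1]
    · rw [if_neg (fun h => hlt (hc2.1 h)), trySwap, hsw, if_neg (fun h => hlt h.2)]
      rw [hrest s3 rfl (by simp [hs3, hs2]) rfl rfl]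
      exact hno
  · rw [if_neg (fun h => hfe (hc1.1 h)), trySwap, hsw, if_neg (fun h => hfe h.1)]
    rw [hrest s3 rfl (by simp [hs3, hs2]) rfl rfl]
    exact hno

/-- Run through all swaps that bring in the item in register `8`. -/
def searchProg (p : ℕ) : ℕ → Prog
  | 0 => tryProg p
  | j + 1 =>
    .seq (.store 10 (.lit j) (.lit 0) (.reg 0)) <|
    .seq (searchProg p j) <|
    .seq (.store 11 (.lit j) (.lit 0) (.lit 0)) <|
    .loop (.lt (.arr 11 (.lit j) (.lit 0)) (.arr 5 (.mat (.reg 8) (.lit j)) (.lit 0))) <|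
      .seq (.store 10 (.lit j) (.lit 0)
        (.arr 6 (.mat (.reg 8) (.lit j)) (.arr 11 (.lit j) (.lit 0)))) <|
      .seq (searchProg p j) <|
      .store 11 (.lit j) (.lit 0) (.add (.arr 11 (.lit j) (.lit 0)) (.lit 1))

/-- The running time of `searchProg`. -/
def searchCost (p κ : ℕ) : ℕ → ℕ
  | 0 => (tryProg p).len
  | j + 1 => (κ + 1) * (searchCost p κ j + 5) + 5

variable (I σ) in
/-- The arrays `5` and `6` hold the lists `F l`. -/
def ListRep (σ : Equiv.Perm (Fin n)) (F : ℕ → List (Fin n)) (s : State n) : Prop :=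
  ∀ l, s.arr 5 l 0 = (F l).length ∧ ∀ i x, (F l)[i]? = some x → s.arr 6 l i = σ.symm x

theorem SearchRep.agree {S : List (Fin n)} {e : Fin n} {s s' : State n}
    (h : SearchRep σ S e s) {rs as vs : List ℕ} (ha : Agree rs as vs s s') (h8 : 8 ∉ rs) :
    SearchRep σ S e s' :=
  ⟨by rw [ha.set, h.set], by rw [ha.reg 8 h8, h.reg], h.new, by rw [ha.arrived]; exact h.here,
    fun x hx => by rw [ha.arrived]; exact h.arrived x hx⟩

theorem ListRep.agree {F : ℕ → List (Fin n)} {s s' : State n}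
    (h : ListRep σ F s) {rs as vs : List ℕ} (ha : Agree rs as vs s s') (h5 : 5 ∉ as)
    (h6 : 6 ∉ as) : ListRep σ F s' := by
  intro l
  rw [ha.arr 5 h5, ha.arr 6 h6]
  exact h l

/-- Level `j` keeps its choice and its loop counter in row `j` of the arrays `10` and `11`. The last
clause says that the search at level `j` leaves the rows from `j` on intact, so the inner loops
cannot disturb the outer ones. -/
theorem ends_searchProg {S : List (Fin n)} {e : Fin n} (hnd : S.Nodup)
    (hS : I.Feasible S.toFinset) (j : ℕ) (hj : j ≤ p) (u : ℕ → Option (Fin n))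
    (o : Option (ℕ → Option (Fin n))) (s : State n) (h0 : s.reg 0 = n)
    (hrep : SearchRep σ S e s) (hlist : ListRep σ (listIn I S) s)
    (hu : ∀ i, j ≤ i → i < p → s.arr 10 i 0 = code σ (u i) ∧ ∀ x, u i = some x → x ∈ S)
    (ho : SwapRep I σ 1 9 12 S e o s) :
    Ends I σ (searchProg p j) s (searchCost p I.kappa j) fun s' =>
      Agree [9, 14] [10, 11, 12] [1, 2] s s' ∧
      SwapRep I σ 1 9 12 S e (searchSwap I S e j u o) s' ∧
      ∀ i, j ≤ i → s'.arr 10 i = s.arr 10 i ∧ s'.arr 11 i = s.arr 11 i := by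
  induction j generalizing u o s with
  | zero =>
    refine ends_exec (tryProg_simple p) ?_
    obtain ⟨h1, h2⟩ := exec_tryProg hrep hS (fun j hj => hu j (Nat.zero_le _) hj) ho
    refine ⟨h1.mono (by simp) (by simp) (by simp), h2, fun i _ => ?_⟩
    rw [h1.arr 10 (by simp), h1.arr 11 (by simp)]
    exact ⟨rfl, rfl⟩
  | succ j ih =>
    set l := (mats I e).getD j 0 with hl
    have hlen : (listIn I S l).length ≤ I.kappa := listIn_length_le hnd hS l
    let F : Option (ℕ → Option (Fin n)) → Option (Fin n) → Option (ℕ → Option (Fin n)) :=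
      fun o x => searchSwap I S e j (Function.update u j x) o
    -- one run of the inner search
    have hinner : ∀ (x : Option (Fin n)) (hx : ∀ y, x = some y → y ∈ S) (o) (s1 : State n),
        Agree [9, 14] [10, 11, 12] [1, 2] s s1 → SwapRep I σ 1 9 12 S e o s1 →
        s1.arr 10 j 0 = code σ x → (∀ i, j < i → s1.arr 10 i = s.arr 10 i) →
        Ends I σ (searchProg p j) s1 (searchCost p I.kappa j) fun s' =>
          Agree [9, 14] [10, 11, 12] [1, 2] s1 s' ∧ SwapRep I σ 1 9 12 S e (F o x) s' ∧
          ∀ i, j ≤ i → s'.arr 10 i = s1.arr 10 i ∧ s'.arr 11 i = s1.arr 11 i := by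
      intro x hx o s1 ha ho h10 hi
      refine ih (by omega) _ _ s1 ((ha.reg 0 (by simp)).trans h0) (hrep.agree ha (by simp))
        (hlist.agree ha (by simp) (by simp)) ?_ ho
      intro i hji hip
      rcases eq_or_lt_of_le hji with rfl | hlt
      · rw [Function.update_self]
        exact ⟨h10, hx⟩
      · rw [Function.update_of_ne (by omega), hi i hlt]
        exact hu i hlt hip
    -- After `c` rounds the accumulator is the fold over the first `c` items of the list. The choice
    -- `none` was tried before the loop, with the code `n` from register `0`.
    let J : ℕ → State n → Prop := fun c s' =>
      Agree [9, 14] [10, 11, 12] [1, 2] s s' ∧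
      SwapRep I σ 1 9 12 S e
        ((((listIn I S l).take c).map some).foldl F (F o none)) s' ∧
      s'.arr 11 j 0 = c ∧ ∀ i, j < i → s'.arr 10 i = s.arr 10 i ∧ s'.arr 11 i = s.arr 11 i
    have hmat : ∀ s' : State n, Agree [9, 14] [10, 11, 12] [1, 2] s s' →
        (Expr.mat (.reg 8) (.lit j)).eval I σ s' = l := by
      intro s' ha
      have hr := hrep.agree ha (by simp)
      simp only [Expr.eval]
      rw [hr.reg, itemAt_symm hr.here]
      rfl
    have hstoreAgree : ∀ (s' : State n) (a i y : ℕ), a ∈ [10, 11, 12] →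
        Agree [9, 14] [10, 11, 12] [1, 2] s s' →
        Agree [9, 14] [10, 11, 12] [1, 2] s { s' with
          arr := fun a' i' j' => if a' = a ∧ i' = i ∧ j' = 0 then y else s'.arr a' i' j' } := by
      intro s' a i y ha h
      refine ⟨h.arrived, h.shortlist, h.set, h.reg, fun a' ha' => ?_, h.val⟩
      rw [← h.arr a' ha']
      funext i' j'
      have : a' ≠ a := fun hh => ha' (hh ▸ ha)
      simp [this]
    have hcost : 1 + (searchCost p I.kappa j + (1 + (∑ i ∈ Finset.range (listIn I S l).length,
        ((1 + (searchCost p I.kappa j + 1 + 1) + 1) + 1) + 1) + 1) + 1) + 1 ≤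
        searchCost p I.kappa (j + 1) := by
      rw [Finset.sum_const, Finset.card_range, smul_eq_mul, searchCost]
      nlinarith [Nat.mul_le_mul_right (searchCost p I.kappa j + 5) hlen]
    refine Ends.mono ?_ hcost fun s' h => h
    rw [searchProg]
    refine Ends.seq (ends_exec (Q := fun s' => s' = { s with
        arr := fun a' i' j' => if a' = 10 ∧ i' = j ∧ j' = 0 then n else s.arr a' i' j' })
      (by trivial) (exec_store rfl rfl h0)) ?_
    rintro s1 rfl
    refine Ends.seq (hinner none (by simp) o _ (hstoreAgree s 10 j n (by simp) (Agree.refl _ _ _ s))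
      ⟨ho.val, ho.flag, fun u hu j hj => by simpa using ho.tuple u hu j hj⟩ (by simp [code])
      (fun i hi => by funext k; simp [hi.ne'])) ?_
    rintro s2 ⟨ha2, ho2, hi2⟩
    refine Ends.seq (ends_exec (Q := J 0) (by trivial) ?_) ?_
    · rw [exec_store (x := j) (y := 0) (z := 0) rfl rfl rfl]
      have ha2' := (hstoreAgree s 10 j n (by simp) (Agree.refl _ _ _ s)).trans ha2
      have hst := hstoreAgree s2 11 j 0 (by simp) ha2'
      refine ⟨?_, ?_, ?_, ?_⟩
      · exact hst
      · refine ⟨?_, ?_, fun u hu j hj => ?_⟩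
        · simpa [exec] using ho2.val
        · simpa [exec] using ho2.flag
        · simpa [exec, Expr.eval] using ho2.tuple u (by simpa using hu) j hj
      · simp
      · intro i hi
        obtain ⟨e1, e2⟩ := hi2 i hi.le
        constructor
        · funext k
          simp [e1, hi.ne']
        · funext k
          simp [e2, hi.ne']
    · intro s3 hs3
      refine (ends_loop (listIn I S l).length
        (fun _ => 1 + (searchCost p I.kappa j + 1 + 1) + 1) J ?_ ?_ s3 hs3).mono
        le_rfl ?_
      · rintro c hc s4 ⟨ha, hsw, h11, hi⟩
        have hl4 := hlist.agree ha (by simp) (by simp) l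
        have hm := hmat s4 ha
        obtain ⟨x, hx⟩ : ∃ x, (listIn I S l)[c]? = some x :=
          ⟨_, List.getElem?_eq_getElem hc⟩
        have hxS : x ∈ S := (List.mem_filter.1 (List.mem_of_getElem? hx)).1
        constructor
        · simp only [Cond.holds]
          simp only [Expr.eval] at hm ⊢
          rw [hm, h11, hl4.1]
          exact hc
        · refine Ends.seq (ends_exec (Q := fun s' => s' = { s4 with
              arr := fun a' i' j' => if a' = 10 ∧ i' = j ∧ j' = 0 then (σ.symm x : ℕ) else s4.arr a' i' j' })
            (by trivial) (exec_store rfl rfl ?_)) ?_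
          · simp only [Expr.eval] at hm ⊢
            rw [hm, h11, hl4.2 c x hx]
          rintro s5 rfl
          refine Ends.seq (hinner (some x) (fun y hy => Option.some.inj hy ▸ hxS) _ _
            (hstoreAgree s4 10 j _ (by simp) ha)
            ⟨hsw.val, hsw.flag, fun u hu j hj => by simpa using hsw.tuple u hu j hj⟩
            (by simp [code]) (fun i hi' => by funext k; simp [hi'.ne', (hi i hi').1])) ?_
          rintro s6 ⟨ha6, ho6, hi6⟩
          have h11' : s6.arr 11 j 0 = c := by
            rw [(hi6 j le_rfl).2]
            simpa using h11
          refine ends_exec (by trivial) ?_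
          rw [exec_store (x := j) (y := 0) (z := c + 1) rfl rfl
            (by simp only [Expr.eval]; rw [h11'])]
          have hst := hstoreAgree s6 11 j (c + 1) (by simp)
            ((hstoreAgree s4 10 j (σ.symm x) (by simp) ha).trans ha6)
          refine ⟨?_, ?_, ?_, ?_⟩
          · exact hst
          · have htake : (((listIn I S l).take (c + 1)).map some).foldl F (F o none) =
                F ((((listIn I S l).take c).map some).foldl F (F o none)) (some x) := by
              rw [List.take_add_one, hx]
              simp
            rw [htake]
            refine ⟨?_, ?_, fun u hu j hj => ?_⟩
            · simpa [exec] using ho6.val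
            · simpa [exec] using ho6.flag
            · simpa [exec, Expr.eval] using ho6.tuple u hu j hj
          · simp
          · intro i hi'
            obtain ⟨e1, e2⟩ := hi6 i hi'.le
            constructor
            · funext k
              simp [e1, hi'.ne', (hi i hi').1]
            · funext k
              simp [e2, hi'.ne', (hi i hi').2]
      · rintro s4 ⟨ha, -, h11, -⟩
        have hm := hmat s4 ha
        simp only [Cond.holds]
        simp only [Expr.eval] at hm ⊢
        rw [hm, h11, (hlist.agree ha (by simp) (by simp) l).1]
        exact lt_irrefl _
      · rintro s4 ⟨ha, hsw, -, hi⟩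
        refine ⟨ha, ?_, fun i hi' => hi i hi'⟩
        rw [List.take_length] at hsw
        exact hsw

end Search

/-! ### Frame rule for programs without loops -/

section Frames

variable {p n q : ℕ} {I : Problem p n q} {σ : Equiv.Perm (Fin n)}

/-- A program without loops that only changes the registers `rs`, the arrays `as` and the values
`vs`. -/
def Prog.Writes (rs as vs : List ℕ) : Prog → Prop
  | .skip => True
  | .assign x _ => x ∈ rs
  | .store a _ _ _ => a ∈ as
  | .query v _ => v ∈ vs
  | .copy v _ => v ∈ vs
  | .seq P Q => P.Writes rs as vs ∧ Q.Writes rs as vs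
  | .ite _ P Q => P.Writes rs as vs ∧ Q.Writes rs as vs
  | _ => False

theorem each_writes {rs as vs : List ℕ} {F : ℕ → Prog} (h : ∀ j, (F j).Writes rs as vs) (k : ℕ) :
    (each k F).Writes rs as vs := by
  induction k with
  | zero => trivial
  | succ k ih => exact ⟨ih, h k⟩

theorem Prog.Writes.simple {rs as vs : List ℕ} {P : Prog} (h : P.Writes rs as vs) :
    P.Simple := by
  induction P with
  | seq P Q ih ih' => exact ⟨ih h.1, ih' h.2⟩
  | ite c P Q ih ih' => exact ⟨ih h.1, ih' h.2⟩
  | rand => exact h.elim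
  | loop => exact h.elim
  | _ => trivial

theorem agree_exec {rs as vs : List ℕ} {P : Prog} (h : P.Writes rs as vs) (s : State n) :
    Agree rs as vs s (exec I σ P s) := by
  classical
  induction P generalizing s with
  | skip => exact Agree.refl _ _ _ s
  | assign x e =>
    refine ⟨rfl, rfl, rfl, fun y hy => ?_, fun _ _ => rfl, fun _ _ => rfl⟩
    exact Function.update_of_ne (fun hh : y = _ => hy (by rw [hh]; exact h)) _ _
  | store a i j e =>
    refine ⟨rfl, rfl, rfl, fun _ _ => rfl, fun b hb => ?_, fun _ _ => rfl⟩
    funext i' j'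
    exact if_neg fun hh : b = a ∧ _ => hb (by rw [hh.1]; exact h)
  | query v S =>
    refine ⟨rfl, rfl, rfl, fun _ _ => rfl, fun _ _ => rfl, fun y hy => ?_⟩
    exact Function.update_of_ne (fun hh : y = _ => hy (by rw [hh]; exact h)) _ _
  | copy v w =>
    refine ⟨rfl, rfl, rfl, fun _ _ => rfl, fun _ _ => rfl, fun y hy => ?_⟩
    exact Function.update_of_ne (fun hh : y = _ => hy (by rw [hh]; exact h)) _ _
  | seq P Q ih ih' => exact (ih h.1 s).trans (ih' h.2 _)
  | ite c P Q ih ih' =>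
    rw [exec_ite]
    split_ifs
    · exact ih h.1 s
    · exact ih' h.2 s
  | _ => exact h.elim

end Frames

/-! ### State invariants and the processing of one item -/

section Items

variable {p n q : ℕ} {I : Problem p n q} {σ : Equiv.Perm (Fin n)}

/-- The successor of the position of an item, or `0` for no item. -/
def pcode (σ : Equiv.Perm (Fin n)) : Option (Fin n) → ℕ
  | none => 0
  | some x => σ.symm x + 1

variable (I σ) in
/-- The data structures for the solution `S`, the history `h` and the shortlist `A`, when `t` items
have arrived. -/
structure Base (A1 A2 : ℕ → ℕ → ℕ) (cnt : ℕ → ℕ) (m : ℕ) (S : List (Fin n))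
    (h : List (Option (Fin n))) (A : Finset (Fin n)) (t j : ℕ) (s : State n) : Prop where
  size : s.reg 0 = n
  -- The register holds `m - 1`, the inclusive bound that `rand` needs in order to draw from `m`
  -- values.
  windows : s.reg 2 + 1 = m
  window : s.reg 6 = j
  next : s.reg 5 = t
  arrived : s.arrived = t
  prio : s.arr 1 = A1
  again : s.arr 2 = A2
  count : ∀ i < m, s.arr 3 i 0 = cnt i
  hist : ∀ x, s.arr 4 x 0 = pcode σ (entry h x)
  lists : ListRep σ (listIn I S) s
  inS : ∀ e, s.arr 7 (σ.symm e) 0 = if e ∈ S then 1 else 0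
  inA : ∀ e, s.arr 8 (σ.symm e) 0 = if e ∈ A then 1 else 0
  shortlist : s.shortlist = A
  out : s.set 0 = ∅
  set : s.set 1 = S.toFinset

variable {A1 A2 : ℕ → ℕ → ℕ} {cnt : ℕ → ℕ} {m : ℕ} {S : List (Fin n)}
  {h : List (Option (Fin n))} {A : Finset (Fin n)} {t j : ℕ} {s s' : State n}

theorem Base.agree (hb : Base I σ A1 A2 cnt m S h A t j s) {rs as vs : List ℕ}
    (ha : Agree rs as vs s s') (hr : ∀ x ∈ rs, x ∉ [0, 2, 5, 6])
    (has : ∀ x ∈ as, x ∉ [1, 2, 3, 4, 5, 6, 7, 8]) : Base I σ A1 A2 cnt m S h A t j s' := by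
  have hr' : ∀ x ∈ [0, 2, 5, 6], s'.reg x = s.reg x := fun x hx =>
    ha.reg x fun hh => hr x hh hx
  have has' : ∀ x ∈ [1, 2, 3, 4, 5, 6, 7, 8], s'.arr x = s.arr x := fun x hx =>
    ha.arr x fun hh => has x hh hx
  constructor
  · rw [hr' 0 (by simp), hb.size]
  · rw [hr' 2 (by simp), hb.windows]
  · rw [hr' 6 (by simp), hb.window]
  · rw [hr' 5 (by simp), hb.next]
  · rw [ha.arrived, hb.arrived]
  · rw [has' 1 (by simp), hb.prio]
  · rw [has' 2 (by simp), hb.again]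
  · rw [has' 3 (by simp)]; exact hb.count
  · rw [has' 4 (by simp)]; exact hb.hist
  · exact hb.lists.agree ha (fun hh => has 5 hh (by simp)) fun hh => has 6 hh (by simp)
  · rw [has' 7 (by simp)]; exact hb.inS
  · rw [has' 8 (by simp)]; exact hb.inA
  · rw [ha.shortlist, hb.shortlist]
  · rw [ha.set, hb.out]
  · rw [ha.set, hb.set]

/-- Find the best swap for the item in register `8`. -/
def evalProg (p : ℕ) : Prog :=
  .seq (.query 1 1) (.seq (.assign 9 (.lit 0)) (searchProg p p))

theorem ends_evalProg {e : Fin n} (hnd : S.Nodup) (hS : I.Feasible S.toFinset)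
    (h0 : s.reg 0 = n) (hrep : SearchRep σ S e s) (hlist : ListRep σ (listIn I S) s) :
    Ends I σ (evalProg p) s (searchCost p I.kappa p + 4) fun s' =>
      Agree [9, 14] [10, 11, 12] [1, 2] s s' ∧ SwapRep I σ 1 9 12 S e (bestSwap I S e) s' := by
  set s1 := exec I σ (.assign 9 (.lit 0)) (exec I σ (.query 1 1) s) with hs1
  have ha : Agree [9, 14] [10, 11, 12] [1, 2] s s1 :=
    agree_exec (P := .seq (.query 1 1) (.assign 9 (.lit 0))) ⟨by simp [Prog.Writes], by simp [Prog.Writes]⟩ s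
  have hval : s1.val 1 = I.f S.toFinset := by
    simp [hs1, exec, hrep.set]
  have hreg : s1.reg 9 = 0 := by
    simp [hs1, exec, Expr.eval]
  refine Ends.mono (B := 1 + (1 + searchCost p I.kappa p + 1) + 1) ?_ (by omega) fun s' h => h
  refine Ends.seq (ends_exec (Q := fun s' => s' = exec I σ (.query 1 1) s) (by trivial) rfl) ?_
  rintro s' rfl
  refine Ends.seq (ends_exec (Q := fun s' => s' = s1) (by trivial) rfl) ?_
  rintro s' rfl
  refine (ends_searchProg hnd hS p le_rfl (fun _ => none) none s1
    ((ha.reg 0 (by simp)).trans h0) (hrep.agree ha (by simp))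
    (hlist.agree ha (by simp) (by simp)) (fun i h1 h2 => by omega)
    ⟨hval, by simpa using hreg, by simp⟩).mono le_rfl ?_
  rintro s' ⟨h1, h2, -⟩
  exact ⟨ha.trans h1, h2⟩

/-- Remember the swap found by `evalProg`. -/
def takeProg (p : ℕ) : Prog :=
  .seq (.copy 0 1) (.seq (.assign 11 (.reg 9)) (.seq (.assign 12 (.reg 8)) (copyTuple p 12 13)))

theorem takeProg_writes (p : ℕ) : (takeProg p).Writes [11, 12] [13] [0] := by
  refine ⟨by simp [Prog.Writes], by simp [Prog.Writes], by simp [Prog.Writes], ?_⟩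
  refine each_writes (fun _ => ?_) p
  simp [Prog.Writes]

theorem exec_takeProg {e : Fin n} {o : Option (ℕ → Option (Fin n))}
    (hs : SwapRep I σ 1 9 12 S e o s) :
    SwapRep I σ 0 11 13 S e o (exec I σ (takeProg p) s) ∧
      (exec I σ (takeProg p) s).reg 12 = s.reg 8 := by
  rw [takeProg, exec_seq, exec_seq, exec_seq, exec_copyTuple (by norm_num)]
  refine ⟨⟨?_, ?_, fun u hu j hj => ?_⟩, ?_⟩
  · simpa [exec] using hs.val
  · simpa [exec, Expr.eval] using hs.flag
  · simpa [exec, hj] using hs.tuple u hu j hj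
  · simp [exec, Expr.eval]

variable (I σ) in
/-- The best item so far and its swap. -/
structure Cand (A1 : ℕ → ℕ → ℕ) (S : List (Fin n)) (o : Option (Fin n)) (s : State n) : Prop where
  val : s.val 0 = o.elim (I.f S.toFinset) (gain I S)
  item : s.reg 10 = pcode σ o
  -- The shift by one puts every actual priority above the value `0` that stands for no item.
  prio : s.reg 16 = o.elim 0 fun e => A1 (σ.symm e) 0 + 1
  flag : o = none → s.reg 11 = 0
  swap : ∀ e, o = some e → s.reg 12 = σ.symm e ∧ SwapRep I σ 0 11 13 S e (bestSwap I S e) s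

theorem SwapRep.agree {v x a : ℕ} {e : Fin n} {o : Option (ℕ → Option (Fin n))}
    (hs : SwapRep I σ v x a S e o s) {rs as vs : List ℕ} (ha : Agree rs as vs s s')
    (hv : v ∉ vs) (hx : x ∉ rs) (ha' : a ∉ as) : SwapRep I σ v x a S e o s' :=
  ⟨by rw [ha.val v hv, hs.val], by rw [ha.reg x hx, hs.flag],
    fun u hu j hj => by rw [ha.arr a ha', hs.tuple u hu j hj]⟩

theorem Cand.agree {o : Option (Fin n)} (hc : Cand I σ A1 S o s) {rs as vs : List ℕ}
    (ha : Agree rs as vs s s') (hv : 0 ∉ vs) (hr : ∀ x ∈ rs, x ∉ [10, 11, 12, 16])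
    (has : 13 ∉ as) : Cand I σ A1 S o s' := by
  have hr' : ∀ x ∈ [10, 11, 12, 16], s'.reg x = s.reg x := fun x hx =>
    ha.reg x fun hh => hr x hh hx
  constructor
  · rw [ha.val 0 hv, hc.val]
  · rw [hr' 10 (by simp), hc.item]
  · rw [hr' 16 (by simp), hc.prio]
  · rw [hr' 11 (by simp)]; exact hc.flag
  · intro e he
    rw [hr' 12 (by simp)]
    exact ⟨(hc.swap e he).1, (hc.swap e he).2.agree ha hv (fun hh => hr 11 hh (by simp)) has⟩

/-- Compare the item in register `8` with the best item; the result is in register `14`. -/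
def compareProg : Prog :=
  .seq (.assign 14 (.lit 0)) <|
  .ite (.vlt 0 1) (.assign 14 (.lit 1)) <|
  .ite (.vlt 1 0) .skip <|
  .ite (.lt (.reg 16) (.add (.arr 1 (.reg 8) (.lit 0)) (.lit 1))) (.assign 14 (.lit 1)) .skip

theorem compareProg_writes : compareProg.Writes [14] [] [] := by
  simp [compareProg, Prog.Writes]

-- With no item so far, value `0` is `f S` and the stored priority is `0`. The gain of the new item
-- is at least `f S`, and in case of equality the priority test is won, so the first item is always
-- accepted.
open Classical in
theorem exec_compareProg {v : Fin n → ℕ} (hv : ∀ e, v e = A1 (σ.symm e) 0)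
    {o : Option (Fin n)} {e : Fin n} (hc : Cand I σ A1 S o s)
    (hval : s.val 1 = gain I S e) (h8 : s.reg 8 = σ.symm e) (h1 : s.arr 1 = A1) :
    (exec I σ compareProg s).reg 14 = if ∀ b, o = some b → Worse I v S b e then 1 else 0 := by
  have h16 := hc.prio
  have hval0 := hc.val
  have hr : ∀ (x y : ℕ), x ≠ 14 → Function.update s.reg 14 y x = s.reg x := fun x y hx => by
    simp [hx]
  simp only [compareProg, exec, Cond.holds, Expr.eval, hr 16 _ (by norm_num),
    hr 8 _ (by norm_num), h1, h8, hval, hval0, h16]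
  cases o with
  | none =>
    have hg : ¬ gain I S e < I.f S.toFinset := not_lt.2 (le_gain S e)
    by_cases hlt : I.f S.toFinset < gain I S e <;> simp [hlt, hg]
  | some b =>
    simp only [Option.elim_some, Option.some.injEq, forall_eq', Worse, hv]
    rcases lt_trichotomy (gain I S b) (gain I S e) with hlt | heq | hgt
    · simp [hlt]
    · by_cases hlt : A1 (σ.symm b) 0 < A1 (σ.symm e) 0 <;> simp [heq, hlt]
    · simp [hgt, hgt.not_gt, hgt.ne']

/-- A multiple of an expression. -/
def times : ℕ → Expr → Expr
  | 0, _ => .lit 0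
  | c + 1, e => .add (times c e) e

theorem eval_times (c : ℕ) (e : Expr) : (times c e).eval I σ s = c * e.eval I σ s := by
  induction c with
  | zero => simp [times, Expr.eval]
  | succ c ih => rw [times, Expr.eval, ih]; ring

/-- Put the item in register `8` on the shortlist, if it is not in the sample and the window has
less than `L` shortlisted items. -/
def selectProg (D L : ℕ) : Prog :=
  .ite (.lt (.arr 3 (.reg 6) (.lit 0)) (times D (.add (.reg 7) (.lit 1))))
    (.ite (.lt (.reg 13) (.lit L))
      (.seq .select (.seq (.store 8 (.reg 8) (.lit 0) (.lit 1))
        (.assign 13 (.add (.reg 13) (.lit 1))))) .skip) .skip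

theorem selectProg_simple (D L : ℕ) : (selectProg D L).Simple := by
  simp [selectProg, Prog.Simple]

theorem exec_selectProg {D L r w : ℕ} {e : Fin n} (hb : Base I σ A1 A2 cnt m S h A (t + 1) j s)
    (hj : j < m) (hw : cnt j = w) (h7 : s.reg 7 = r) (h8 : s.reg 8 = σ.symm e)
    (he : (σ.symm e : ℕ) = t) {l : List (Fin n)} (h13 : s.reg 13 = l.length) {A0 : Finset (Fin n)}
    (hA : A = A0 ∪ l.toFinset) {o : Option (Fin n)} (hc : Cand I σ A1 S o s) :
    Base I σ A1 A2 cnt m S h (A0 ∪ (if w < D * (r + 1) ∧ l.length < L then e :: l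
        else l).toFinset) (t + 1) j (exec I σ (selectProg D L) s) ∧
      Cand I σ A1 S o (exec I σ (selectProg D L) s) ∧
      (exec I σ (selectProg D L) s).reg 13 =
        (if w < D * (r + 1) ∧ l.length < L then e :: l else l).length ∧
      (exec I σ (selectProg D L) s).reg 7 = r := by
  classical
  have hc1 : (Cond.lt (.arr 3 (.reg 6) (.lit 0)) (times D (.add (.reg 7) (.lit 1)))).holds I σ s ↔
      w < D * (r + 1) := by
    simp only [Cond.holds, eval_times]
    simp only [Expr.eval, hb.window, hb.count j hj, hw, h7]
  have hc2 : (Cond.lt (.reg 13) (.lit L)).holds I σ s ↔ l.length < L := by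
    simp only [Cond.holds, Expr.eval, h13]
  rw [selectProg, exec_ite, exec_ite]
  by_cases hh : w < D * (r + 1) ∧ l.length < L
  · rw [if_pos (hc1.2 hh.1), if_pos (hc2.2 hh.2), if_pos hh, exec_seq, exec_seq]
    set s1 := exec I σ .select s with hs1
    have hA1 : s1.shortlist = A0 ∪ (e :: l).toFinset := by
      simp only [hs1, exec, hb.arrived, hb.shortlist]
      rw [if_neg (Nat.succ_ne_zero t), Nat.add_sub_cancel, ← he,
        itemAt_symm (by rw [hb.arrived]; omega), hA, List.toFinset_cons]
      ext x
      simp only [Finset.mem_union, Finset.mem_singleton, Finset.mem_insert]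
      tauto
    have h8' : (Expr.reg 8).eval I σ s1 = σ.symm e := h8
    rw [exec_store (x := (σ.symm e : ℕ)) (y := 0) (z := 1) h8' rfl rfl]
    refine ⟨⟨?_, ?_, ?_, ?_, ?_, ?_, ?_, ?_, ?_, ?_, ?_, ?_, ?_, ?_, ?_⟩,
      ⟨?_, ?_, ?_, ?_, fun x hx => ⟨?_, ⟨?_, ?_, fun u hu i hi => ?_⟩⟩⟩, ?_, ?_⟩
    · simpa [exec, hs1] using hb.size
    · simpa [exec, hs1] using hb.windows
    · simpa [exec, hs1] using hb.window
    · simpa [exec, hs1] using hb.next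
    · simpa [exec, hs1] using hb.arrived
    · simpa [exec, hs1] using hb.prio
    · simpa [exec, hs1] using hb.again
    · simpa [exec, hs1] using hb.count
    · simpa [exec, hs1] using hb.hist
    · simpa [ListRep, exec, hs1] using hb.lists
    · simpa [exec, hs1] using hb.inS
    · intro x
      have := hb.inA x
      rw [hA] at this
      by_cases hx : x = e
      · subst hx
        simp [exec]
      · have hne : (σ.symm x : ℕ) ≠ σ.symm e := fun hh =>
          hx (σ.symm.injective (Fin.ext hh))
        simpa [exec, hne, hs1, hx] using this
    · simpa [exec] using hA1
    · simpa [exec, hs1] using hb.out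
    · simpa [exec, hs1] using hb.set
    · simpa [exec, hs1] using hc.val
    · simpa [exec, hs1] using hc.item
    · simpa [exec, hs1] using hc.prio
    · simpa [exec, hs1] using hc.flag
    · simpa [exec, hs1] using (hc.swap x hx).1
    · simpa [exec, hs1] using (hc.swap x hx).2.val
    · simpa [exec, hs1] using (hc.swap x hx).2.flag
    · simpa [exec, hs1] using (hc.swap x hx).2.tuple u hu i hi
    · simp [exec, hs1, Expr.eval, h13]
    · simp [exec, hs1, h7]
  · have hs : (if (Cond.lt (.arr 3 (.reg 6) (.lit 0))
        (times D (.add (.reg 7) (.lit 1)))).holds I σ s then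
        if (Cond.lt (.reg 13) (.lit L)).holds I σ s then
        exec I σ (.seq .select (.seq (.store 8 (.reg 8) (.lit 0) (.lit 1))
        (.assign 13 (.add (.reg 13) (.lit 1))))) s else exec I σ .skip s else exec I σ .skip s) =
        s := by
      rw [hc1, hc2]
      by_cases h1 : w < D * (r + 1)
      · rw [if_pos h1, if_neg fun h2 => hh ⟨h1, h2⟩]
        rfl
      · rw [if_neg h1]
        rfl
    rw [hs, if_neg hh, ← hA]
    exact ⟨hb, hc, h13, h7⟩

end Items

/-! ### Correctness of the processing of one arrival -/

section Window

variable {p n q : ℕ} {I : Problem p n q} {σ : Equiv.Perm (Fin n)}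
  {A1 A2 : ℕ → ℕ → ℕ} {cnt : ℕ → ℕ} {m : ℕ} {S : List (Fin n)}
  {h : List (Option (Fin n))} {A : Finset (Fin n)} {t j : ℕ} {s s' : State n}

theorem ends_exec_eq {P : Prog} (hP : P.Simple) (s : State n) :
    Ends I σ P s P.len fun s' => s' = exec I σ P s := ends_exec hP rfl

/-- The next item arrives; register `8` holds its position. -/
def arriveProg : Prog :=
  .seq (.assign 8 (.reg 5)) (.seq .arrive (.assign 5 (.add (.reg 5) (.lit 1))))

/-- Update the best item, and perhaps the shortlist. -/
def decideProg (p D L : ℕ) : Prog :=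
  .seq compareProg <|
  .seq (.ite (.lt (.lit 0) (.reg 14)) (.seq (takeProg p) (.seq (.assign 10 (.reg 5))
    (.seq (.assign 16 (.add (.arr 1 (.reg 8) (.lit 0)) (.lit 1))) (selectProg D L)))) .skip)
  (.assign 7 (.add (.reg 7) (.lit 1)))

/-- Process the next item. -/
def itemProg (p D L : ℕ) : Prog := .seq arriveProg (.seq (evalProg p) (decideProg p D L))

variable (I σ) in
/-- The state after `r` items of a window. -/
structure InWindow (A1 A2 : ℕ → ℕ → ℕ) (cnt : ℕ → ℕ) (m : ℕ) (S : List (Fin n))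
    (h : List (Option (Fin n))) (A : Finset (Fin n)) (b j D L : ℕ) (v : Fin n → ℕ)
    (it : ℕ → Fin n) (r : ℕ) (s : State n) : Prop where
  base : Base I σ A1 A2 cnt m S h (A ∪ (scan I D L (cnt j) v S it r).2.toFinset) (b + r) j s
  cand : Cand I σ A1 S (scan I D L (cnt j) v S it r).1 s
  selected : s.reg 13 = (scan I D L (cnt j) v S it r).2.length
  items : s.reg 7 = r

theorem exec_arriveProg (hb : Base I σ A1 A2 cnt m S h A t j s) (ht : t < n) :
    Base I σ A1 A2 cnt m S h A (t + 1) j (exec I σ arriveProg s) ∧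
      (exec I σ arriveProg s).reg 8 = t ∧
      (∀ x, x ≠ 5 → x ≠ 8 → (exec I σ arriveProg s).reg x = s.reg x) ∧
      (exec I σ arriveProg s).arr = s.arr ∧ (exec I σ arriveProg s).val = s.val := by
  refine ⟨⟨?_, ?_, ?_, ?_, ?_, ?_, ?_, ?_, ?_, ?_, ?_, ?_, ?_, ?_, ?_⟩, ?_, ?_, rfl, rfl⟩
  · simpa [exec, arriveProg] using hb.size
  · simpa [exec, arriveProg] using hb.windows
  · simpa [exec, arriveProg] using hb.window
  · simpa [exec, arriveProg, Expr.eval] using hb.next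
  · simp only [exec, arriveProg, hb.arrived]
    omega
  · exact hb.prio
  · exact hb.again
  · exact hb.count
  · exact hb.hist
  · exact hb.lists
  · exact hb.inS
  · exact hb.inA
  · exact hb.shortlist
  · exact hb.out
  · exact hb.set
  · simpa [exec, arriveProg, Expr.eval] using hb.next
  · intro x h5 h8
    simp [exec, arriveProg, h5, h8]

theorem decideProg_simple (p D L : ℕ) : (decideProg p D L).Simple := by
  refine ⟨compareProg_writes.simple, ⟨⟨(takeProg_writes p).simple, ?_, ?_, selectProg_simple D L⟩,
    ?_⟩, ?_⟩ <;> trivial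

theorem exec_decideProg {v : Fin n → ℕ} (hv : ∀ e, v e = A1 (σ.symm e) 0) {D L b r : ℕ}
    {it : ℕ → Fin n} (hit : (σ.symm (it r) : ℕ) = b + r) (hj : j < m)
    (hb : Base I σ A1 A2 cnt m S h (A ∪ (scan I D L (cnt j) v S it r).2.toFinset) (b + r + 1) j s)
    (hc : Cand I σ A1 S (scan I D L (cnt j) v S it r).1 s)
    (h13 : s.reg 13 = (scan I D L (cnt j) v S it r).2.length) (h7 : s.reg 7 = r)
    (h8 : s.reg 8 = b + r) (hsw : SwapRep I σ 1 9 12 S (it r) (bestSwap I S (it r)) s) :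
    InWindow I σ A1 A2 cnt m S h A b j D L v it (r + 1) (exec I σ (decideProg p D L) s) := by
  classical
  rw [decideProg, exec_seq, exec_seq, exec_ite]
  set s1 := exec I σ compareProg s with hs1
  have ha1 : Agree [14] [] [] s s1 := agree_exec compareProg_writes s
  have h14 : s1.reg 14 = _ := exec_compareProg hv hc hsw.val (by rw [h8, hit]) hb.prio
  have hb1 := hb.agree ha1 (by simp) (by simp)
  have hc1 := hc.agree ha1 (by simp) (by simp) (by simp)
  have hcond : (Cond.lt (.lit 0) (.reg 14)).holds I σ s1 ↔
      ∀ b, (scan I D L (cnt j) v S it r).1 = some b → Worse I v S b (it r) := by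
    simp only [Cond.holds, Expr.eval, h14]
    split_ifs with hh
    · exact iff_of_true Nat.zero_lt_one hh
    · exact iff_of_false (lt_irrefl 0) hh
  -- the last instruction
  have hlast : ∀ s2 : State n,
      Base I σ A1 A2 cnt m S h (A ∪ (scan I D L (cnt j) v S it (r + 1)).2.toFinset)
        (b + (r + 1)) j s2 →
      Cand I σ A1 S (scan I D L (cnt j) v S it (r + 1)).1 s2 →
      s2.reg 13 = (scan I D L (cnt j) v S it (r + 1)).2.length → s2.reg 7 = r →
      InWindow I σ A1 A2 cnt m S h A b j D L v it (r + 1)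
        (exec I σ (.assign 7 (.add (.reg 7) (.lit 1))) s2) := by
    intro s2 h1 h2 h3 h4
    have ha := agree_exec (I := I) (σ := σ) (P := .assign 7 (.add (.reg 7) (.lit 1)))
      (rs := [7]) (as := []) (vs := []) (by simp [Prog.Writes]) s2
    refine ⟨h1.agree ha (by simp) (by simp), h2.agree ha (by simp) (by simp) (by simp), ?_, ?_⟩
    · rw [ha.reg 13 (by simp), h3]
    · simp [exec, Expr.eval, h4]
  by_cases hbetter : ∀ b, (scan I D L (cnt j) v S it r).1 = some b → Worse I v S b (it r)
  · rw [if_pos (hcond.2 hbetter), exec_seq, exec_seq, exec_seq]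
    set s2 := exec I σ (takeProg p) s1 with hs2
    have ha2 : Agree [11, 12] [13] [0] s1 s2 := agree_exec (takeProg_writes p) s1
    obtain ⟨hsw2, h12⟩ := exec_takeProg (hsw.agree ha1 (by simp) (by simp) (by simp))
    rw [← hs2] at hsw2 h12
    set s3 := exec I σ (.assign 16 (.add (.arr 1 (.reg 8) (.lit 0)) (.lit 1)))
      (exec I σ (.assign 10 (.reg 5)) s2) with hs3
    have ha3 : Agree [10, 16] [] [] s2 s3 :=
      agree_exec (P := .seq (.assign 10 (.reg 5))
        (.assign 16 (.add (.arr 1 (.reg 8) (.lit 0)) (.lit 1))))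
        ⟨by simp [Prog.Writes], by simp [Prog.Writes]⟩ s2
    have hb2 := hb1.agree ha2 (by simp) (by simp)
    have hb3 := hb2.agree ha3 (by simp) (by simp)
    have h8' : s2.reg 8 = b + r := by
      rw [ha2.reg 8 (by simp), ha1.reg 8 (by simp), h8]
    have hc3 : Cand I σ A1 S (some (it r)) s3 := by
      refine ⟨?_, ?_, ?_, by simp, fun e he => ?_⟩
      · rw [ha3.val 0 (by simp), hsw2.val]
        rfl
      · simp [hs3, exec, Expr.eval, hb2.next, pcode, hit]
      · simp [hs3, exec, Expr.eval, hb2.prio, h8', hit]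
      · obtain rfl := Option.some.inj he
        refine ⟨?_, hsw2.agree ha3 (by simp) (by simp) (by simp)⟩
        rw [ha3.reg 12 (by simp), h12, ha1.reg 8 (by simp), h8, hit]
    have hr : ∀ x ∈ [7, 8, 13], s3.reg x = s.reg x := by
      intro x hx
      have : x ∉ [14] ∧ x ∉ [11, 12] ∧ x ∉ [10, 16] := by
        fin_cases hx <;> simp
      rw [ha3.reg x this.2.2, ha2.reg x this.2.1, ha1.reg x this.1]
    obtain ⟨k1, k2, k3, k4⟩ := exec_selectProg (D := D) (L := L) (e := it r) hb3 hj rfl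
      ((hr 7 (by simp)).trans h7) (by rw [hr 8 (by simp), h8, hit]) hit
      ((hr 13 (by simp)).trans h13) rfl hc3
    have hscan : scan I D L (cnt j) v S it (r + 1) = (some (it r),
        if cnt j < D * (r + 1) ∧ (scan I D L (cnt j) v S it r).2.length < L then
          it r :: (scan I D L (cnt j) v S it r).2 else (scan I D L (cnt j) v S it r).2) := by
      rw [scan]
      exact if_pos hbetter
    refine hlast _ ?_ ?_ ?_ k4
    · rw [hscan]; exact k1
    · rw [hscan]; exact k2
    · rw [hscan]; exact k3
  · rw [if_neg fun hh => hbetter (hcond.1 hh)]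
    have hscan : scan I D L (cnt j) v S it (r + 1) = scan I D L (cnt j) v S it r := by
      rw [scan]
      exact if_neg hbetter
    refine hlast _ ?_ ?_ ?_ ?_
    · rw [hscan]; exact hb1
    · rw [hscan]; exact hc1
    · rw [hscan]
      exact (ha1.reg 13 (by simp)).trans h13
    · exact (ha1.reg 7 (by simp)).trans h7

/-- A bound on the running time of `itemProg`. -/
def itemCost (p κ : ℕ) : ℕ := searchCost p κ p + (takeProg p).len + 40

theorem ends_itemProg {v : Fin n → ℕ} (hv : ∀ e, v e = A1 (σ.symm e) 0) {D L b r : ℕ}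
    {it : ℕ → Fin n} (hit : (σ.symm (it r) : ℕ) = b + r) (hj : j < m) (hnd : S.Nodup)
    (hS : I.Feasible S.toFinset) (hpos : ∀ x ∈ S, (σ.symm x : ℕ) < b)
    (hs : InWindow I σ A1 A2 cnt m S h A b j D L v it r s) :
    Ends I σ (itemProg p D L) s (itemCost p I.kappa)
      (InWindow I σ A1 A2 cnt m S h A b j D L v it (r + 1)) := by
  have hlt : b + r < n := hit ▸ (σ.symm (it r)).2
  obtain ⟨k1, k2, k3, k4, k5⟩ := exec_arriveProg hs.base hlt
  refine Ends.mono (B := arriveProg.len + (searchCost p I.kappa p + 4 + (decideProg p D L).len + 1)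
    + 1) ?_ ?_ fun s' h => h
  · have hsimple : arriveProg.Simple := by refine ⟨?_, ?_, ?_⟩ <;> trivial
    refine Ends.seq (ends_exec_eq hsimple s) ?_
    rintro s1 rfl
    set s1 := exec I σ arriveProg s with hs1
    have hrep : SearchRep σ S (it r) s1 := by
      refine ⟨k1.set, k2.trans hit.symm, fun hh => ?_, ?_, fun x hx => ?_⟩
      · have := hpos _ hh
        omega
      · rw [k1.arrived]; omega
      · have := hpos x hx
        rw [k1.arrived]; omega
    refine Ends.seq (ends_evalProg hnd hS k1.size hrep k1.lists) ?_
    rintro s2 ⟨ha, hsw⟩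
    have hc1 : Cand I σ A1 S (scan I D L (cnt j) v S it r).1 s1 := by
      refine ⟨?_, ?_, ?_, ?_, fun e he => ⟨?_, ⟨?_, ?_, fun u hu i hi => ?_⟩⟩⟩
      · rw [k5]; exact hs.cand.val
      · rw [k3 10 (by simp) (by simp)]; exact hs.cand.item
      · rw [k3 16 (by simp) (by simp)]; exact hs.cand.prio
      · rw [k3 11 (by simp) (by simp)]; exact hs.cand.flag
      · rw [k3 12 (by simp) (by simp)]; exact (hs.cand.swap e he).1
      · rw [k5]; exact (hs.cand.swap e he).2.val
      · rw [k3 11 (by simp) (by simp)]; exact (hs.cand.swap e he).2.flag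
      · rw [k4]; exact (hs.cand.swap e he).2.tuple u hu i hi
    refine ends_exec (decideProg_simple p D L) ?_
    refine exec_decideProg hv hit hj (k1.agree ha (by simp) (by simp))
      (hc1.agree ha (by simp) (by simp) (by simp)) ?_ ?_ ?_ hsw
    · rw [ha.reg 13 (by simp), k3 13 (by simp) (by simp)]; exact hs.selected
    · rw [ha.reg 7 (by simp), k3 7 (by simp) (by simp)]; exact hs.items
    · rw [ha.reg 8 (by simp), k2]
  · simp only [itemCost, arriveProg, decideProg, compareProg, selectProg, Prog.len]
    omega

end Window

/-! ### Updating the lists of the solution -/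

section Update

variable {p n q : ℕ} {I : Problem p n q} {σ : Equiv.Perm (Fin n)} {s s' : State n}

/-- Remove the item in register `8` from the `i`-th list of that item. -/
def filterProg (i : ℕ) : Prog :=
  .seq (.assign 17 (.lit 0)) <| .seq (.assign 18 (.lit 0)) <|
  .seq (.loop (.lt (.reg 17) (.arr 5 (.mat (.reg 8) (.lit i)) (.lit 0)))
    (.seq (.ite (.lt (.lit 0) (.add
        (.sub (.arr 6 (.mat (.reg 8) (.lit i)) (.reg 17)) (.reg 8))
        (.sub (.reg 8) (.arr 6 (.mat (.reg 8) (.lit i)) (.reg 17)))))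
      (.seq (.store 6 (.mat (.reg 8) (.lit i)) (.reg 18)
        (.arr 6 (.mat (.reg 8) (.lit i)) (.reg 17))) (.assign 18 (.add (.reg 18) (.lit 1)))) .skip)
    (.assign 17 (.add (.reg 17) (.lit 1)))))
  (.store 5 (.mat (.reg 8) (.lit i)) (.lit 0) (.reg 18))

/-- The list is compacted in place. The write index in register `18` never exceeds the read index in
register `17`, so the entries still to be read are unchanged. -/
theorem ends_filterProg {F : ℕ → List (Fin n)} {e : Fin n} {i l κ : ℕ}
    (hl : (mats I e)[i]? = some l) (h8 : s.reg 8 = σ.symm e)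
    (he : (σ.symm e : ℕ) < s.arrived) (hF : ListRep σ F s) (hκ : (F l).length ≤ κ) :
    Ends I σ (filterProg i) s (10 * κ + 10) fun s' =>
      Agree [17, 18] [5, 6] [] s s' ∧
      ListRep σ (Function.update F l ((F l).filter fun x => x ≠ e)) s' := by
  have hmat : ∀ s' : State n, Agree [17, 18] [5, 6] [] s s' →
      (Expr.mat (.reg 8) (.lit i)).eval I σ s' = l := by
    intro s' ha
    simp only [Expr.eval]
    rw [ha.reg 8 (by simp), h8, itemAt_congr ha.arrived, itemAt_symm he]
    change (mats I e).getD i 0 = l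
    rw [List.getD_eq_getElem?_getD, hl, Option.getD_some]
  let G : ℕ → List (Fin n) := fun c => ((F l).take c).filter fun x => x ≠ e
  have hGlen : ∀ c, c ≤ (F l).length → (G c).length ≤ c := by
    intro c hc
    refine (List.length_filter_le _ _).trans ?_
    rw [List.length_take]
    exact min_le_left _ _
  let J : ℕ → State n → Prop := fun c s' =>
    Agree [17, 18] [5, 6] [] s s' ∧ s'.reg 17 = c ∧ s'.reg 18 = (G c).length ∧
    s'.arr 5 = s.arr 5 ∧ (∀ l', l' ≠ l → s'.arr 6 l' = s.arr 6 l') ∧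
    (∀ k x, (G c)[k]? = some x → s'.arr 6 l k = σ.symm x) ∧
    ∀ k, c ≤ k → s'.arr 6 l k = s.arr 6 l k
  have hinit : J 0 (exec I σ (.assign 18 (.lit 0)) (exec I σ (.assign 17 (.lit 0)) s)) := by
    refine ⟨agree_exec (P := .seq (.assign 17 (.lit 0)) (.assign 18 (.lit 0)))
      ⟨by simp [Prog.Writes], by simp [Prog.Writes]⟩ s, ?_, ?_, rfl, fun _ _ => rfl, ?_,
      fun _ _ => rfl⟩
    · simp [exec, Expr.eval]
    · simp [exec, Expr.eval, G]
    · simp [G]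
  refine Ends.seq_le (b := 10 * κ + 8) (ends_exec_eq (by trivial) s) ?_
    (by simp only [Prog.len]; omega)
  rintro s1 rfl
  refine Ends.seq_le (b := 10 * κ + 6) (ends_exec_eq (by trivial) _) ?_
    (by simp only [Prog.len]; omega)
  rintro s1 rfl
  refine Ends.seq_le (b := 1) (ends_loop (F l).length (fun _ => 7) J ?_ ?_ _ hinit) ?_
    (by rw [Finset.sum_const, Finset.card_range, smul_eq_mul]; omega)
  · rintro c hc s1 ⟨ha, h17, h18, h5, h6, h6l, h6r⟩
    have hme := hmat s1 ha
    have hm := hme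
    simp only [Expr.eval] at hm
    have hx : (F l)[c]? = some (F l)[c] := List.getElem?_eq_getElem hc
    set x := (F l)[c] with hxdef
    have h6x : s1.arr 6 l c = σ.symm x := by
      rw [h6r c le_rfl]
      exact (hF l).2 c x hx
    have h8' : s1.reg 8 = σ.symm e := by rw [ha.reg 8 (by simp), h8]
    have hG : G (c + 1) = if x ≠ e then G c ++ [x] else G c := by
      simp only [G, List.take_add_one, hx, Option.toList_some, List.filter_append]
      by_cases hxe : x = e <;> simp [hxe]
    constructor
    · simp only [Cond.holds, Expr.eval]
      rw [hm, h17, h5, (hF l).1]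
      exact hc
    · have hsimple : (Prog.seq (.ite (.lt (.lit 0) (.add
          (.sub (.arr 6 (.mat (.reg 8) (.lit i)) (.reg 17)) (.reg 8))
          (.sub (.reg 8) (.arr 6 (.mat (.reg 8) (.lit i)) (.reg 17)))))
        (.seq (.store 6 (.mat (.reg 8) (.lit i)) (.reg 18)
          (.arr 6 (.mat (.reg 8) (.lit i)) (.reg 17))) (.assign 18 (.add (.reg 18) (.lit 1))))
          .skip) (.assign 17 (.add (.reg 17) (.lit 1)))).Writes [17, 18] [5, 6] [] := by
        simp [Prog.Writes]
      refine (ends_exec hsimple.simple (Q := J (c + 1)) ?_).mono (by simp [Prog.len]) fun s' h => h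
      have hag := ha.trans (agree_exec (I := I) (σ := σ) hsimple s1)
      -- With truncated subtraction, two numbers differ exactly when the sum of their differences in
      -- both directions is positive.
      have hcond : (Cond.lt (.lit 0) (.add
          (.sub (.arr 6 (.mat (.reg 8) (.lit i)) (.reg 17)) (.reg 8))
          (.sub (.reg 8) (.arr 6 (.mat (.reg 8) (.lit i)) (.reg 17))))).holds I σ s1 ↔ x ≠ e := by
        simp only [Cond.holds, Expr.eval]
        rw [hm, h17, h6x, h8']
        have : x = e ↔ (σ.symm x : ℕ) = σ.symm e := by
          rw [← Fin.ext_iff, σ.symm.injective.eq_iff]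
        rw [Ne, this]
        omega
      rw [exec_seq, exec_ite] at hag ⊢
      by_cases hxe : x ≠ e
      · rw [if_pos (hcond.2 hxe)] at hag ⊢
        rw [if_pos hxe] at hG
        have h18' : (Expr.reg 18).eval I σ s1 = (G c).length := h18
        have hsrc : (Expr.arr 6 (.mat (.reg 8) (.lit i)) (.reg 17)).eval I σ s1 = σ.symm x := by
          simp only [Expr.eval]
          rw [hm, h17, h6x]
        rw [exec_seq, exec_store hme h18' hsrc] at hag ⊢
        refine ⟨hag, ?_, ?_, ?_, ?_, ?_, ?_⟩
        · simp [exec, Expr.eval, h17]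
        · simp [exec, Expr.eval, h18, hG]
        · simpa [exec] using h5
        · intro l' hl'
          funext k
          simp [exec, hl', h6 l' hl']
        · intro k y hky
          rw [hG] at hky
          simp only [exec]
          rcases lt_trichotomy k (G c).length with hlt | heq | hgt
          · rw [List.getElem?_append_left hlt] at hky
            simpa [hlt.ne] using h6l k y hky
          · subst heq
            simp at hky
            simp [hky]
          · rw [List.getElem?_eq_none (by simp; omega)] at hky
            simp at hky
        · intro k hk
          have := hGlen c hc.le
          simpa [exec, show k ≠ (G c).length by omega] using h6r k (by omega)
      · rw [if_neg fun hh => hxe (hcond.1 hh)] at hag ⊢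
        rw [if_neg hxe] at hG
        refine ⟨hag, ?_, ?_, ?_, ?_, ?_, ?_⟩
        · simp [exec, Expr.eval, h17]
        · simp [exec, h18, hG]
        · simpa [exec] using h5
        · exact h6
        · rw [hG]
          exact h6l
        · exact fun k hk => h6r k (by omega)
  · rintro s1 ⟨ha, h17, -, h5, -⟩
    have hm := hmat s1 ha
    simp only [Cond.holds]
    simp only [Expr.eval] at hm ⊢
    rw [hm, h17, h5, (hF l).1]
    exact lt_irrefl _
  · rintro s1 ⟨ha, h17, h18, h5, h6, h6l, -⟩
    have hm := hmat s1 ha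
    have hGall : G (F l).length = (F l).filter fun x => x ≠ e := by
      simp only [G, List.take_length]
    have hw : (Prog.store 5 (.mat (.reg 8) (.lit i)) (.lit 0) (.reg 18)).Writes [17, 18] [5, 6]
      [] := by simp [Prog.Writes]
    refine ends_exec (by trivial) ⟨ha.trans (agree_exec hw s1), ?_⟩
    have h18' : (Expr.reg 18).eval I σ s1 = (G (F l).length).length := h18
    have h0 : (Expr.lit 0).eval I σ s1 = 0 := rfl
    rw [exec_store hm h0 h18', ← hGall]
    intro l'
    by_cases hl' : l' = l
    · subst hl'
      rw [Function.update_self]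
      exact ⟨by simp, fun k x hx => by simpa using h6l k x hx⟩
    · rw [Function.update_of_ne hl']
      refine ⟨?_, fun k x hx => ?_⟩
      · simpa [hl', h5] using (hF l').1
      · simpa [h6 l' hl'] using (hF l').2 k x hx

theorem ends_each {F : ℕ → Prog} (B : ℕ) (J : ℕ → State n → Prop) (k : ℕ)
    (hF : ∀ i < k, ∀ s, J i s → Ends I σ (F i) s B (J (i + 1))) (s : State n) (h0 : J 0 s) :
    Ends I σ (each k F) s (k * (B + 1) + 1) (J k) := by
  induction k with
  | zero =>
    exact (ends_of_step (P := .skip) (s' := s) h0 fun K => rfl).mono (by omega) fun _ h => h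
  | succ k ih =>
    refine Ends.mono (B := k * (B + 1) + 1 + B + 1) (Ends.seq (ih fun i hi => hF i (by omega))
      fun s' hs' => hF k (Nat.lt_succ_self k) s' hs') ?_ fun s' h => h
    rw [Nat.succ_mul]
    omega

variable (I) in
/-- The data structures for the current solution. -/
structure SolRep (σ : Equiv.Perm (Fin n)) (S : List (Fin n)) (s : State n) : Prop where
  lists : ListRep σ (listIn I S) s
  inS : ∀ e, s.arr 7 (σ.symm e) 0 = if e ∈ S then 1 else 0
  set : s.set 1 = S.toFinset

/-- Remove the item in register `8`. -/
def removeProg (p : ℕ) : Prog :=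
  .seq (each p fun i => .ite (.lt (.lit i) (.deg (.reg 8))) (filterProg i) .skip) <|
  .seq (.store 7 (.reg 8) (.lit 0) (.lit 0)) (.erase 1 (.reg 8))

/-- The machine state, except for the solution and some temporary registers, is not changed. -/
structure Keeps (rs : List ℕ) (s s' : State n) : Prop where
  arrived : s'.arrived = s.arrived
  shortlist : s'.shortlist = s.shortlist
  set : ∀ i, i ≠ 1 → s'.set i = s.set i
  reg : ∀ x, x ∉ rs → s'.reg x = s.reg x
  arr : ∀ a, a ∉ [5, 6, 7] → s'.arr a = s.arr a

theorem Keeps.trans {rs : List ℕ} {s s' s'' : State n} (h : Keeps rs s s')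
    (h' : Keeps rs s' s'') : Keeps rs s s'' :=
  ⟨h'.arrived.trans h.arrived, h'.shortlist.trans h.shortlist,
    fun x hx => (h'.set x hx).trans (h.set x hx),
    fun x hx => (h'.reg x hx).trans (h.reg x hx), fun x hx => (h'.arr x hx).trans (h.arr x hx)⟩

theorem Agree.keeps {rs as vs : List ℕ} (h : Agree rs as vs s s') (ha : as ⊆ [5, 6, 7]) :
    Keeps rs s s' :=
  ⟨h.arrived, h.shortlist, fun _ _ => by rw [h.set], h.reg, fun a ha' => h.arr a fun hh =>
    ha' (ha hh)⟩

theorem ends_removeProg {S : List (Fin n)} {e : Fin n} (hnd : S.Nodup)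
    (hS : I.Feasible S.toFinset) (h8 : s.reg 8 = σ.symm e) (he : (σ.symm e : ℕ) < s.arrived)
    (hrep : SolRep I σ S s) :
    Ends I σ (removeProg p) s (p * (10 * I.kappa + 12) + 5) fun s' =>
      Keeps [17, 18] s s' ∧ SolRep I σ (S.filter fun x => x ≠ e) s' := by
  -- The lists after the first `i` matroids of `e` have been treated.
  let G : ℕ → ℕ → List (Fin n) := fun i l =>
    if l ∈ (mats I e).take i then (listIn I S l).filter fun x => x ≠ e else listIn I S l
  let J : ℕ → State n → Prop := fun i s' => Agree [17, 18] [5, 6] [] s s' ∧ ListRep σ (G i) s'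
  have hG0 : G 0 = listIn I S := by
    funext l; simp [G]
  have hstep : ∀ i < p, ∀ s1, J i s1 → Ends I σ (.ite (.lt (.lit i) (.deg (.reg 8)))
      (filterProg i) .skip) s1 (10 * I.kappa + 11) (J (i + 1)) := by
    rintro i hi s1 ⟨ha, hl⟩
    have h8' : s1.reg 8 = σ.symm e := by rw [ha.reg 8 (by simp), h8]
    have he' : (σ.symm e : ℕ) < s1.arrived := by rw [ha.arrived]; exact he
    have hcond : (Cond.lt (.lit i) (.deg (.reg 8))).holds I σ s1 ↔ i < (mats I e).length := by
      simp only [Cond.holds, Expr.eval]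
      rw [h8', itemAt_symm he']
      rfl
    by_cases hlt : i < (mats I e).length
    · obtain ⟨y, hget⟩ : ∃ y, (mats I e)[i]? = some y := ⟨_, List.getElem?_eq_getElem hlt⟩
      refine Ends.ite_true (hcond.2 hlt) ((ends_filterProg hget h8' he' hl
        (κ := I.kappa) ?_).mono le_rfl ?_)
      · refine le_trans ?_ (listIn_length_le hnd hS y)
        simp only [G]
        split_ifs
        · exact List.length_filter_le _ _
        · exact le_rfl
      · rintro s2 ⟨ha2, hl2⟩
        refine ⟨ha.trans ha2, ?_⟩
        have : G (i + 1) = Function.update (G i) y ((G i y).filter fun x => x ≠ e) := by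
          funext l
          by_cases hle : l = y
          · subst hle
            have hmem : l ∈ (mats I e).take (i + 1) := by
              simp [List.take_add_one, hget]
            simp only [G, if_pos hmem, Function.update_self]
            split_ifs
            · rw [List.filter_filter]
              simp
            · rfl
          · rw [Function.update_of_ne hle]
            simp [G, List.take_add_one, hget, hle]
        rw [this]
        exact hl2
    · refine (Ends.ite_false (fun hh => hlt (hcond.1 hh))
        (ends_of_step (Q := J (i + 1)) (s' := s1) ⟨ha, ?_⟩ fun K => rfl)).mono (by omega)
        fun s' h => h
      have : G (i + 1) = G i := by
        funext l
        simp only [G]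
        rw [List.take_of_length_le (by omega), List.take_of_length_le (by omega)]
      rw [this]
      exact hl
  refine Ends.seq_le (b := 3) (ends_each _ J p hstep s ⟨Agree.refl _ _ _ s, hG0 ▸ hrep.lists⟩) ?_
    (le_of_eq (by ring))
  rintro s1 ⟨ha, hl⟩
  have h8' : s1.reg 8 = σ.symm e := by rw [ha.reg 8 (by simp), h8]
  have he' : (σ.symm e : ℕ) < s1.arrived := by rw [ha.arrived]; exact he
  refine Ends.seq_le (b := 1) (ends_exec_eq (by trivial) s1) ?_ (by simp [Prog.len])
  rintro s2 rfl
  have h8'' : (Expr.reg 8).eval I σ s1 = σ.symm e := h8'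
  rw [exec_store (x := (σ.symm e : ℕ)) (y := 0) (z := 0) h8'' rfl rfl]
  refine ends_exec (by trivial) ?_
  have hk := ha.keeps (by simp)
  have hGp : G p = listIn I (S.filter fun x => x ≠ e) := by
    funext l
    simp only [G]
    rw [List.take_of_length_le (length_mats_le e)]
    simp only [listIn, List.filter_filter]
    split_ifs with hm
    · exact List.filter_congr fun x _ => Bool.and_comm _ _
    · refine List.filter_congr fun x _ => ?_
      by_cases hx : x = e
      · subst hx; simp [hm]
      · simp [hx]
  refine ⟨⟨hk.arrived, hk.shortlist, fun i hi => ?_, hk.reg, fun a ha' => ?_⟩, ⟨?_, fun x => ?_, ?_⟩⟩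
  · simpa [exec, hi] using hk.set i hi
  · rw [← hk.arr a ha']
    have : a ≠ 7 := by rintro rfl; simp at ha'
    funext i j
    simp [exec, this]
  · rw [← hGp]
    simpa [ListRep, exec] using hl
  · have h1 := hrep.inS x
    have h2 := ha.arr 7 (by simp)
    by_cases hx : x = e
    · subst hx; simp [exec]
    · have hne : (σ.symm x : ℕ) ≠ σ.symm e := fun hh => hx (σ.symm.injective (Fin.ext hh))
      simp [exec, hne, h2, h1, hx]
  · have hi : ∀ f T, itemAt σ { s1 with arr := f, set := T } (σ.symm e) = {e} :=
      fun f T => itemAt_symm he'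
    simp only [exec, Expr.eval, h8', hi, Function.update_self, ha.set, hrep.set]
    ext x
    simp

/-- Add the item in register `8`. -/
def addProg (p : ℕ) : Prog :=
  .seq (each p fun i => .ite (.lt (.lit i) (.deg (.reg 8)))
    (.seq (.store 6 (.mat (.reg 8) (.lit i)) (.arr 5 (.mat (.reg 8) (.lit i)) (.lit 0)) (.reg 8))
      (.store 5 (.mat (.reg 8) (.lit i)) (.lit 0)
        (.add (.arr 5 (.mat (.reg 8) (.lit i)) (.lit 0)) (.lit 1)))) .skip) <|
  .seq (.store 7 (.reg 8) (.lit 0) (.lit 1)) (.insert 1 (.reg 8))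

theorem ends_addProg {S : List (Fin n)} {e : Fin n} (h8 : s.reg 8 = σ.symm e)
    (he : (σ.symm e : ℕ) < s.arrived) (hrep : SolRep I σ S s) :
    Ends I σ (addProg p) s (p * 5 + 5) fun s' =>
      Keeps [17, 18] s s' ∧ SolRep I σ (S ++ [e]) s' := by
  let G : ℕ → ℕ → List (Fin n) := fun i l =>
    if l ∈ (mats I e).take i then listIn I S l ++ [e] else listIn I S l
  let J : ℕ → State n → Prop := fun i s' => Agree [17, 18] [5, 6] [] s s' ∧ ListRep σ (G i) s'
  have hG0 : G 0 = listIn I S := by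
    funext l; simp [G]
  have hstep : ∀ i < p, ∀ s1, J i s1 → Ends I σ (.ite (.lt (.lit i) (.deg (.reg 8)))
    (.seq (.store 6 (.mat (.reg 8) (.lit i)) (.arr 5 (.mat (.reg 8) (.lit i)) (.lit 0)) (.reg 8))
      (.store 5 (.mat (.reg 8) (.lit i)) (.lit 0)
        (.add (.arr 5 (.mat (.reg 8) (.lit i)) (.lit 0)) (.lit 1)))) .skip) s1 4 (J (i + 1)) := by
    rintro i hi s1 ⟨ha, hl⟩
    have h8' : s1.reg 8 = σ.symm e := by rw [ha.reg 8 (by simp), h8]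
    have he' : (σ.symm e : ℕ) < s1.arrived := by rw [ha.arrived]; exact he
    have hcond : (Cond.lt (.lit i) (.deg (.reg 8))).holds I σ s1 ↔ i < (mats I e).length := by
      simp only [Cond.holds, Expr.eval]
      rw [h8', itemAt_symm he']
      rfl
    by_cases hlt : i < (mats I e).length
    · have hget : (mats I e)[i]? = some (mats I e)[i] := List.getElem?_eq_getElem hlt
      set l := (mats I e)[i] with hldef
      have hm : ∀ s2 : State n, s2.reg 8 = s1.reg 8 → s2.arrived = s1.arrived →
          (Expr.mat (.reg 8) (.lit i)).eval I σ s2 = l := by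
        intro s2 h1 h2
        simp only [Expr.eval]
        rw [h1, h8', itemAt_congr h2, itemAt_symm he']
        change (mats I e).getD i 0 = l
        rw [List.getD_eq_getElem?_getD, hget, Option.getD_some]
      -- The matroids of an item are listed without repetition, so this list has not been extended
      -- yet.
      have hGl : G i l = listIn I S l := by
        have : l ∉ (mats I e).take i := by
          intro hmem
          obtain ⟨k, hk, hkl⟩ := List.mem_take_iff_getElem.1 hmem
          have := (matroidsOf_nodup (I := I) {e}).getElem_inj_iff (i := k) (j := i)
            (hi := by change k < (mats I e).length; omega) (hj := hlt)
          have hki : k = i := this.1 hkl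
          omega
        simp [G, this]
      have hlen1 : s1.arr 5 l 0 = (listIn I S l).length := by rw [(hl l).1, hGl]
      have hw : (Prog.seq (.store 6 (.mat (.reg 8) (.lit i))
          (.arr 5 (.mat (.reg 8) (.lit i)) (.lit 0)) (.reg 8))
        (.store 5 (.mat (.reg 8) (.lit i)) (.lit 0)
          (.add (.arr 5 (.mat (.reg 8) (.lit i)) (.lit 0)) (.lit 1)))).Writes [17, 18] [5, 6] [] := by
        simp [Prog.Writes]
      refine Ends.ite_true (a := 3) (hcond.2 hlt) (ends_exec (Q := J (i + 1)) hw.simple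
        ⟨ha.trans (agree_exec hw s1), ?_⟩)
      have hlen2 : ∀ s2 : State n, s2.reg 8 = s1.reg 8 → s2.arrived = s1.arrived →
          s2.arr 5 = s1.arr 5 → (Expr.arr 5 (.mat (.reg 8) (.lit i)) (.lit 0)).eval I σ s2 =
          (listIn I S l).length := by
        intro s2 h1 h2 h3
        have := hm s2 h1 h2
        simp only [Expr.eval] at this ⊢
        rw [this, h3, hlen1]
      have h8'' : (Expr.reg 8).eval I σ s1 = σ.symm e := h8'
      rw [exec_seq, exec_store (hm s1 rfl rfl) (hlen2 s1 rfl rfl rfl) h8'']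
      obtain ⟨s2, hs2⟩ : ∃ s2 : State n, s2 = { s1 with
          arr := fun a' i' j' => if a' = 6 ∧ i' = l ∧ j' = (listIn I S l).length then
            (σ.symm e : ℕ) else s1.arr a' i' j' } := ⟨_, rfl⟩
      have hreg : s2.reg 8 = s1.reg 8 := by rw [hs2]
      have harr : s2.arrived = s1.arrived := by rw [hs2]
      have h0 : (Expr.lit 0).eval I σ s2 = 0 := rfl
      have hz : (Expr.add (.arr 5 (.mat (.reg 8) (.lit i)) (.lit 0)) (.lit 1)).eval I σ s2 =
          (listIn I S l).length + 1 := by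
        rw [Expr.eval, hlen2 s2 hreg harr (by rw [hs2]; funext i j; simp)]
        rfl
      rw [← hs2, exec_store (hm s2 hreg harr) h0 hz, hs2]
      intro l'
      by_cases hll : l' = l
      · rw [hll]
        have : G (i + 1) l = listIn I S l ++ [e] := by
          simp [G, List.take_add_one, hget]
        rw [this]
        refine ⟨by simp, fun k x hx => ?_⟩
        rcases lt_trichotomy k (listIn I S l).length with hlt | heq | hgt
        · rw [List.getElem?_append_left hlt, ← hGl] at hx
          simpa [hlt.ne] using (hl l).2 k x hx
        · subst heq
          simp at hx
          simp [hx]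
        · rw [List.getElem?_eq_none (by simp; omega)] at hx
          simp at hx
      · have : G (i + 1) l' = G i l' := by
          simp [G, List.take_add_one, hget, hll]
        rw [this]
        refine ⟨?_, fun k x hx => ?_⟩
        · simpa [hll] using (hl l').1
        · simpa [hll] using (hl l').2 k x hx
    · refine (Ends.ite_false (fun hh => hlt (hcond.1 hh))
        (ends_of_step (Q := J (i + 1)) (s' := s1) ⟨ha, ?_⟩ fun K => rfl)).mono (by omega)
        fun s' h => h
      have : G (i + 1) = G i := by
        funext l
        simp only [G]
        rw [List.take_of_length_le (by omega), List.take_of_length_le (by omega)]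
      rw [this]
      exact hl
  refine Ends.seq_le (b := 3) (ends_each _ J p hstep s ⟨Agree.refl _ _ _ s, hG0 ▸ hrep.lists⟩) ?_
    (le_of_eq (by ring))
  rintro s1 ⟨ha, hl⟩
  have h8' : s1.reg 8 = σ.symm e := by rw [ha.reg 8 (by simp), h8]
  have he' : (σ.symm e : ℕ) < s1.arrived := by rw [ha.arrived]; exact he
  refine Ends.seq_le (b := 1) (ends_exec_eq (by trivial) s1) ?_ (by simp [Prog.len])
  rintro s2 rfl
  have h8'' : (Expr.reg 8).eval I σ s1 = σ.symm e := h8'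
  rw [exec_store (x := (σ.symm e : ℕ)) (y := 0) (z := 1) h8'' rfl rfl]
  refine ends_exec (by trivial) ?_
  have hk := ha.keeps (by simp)
  have hGp : G p = listIn I (S ++ [e]) := by
    funext l
    simp only [G]
    rw [List.take_of_length_le (length_mats_le e)]
    simp only [listIn, List.filter_append]
    split_ifs with hm <;> simp [hm]
  refine ⟨⟨hk.arrived, hk.shortlist, fun i hi => ?_, hk.reg, fun a ha' => ?_⟩, ⟨?_, fun x => ?_, ?_⟩⟩
  · simpa [exec, hi] using hk.set i hi
  · rw [← hk.arr a ha']
    have : a ≠ 7 := by rintro rfl; simp at ha'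
    funext i j
    simp [exec, this]
  · rw [← hGp]
    simpa [ListRep, exec] using hl
  · have h1 := hrep.inS x
    have h2 := ha.arr 7 (by simp)
    by_cases hx : x = e
    · subst hx; simp [exec]
    · have hne : (σ.symm x : ℕ) ≠ σ.symm e := fun hh => hx (σ.symm.injective (Fin.ext hh))
      simp [exec, hne, h2, h1, hx]
  · have hi : ∀ f T, itemAt σ { s1 with arr := f, set := T } (σ.symm e) = {e} :=
      fun f T => itemAt_symm he'
    simp only [exec, Expr.eval, h8', hi, Function.update_self, ha.set, hrep.set]
    ext x
    simp

end Update

/-! ### Second chance and execution of the swap -/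

section WindowEnd

variable {p n q : ℕ} {I : Problem p n q} {σ : Equiv.Perm (Fin n)}
  {A1 A2 : ℕ → ℕ → ℕ} {cnt : ℕ → ℕ} {m : ℕ} {S : List (Fin n)}
  {h : List (Option (Fin n))} {A : Finset (Fin n)} {t j : ℕ} {s s' : State n}

/-- Give the old item chosen for this window a second chance. -/
def againProg (p : ℕ) : Prog :=
  .ite (.lt (.lit 0) (.arr 4 (.arr 2 (.reg 6) (.lit 0)) (.lit 0)))
    (.seq (.assign 8 (.sub (.arr 4 (.arr 2 (.reg 6) (.lit 0)) (.lit 0)) (.lit 1)))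
      (.ite (.lt (.lit 0) (.arr 7 (.reg 8) (.lit 0))) .skip
        (.seq (evalProg p) (.ite (.vlt 0 1) (takeProg p) .skip)))) .skip

variable (I σ) in
/-- The swap that will be carried out. -/
structure Pending (S : List (Fin n)) (t : ℕ) (y : Option (Fin n)) (s : State n) : Prop where
  flag : y = none → s.reg 11 = 0
  swap : ∀ e, y = some e → s.reg 12 = σ.symm e ∧ SwapRep I σ 0 11 13 S e (bestSwap I S e) s
  pos : ∀ e, y = some e → (σ.symm e : ℕ) < t

theorem Cand.pending {x : Option (Fin n)} (hc : Cand I σ A1 S x s)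
    (hx : ∀ e, x = some e → (σ.symm e : ℕ) < t) : Pending I σ S t x s :=
  ⟨hc.flag, hc.swap, hx⟩

/-- The old item overwrites the pending swap only if it is strictly better. Register `10` still
holds the pick of the window, since the history records the picks and not the swaps that were
carried out. -/
theorem ends_againProg {x : Option (Fin n)} (hb : Base I σ A1 A2 cnt m S h A t j s)
    (hc : Cand I σ A1 S x s) (hnd : S.Nodup) (hS : I.Feasible S.toFinset)
    (hpos : ∀ e ∈ S, (σ.symm e : ℕ) < t) (hh : ∀ e, some e ∈ h → (σ.symm e : ℕ) < t)
    (hx : ∀ e, x = some e → (σ.symm e : ℕ) < t) :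
    Ends I σ (againProg p) s (searchCost p I.kappa p + (takeProg p).len + 20) fun s' =>
      Base I σ A1 A2 cnt m S h A t j s' ∧ s'.reg 10 = pcode σ x ∧
      ∃ y, Pending I σ S t y s' ∧
        nextSol I S x (entry h (A2 j 0)) = y.elim S (swapTo I S) := by
  have hH : s.arr 4 (s.arr 2 (s.reg 6) 0) 0 = pcode σ (entry h (A2 j 0)) := by
    rw [hb.again, hb.window, hb.hist]
  have hcond : (Cond.lt (.lit 0) (.arr 4 (.arr 2 (.reg 6) (.lit 0)) (.lit 0))).holds I σ s ↔
      0 < pcode σ (entry h (A2 j 0)) := by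
    simp only [Cond.holds, Expr.eval, hH]
  cases hr : entry h (A2 j 0) with
  | none =>
    rw [hr] at hcond
    refine (Ends.ite_false (fun hh => absurd (hcond.1 hh) (lt_irrefl 0))
      (ends_of_step (s' := s) (P := .skip) ?_ fun K => rfl)).mono (by omega) fun s' h => h
    refine ⟨hb, hc.item, x, hc.pending hx, ?_⟩
    cases x <;> rfl
  | some e =>
    rw [hr] at hcond hH
    have het : (σ.symm e : ℕ) < t := hh e (exists_entry_iff.2 ⟨_, hr⟩)
    refine Ends.mono (Ends.ite_true (hcond.2 (Nat.succ_pos _)) (Ends.seq_le (b :=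
      searchCost p I.kappa p + (takeProg p).len + 17) (ends_exec_eq (by trivial) s) ?_
      (B := searchCost p I.kappa p + (takeProg p).len + 19)
      (by simp only [Prog.len]; omega))) (by omega) fun s' h => h
    rintro s1 rfl
    set s1 := exec I σ (.assign 8 (.sub (.arr 4 (.arr 2 (.reg 6) (.lit 0)) (.lit 0)) (.lit 1))) s
      with hs1
    have ha1 : Agree [8] [] [] s s1 := agree_exec (by simp [Prog.Writes]) s
    have h8 : s1.reg 8 = σ.symm e := by
      simp [hs1, exec, Expr.eval, hH, pcode]
    have hb1 := hb.agree ha1 (by simp) (by simp)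
    have hc1 := hc.agree ha1 (by simp) (by simp) (by simp)
    have hcond1 : (Cond.lt (.lit 0) (.arr 7 (.reg 8) (.lit 0))).holds I σ s1 ↔ e ∈ S := by
      simp only [Cond.holds, Expr.eval, h8, hb1.inS]
      split_ifs with hm <;> simp [hm]
    by_cases heS : e ∈ S
    · refine (Ends.ite_true (hcond1.2 heS)
        (ends_of_step (s' := s1) (P := .skip) ?_ fun K => rfl)).mono (by omega) fun s' h => h
      refine ⟨hb1, hc1.item, x, hc1.pending hx, ?_⟩
      simp only [nextSol, Option.elim_some, heS, not_true_eq_false, false_and, if_false]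
    · have hrep : SearchRep σ S e s1 :=
        ⟨hb1.set, h8, heS, by rw [hb1.arrived]; exact het,
          fun y hy => by rw [hb1.arrived]; exact hpos y hy⟩
      refine Ends.mono (Ends.ite_false (fun hh => heS (hcond1.1 hh)) (Ends.seq_le
        (b := (takeProg p).len + 2) (ends_evalProg hnd hS hb1.size hrep hb1.lists) ?_
        (B := searchCost p I.kappa p + (takeProg p).len + 15) (by omega)))
        (by omega) fun s' h => h
      rintro s2 ⟨ha2, hsw⟩
      have hb2 := hb1.agree ha2 (by simp) (by simp)
      have hc2 := hc1.agree ha2 (by simp) (by simp) (by simp)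
      have hval : I.f (x.elim S (swapTo I S)).toFinset = s2.val 0 := by
        rw [hc2.val]
        cases x <;> rfl
      have hcond2 : (Cond.vlt 0 1).holds I σ s2 ↔
          I.f (x.elim S (swapTo I S)).toFinset < gain I S e := by
        simp only [Cond.holds, hsw.val, hval]
        rfl
      by_cases hlt : I.f (x.elim S (swapTo I S)).toFinset < gain I S e
      · refine (Ends.ite_true (hcond2.2 hlt) (ends_exec (takeProg_writes p).simple ?_)).mono
          (by omega) fun s' h => h
        have ha3 := agree_exec (I := I) (σ := σ) (takeProg_writes p) s2
        obtain ⟨k1, k2⟩ := exec_takeProg hsw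
        refine ⟨hb2.agree ha3 (by simp) (by simp), ?_, some e, ⟨by simp, fun y hy => ?_,
          fun y hy => ?_⟩, ?_⟩
        · rw [ha3.reg 10 (by simp), hc2.item]
        · obtain rfl := Option.some.inj hy
          refine ⟨?_, k1⟩
          rw [k2, ha2.reg 8 (by simp), h8]
        · obtain rfl := Option.some.inj hy
          exact het
        · simp only [nextSol, Option.elim_some]
          exact if_pos ⟨heS, hlt⟩
      · refine (Ends.ite_false (fun hh => hlt (hcond2.1 hh))
          (ends_of_step (s' := s2) (P := .skip) ?_ fun K => rfl)).mono (by omega) fun s' h => h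
        refine ⟨hb2, hc2.item, x, hc2.pending hx, ?_⟩
        simp only [nextSol, Option.elim_some]
        exact if_neg fun hh => hlt hh.2

/-- The items that leave belong to `S`, so they have arrived and erasing them takes effect. -/
theorem searchSwap_mem {S : List (Fin n)} {e : Fin n} (j : ℕ) (u : ℕ → Option (Fin n))
    (o : Option (ℕ → Option (Fin n))) (hu : ∀ i, j ≤ i → i < p → ∀ x, u i = some x → x ∈ S)
    (ho : ∀ u', o = some u' → ∀ i < p, ∀ x, u' i = some x → x ∈ S) :
    ∀ u', searchSwap I S e j u o = some u' → ∀ i < p, ∀ x, u' i = some x → x ∈ S := by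
  induction j generalizing u o with
  | zero =>
    intro u' hu'
    simp only [searchSwap, trySwap] at hu'
    split_ifs at hu' with hh
    · obtain rfl := Option.some.inj hu'
      exact fun i hi => hu i (Nat.zero_le i) hi
    · exact ho u' hu'
  | succ j ih =>
    rw [searchSwap]
    have key : ∀ (l : List (Option (Fin n))), (∀ y ∈ l, ∀ x, y = some x → x ∈ S) →
        ∀ o : Option (ℕ → Option (Fin n)),
        (∀ u', o = some u' → ∀ i < p, ∀ x, u' i = some x → x ∈ S) →
        ∀ u', l.foldl (fun o x => searchSwap I S e j (Function.update u j x) o) o = some u' →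
        ∀ i < p, ∀ x, u' i = some x → x ∈ S := by
      intro l
      induction l with
      | nil => exact fun _ o ho => ho
      | cons y l ihl =>
        intro hl o ho
        refine ihl (fun y' hy' => hl y' (List.mem_cons_of_mem _ hy')) _ ?_
        refine ih _ _ (fun i hji hip x hx => ?_) ho
        rcases eq_or_lt_of_le hji with rfl | hlt
        · rw [Function.update_self] at hx
          exact hl y List.mem_cons_self x hx
        · rw [Function.update_of_ne (by omega)] at hx
          exact hu i hlt hip x hx
    refine key _ ?_ o ho
    intro y hy x hyx
    subst hyx
    simp only [List.mem_cons, reduceCtorEq, List.mem_map, Option.some.injEq, exists_eq_right,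
      false_or] at hy
    exact (List.mem_filter.1 hy).1

/-- Carry out the swap in register `12` and array `13`. -/
def applyProg (p : ℕ) : Prog :=
  .ite (.lt (.lit 0) (.reg 11))
    (.seq (each p fun i => .seq (.assign 8 (.arr 13 (.lit i) (.lit 0)))
        (.ite (.lt (.reg 8) (.reg 0)) (removeProg p) .skip))
      (.seq (.assign 8 (.reg 12)) (addProg p))) .skip

/-- A bound on the running time of `applyProg`. -/
def applyCost (p κ : ℕ) : ℕ := p * (p * (10 * κ + 12) + 9) + p * 5 + 10

theorem Keeps.mono {rs rs' : List ℕ} (hk : Keeps rs s s') (hr : rs ⊆ rs') : Keeps rs' s s' :=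
  ⟨hk.arrived, hk.shortlist, hk.set, fun x hx => hk.reg x fun hh => hx (hr hh), hk.arr⟩

theorem SolRep.agree (hs : SolRep I σ S s) {rs as vs : List ℕ} (ha : Agree rs as vs s s')
    (has : ∀ x ∈ as, x ∉ [5, 6, 7]) : SolRep I σ S s' :=
  ⟨hs.lists.agree ha (fun hh => has 5 hh (by simp)) (fun hh => has 6 hh (by simp)),
    by rw [ha.arr 7 fun hh => has 7 hh (by simp)]; exact hs.inS, by rw [ha.set, hs.set]⟩

theorem ends_applyProg {y : Option (Fin n)} (hs : SolRep I σ S s) (h0 : s.reg 0 = n)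
    (hy : Pending I σ S s.arrived y s) (hnd : S.Nodup) (hS : I.Feasible S.toFinset)
    (hpos : ∀ e ∈ S, (σ.symm e : ℕ) < s.arrived) :
    Ends I σ (applyProg p) s (applyCost p I.kappa) fun s' =>
      Keeps [8, 17, 18] s s' ∧ SolRep I σ (y.elim S (swapTo I S)) s' := by
  have hskip : s.reg 11 = 0 → y.elim S (swapTo I S) = S →
      Ends I σ (applyProg p) s (applyCost p I.kappa) fun s' =>
      Keeps [8, 17, 18] s s' ∧ SolRep I σ (y.elim S (swapTo I S)) s' := by
    intro h11 hyS
    refine (Ends.ite_false ?_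
      (ends_of_step (s' := s) (P := .skip) ?_ fun K => rfl)).mono
      (by rw [applyCost]; omega) fun s' h => h
    · simp only [Cond.holds, Expr.eval, h11]
      exact lt_irrefl 0
    · rw [hyS]
      exact ⟨(Agree.refl [8, 17, 18] [] [] s).keeps (by simp), hs⟩
  cases y with
  | none => exact hskip (hy.flag rfl) rfl
  | some e =>
    obtain ⟨h12, hsw⟩ := hy.swap e rfl
    have het := hy.pos e rfl
    cases hu : bestSwap I S e with
    | none =>
      refine hskip ?_ ?_
      · rw [hsw.flag, hu]; rfl
      · simp only [Option.elim_some, swapTo, hu]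
        rfl
    | some u =>
      have hmem := searchSwap_mem p (fun _ => none) none (fun i h1 h2 => by omega) (by simp) u hu
      have h11 : s.reg 11 = 1 := by rw [hsw.flag, hu]; rfl
      -- The solution after the first `i` removals. An item that is the partner in several matroids
      -- may be removed again without harm.
      let G : ℕ → List (Fin n) := fun i => S.filter fun x => ∀ j < i, u j ≠ some x
      have hG0 : G 0 = S := by simp [G]
      let J : ℕ → State n → Prop := fun i s' => Keeps [8, 17, 18] s s' ∧ SolRep I σ (G i) s'
      have hstep : ∀ i < p, ∀ s1, J i s1 → Ends I σ
          (.seq (.assign 8 (.arr 13 (.lit i) (.lit 0)))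
            (.ite (.lt (.reg 8) (.reg 0)) (removeProg p) .skip)) s1
          (p * (10 * I.kappa + 12) + 8) (J (i + 1)) := by
        rintro i hi s1 ⟨hk, hsol⟩
        refine Ends.seq_le (b := p * (10 * I.kappa + 12) + 6) (ends_exec_eq (by trivial) s1) ?_
          (by simp only [Prog.len]; omega)
        rintro s2 rfl
        set s2 := exec I σ (.assign 8 (.arr 13 (.lit i) (.lit 0))) s1 with hs2
        have ha : Agree [8] [] [] s1 s2 := agree_exec (by simp [Prog.Writes]) s1
        have hk2 : Keeps [8, 17, 18] s s2 := hk.trans ((ha.keeps (by simp)).mono (by simp))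
        have hsol2 : SolRep I σ (G i) s2 := hsol.agree ha (by simp)
        have h8 : s2.reg 8 = code σ (u i) := by
          have := hsw.tuple u hu i hi
          simp [hs2, exec, Expr.eval, hk.arr 13, this]
        have h02 : s2.reg 0 = n := by rw [hk2.reg 0 (by simp), h0]
        have hcond : (Cond.lt (.reg 8) (.reg 0)).holds I σ s2 ↔ code σ (u i) < n := by
          simp only [Cond.holds, Expr.eval, h8, h02]
        cases hui : u i with
        | none =>
          rw [hui] at hcond
          refine (Ends.ite_false (fun hh => absurd (hcond.1 hh) (lt_irrefl n))
            (ends_of_step (s' := s2) (P := .skip) ?_ fun K => rfl)).mono (by omega) fun s' h => h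
          have : G (i + 1) = G i := by
            refine List.filter_congr fun x _ => ?_
            rw [decide_eq_decide, Nat.forall_lt_succ_right]
            simp [hui]
          exact ⟨hk2, this ▸ hsol2⟩
        | some x =>
          rw [hui] at hcond h8
          have hxs := hpos x (hmem i hi x hui)
          have hGsub : (G i).toFinset ⊆ S.toFinset := by
            intro z hz
            exact List.mem_toFinset.2 (List.mem_filter.1 (List.mem_toFinset.1 hz)).1
          refine (Ends.ite_true (hcond.2 (σ.symm x).2) (ends_removeProg (hnd.filter _)
            (hS.subset hGsub) h8 (by rw [hk2.arrived]; exact hxs) hsol2)).mono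
            (by omega) ?_
          rintro s3 ⟨hk3, hsol3⟩
          have : G (i + 1) = (G i).filter fun z => z ≠ x := by
            simp only [G, List.filter_filter]
            refine List.filter_congr fun z _ => ?_
            rw [← Bool.decide_and, decide_eq_decide, Nat.forall_lt_succ_right, hui, and_comm]
            simp [eq_comm]
          exact ⟨hk2.trans (hk3.mono (by simp)), this ▸ hsol3⟩
      refine Ends.mono (Ends.ite_true (by simp [Cond.holds, Expr.eval, h11])
        (Ends.seq_le (b := p * 5 + 7) (ends_each _ J p hstep s
          ⟨(Agree.refl [8, 17, 18] [] [] s).keeps (by simp), hG0.symm ▸ hs⟩) ?_ le_rfl))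
        (by rw [applyCost]; exact le_of_eq (by ring)) fun s' h => h
      rintro s1 ⟨hk, hsol⟩
      refine Ends.seq_le (b := p * 5 + 5) (ends_exec_eq (by trivial) s1) ?_
        (by simp only [Prog.len]; omega)
      rintro s2 rfl
      set s2 := exec I σ (.assign 8 (.reg 12)) s1 with hs2
      have ha : Agree [8] [] [] s1 s2 := agree_exec (by simp [Prog.Writes]) s1
      have hk2 : Keeps [8, 17, 18] s s2 := hk.trans ((ha.keeps (by simp)).mono (by simp))
      have h8 : s2.reg 8 = σ.symm e := by
        simp [hs2, exec, Expr.eval, hk.reg 12, h12]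
      refine (ends_addProg h8 (by rw [hk2.arrived]; exact het)
        (hsol.agree ha (by simp))).mono le_rfl ?_
      rintro s3 ⟨hk3, hsol3⟩
      refine ⟨hk2.trans (hk3.mono (by simp)), ?_⟩
      simp only [Option.elim_some, swapTo, hu, applySwap, swapped]
      exact hsol3

end WindowEnd

/-! ### The loop over the windows, the output and the tally of the draws -/

section Windows

variable {p n q : ℕ} {I : Problem p n q} {σ : Equiv.Perm (Fin n)}

section

variable [NeZero n] {m D L : ℕ} {v : Fin n → ℕ} {R : ℕ → ℕ} {w : Fin n → Fin m}

theorem length_runHist (j : ℕ) : (runHist I D L v R σ w j).length = j := by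
  induction j with
  | zero => rfl
  | succ j ih => rw [runHist, List.length_cons, ih]

theorem symm_window_item {j r : ℕ} (hr : r < winCard w j) :
    (σ.symm (itemPos σ (winBase w j + r)) : ℕ) = winBase w j + r :=
  symm_itemPos σ (by have := winBase_add_le w j; omega)

theorem scan_pos {j r : ℕ} (hr : r ≤ winCard w j) {S : List (Fin n)} {e : Fin n}
    (he : (scan I D L (winCard w j) v S (fun r => itemPos σ (winBase w j + r)) r).1 = some e) :
    winBase w j ≤ σ.symm e ∧ (σ.symm e : ℕ) < winBase w j + r := by
  obtain ⟨i, hi, rfl⟩ := scan_fst_mem _ _ he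
  rw [symm_window_item (by omega)]
  omega

theorem runHist_pos (j : ℕ) {e : Fin n} (he : some e ∈ runHist I D L v R σ w j) :
    (σ.symm e : ℕ) < winBase w j := by
  induction j with
  | zero => simp [runHist] at he
  | succ j ih =>
    rw [winBase_succ]
    rw [runHist] at he
    rcases List.mem_cons.1 he with he | he
    · exact (scan_pos le_rfl he.symm).2
    · have := ih he
      omega

theorem sol_runHist_pos (j : ℕ) {e : Fin n} (he : e ∈ sol I R (runHist I D L v R σ w j)) :
    (σ.symm e : ℕ) < winBase w j := runHist_pos j (sol_subset _ _ e he)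

/-- An item of the current window arrives later than everything in the solution, and an old item is
brought in only if it is not there already. -/
theorem sol_runHist_nodup (j : ℕ) : (sol I R (runHist I D L v R σ w j)).Nodup := by
  induction j with
  | zero => exact List.nodup_nil
  | succ j ih =>
    rw [runHist, sol]
    rcases nextSol_cases (I := I) (sol I R (runHist I D L v R σ w j))
      (scan I D L (winCard w j) v (sol I R (runHist I D L v R σ w j))
        (fun r => itemPos σ (winBase w j + r)) (winCard w j)).1
      (entry (runHist I D L v R σ w j) (R (runHist I D L v R σ w j).length)) with
      hh | ⟨e, he, hh⟩ | ⟨e, -, he, hh⟩ <;> rw [hh]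
    · exact ih
    · refine applySwap_nodup ih (fun hm => ?_) _
      have h1 := sol_runHist_pos j hm
      have h2 := (scan_pos le_rfl he).1
      omega
    · exact applySwap_nodup ih he _

theorem runList_succ (j : ℕ) : runList I D L v R σ w (j + 1) =
    runList I D L v R σ w j ∪ (winList I D L v R σ w j).toFinset := by
  rw [runList, Finset.range_add_one, Finset.biUnion_insert, Finset.union_comm]
  rfl

theorem card_runList_le (j : ℕ) : (runList I D L v R σ w j).card ≤ j * L := by
  refine Finset.card_biUnion_le.trans ?_
  refine (Finset.sum_le_card_nsmul _ _ L fun i _ => ?_).trans (by simp)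
  exact (List.toFinset_card_le _).trans (scan_snd_length_le _)

end

/-- Prepare a window. -/
def startProg : Prog :=
  .seq (.query 0 1) (.seq (.assign 7 (.lit 0)) (.seq (.assign 10 (.lit 0))
    (.seq (.assign 11 (.lit 0)) (.seq (.assign 13 (.lit 0)) (.assign 16 (.lit 0))))))

/-- Record the best item of the window. -/
def finishProg : Prog :=
  .seq (.store 4 (.reg 6) (.lit 0) (.reg 10)) (.assign 6 (.add (.reg 6) (.lit 1)))

/-- Process a window. -/
def windowProg (p D L : ℕ) : Prog :=
  .seq startProg <| .seq (.loop (.lt (.reg 7) (.arr 3 (.reg 6) (.lit 0))) (itemProg p D L)) <|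
  .seq (againProg p) <| .seq (applyProg p) finishProg

theorem exec_startProg {A1 A2 : ℕ → ℕ → ℕ} {cnt : ℕ → ℕ} {m : ℕ} {S : List (Fin n)}
    {h : List (Option (Fin n))} {A : Finset (Fin n)} {b j D L : ℕ} {v : Fin n → ℕ}
    {it : ℕ → Fin n} {s : State n} (hb : Base I σ A1 A2 cnt m S h A b j s) :
    InWindow I σ A1 A2 cnt m S h A b j D L v it 0 (exec I σ startProg s) := by
  have hw : startProg.Writes [7, 10, 11, 13, 16] [] [0] := by simp [startProg, Prog.Writes]
  have ha := agree_exec (I := I) (σ := σ) hw s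
  refine ⟨?_, ⟨?_, ?_, ?_, fun _ => ?_, by simp [scan]⟩, ?_, ?_⟩
  · simpa [scan] using hb.agree ha (by simp) (by simp)
  · simp [startProg, exec, hb.set, scan]
  · simp [startProg, exec, Expr.eval, scan, pcode]
  · simp [startProg, exec, Expr.eval, scan]
  · simp [startProg, exec, Expr.eval]
  · simp [startProg, exec, Expr.eval, scan]
  · simp [startProg, exec, Expr.eval]

theorem exec_finishProg {A1 A2 : ℕ → ℕ → ℕ} {cnt : ℕ → ℕ} {m : ℕ} {S S' : List (Fin n)}
    {h : List (Option (Fin n))} {A : Finset (Fin n)} {t j : ℕ} {x : Option (Fin n)}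
    {s s' : State n} (hb : Base I σ A1 A2 cnt m S h A t j s) (hk : Keeps [8, 17, 18] s s')
    (hs : SolRep I σ S' s') (h10 : s.reg 10 = pcode σ x) (hj : h.length = j) :
    Base I σ A1 A2 cnt m S' (x :: h) A t (j + 1) (exec I σ finishProg s') := by
  have h6 : (Expr.reg 6).eval I σ s' = j := (hk.reg 6 (by simp)).trans hb.window
  have h10' : (Expr.reg 10).eval I σ s' = pcode σ x := (hk.reg 10 (by simp)).trans h10
  rw [finishProg, exec_seq, exec_store (y := 0) h6 rfl h10']
  refine ⟨?_, ?_, ?_, ?_, ?_, ?_, ?_, ?_, fun y => ?_, ?_, ?_, ?_, ?_, ?_, ?_⟩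
  · simpa [exec] using (hk.reg 0 (by simp)).trans hb.size
  · simpa [exec, hk.reg 2 (by simp)] using hb.windows
  · simpa [exec, Expr.eval] using h6
  · simpa [exec] using (hk.reg 5 (by simp)).trans hb.next
  · simpa [exec] using hk.arrived.trans hb.arrived
  · simpa [exec] using (hk.arr 1 (by simp)).trans hb.prio
  · simpa [exec] using (hk.arr 2 (by simp)).trans hb.again
  · simpa [exec, hk.arr 3 (by simp)] using hb.count
  · rcases lt_trichotomy y j with hlt | rfl | hgt
    · rw [entry_cons_lt (by omega), ← hb.hist]
      simp [exec, hlt.ne, hk.arr 4 (by simp)]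
    · subst hj
      simp [exec, entry_length]
    · have h1 := hb.hist y
      rw [entry_of_le (by omega)] at h1
      rw [entry_of_le (by rw [List.length_cons]; omega)]
      simpa [exec, hgt.ne', hk.arr 4 (by simp)] using h1
  · simpa [ListRep, exec] using hs.lists
  · simpa [exec] using hs.inS
  · simpa [exec, hk.arr 8 (by simp)] using hb.inA
  · simpa [exec] using hk.shortlist.trans hb.shortlist
  · simpa [exec] using (hk.set 0 (by simp)).trans hb.out
  · simpa [exec] using hs.set

/-- A bound on the running time of a window, without the items. -/
def windowCost (p κ : ℕ) : ℕ :=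
  searchCost p κ p + (takeProg p).len + applyCost p κ + 50

variable [NeZero n] {m D L : ℕ} {v : Fin n → ℕ} {R : ℕ → ℕ} {w : Fin n → Fin m}
  {A1 A2 : ℕ → ℕ → ℕ}

theorem ends_windowProg (hv : ∀ e, v e = A1 (σ.symm e) 0) (hR : ∀ j < m, R j = A2 j 0) {j : ℕ}
    (hj : j < m) {s : State n}
    (hb : Base I σ A1 A2 (winCard w) m (sol I R (runHist I D L v R σ w j))
      (runHist I D L v R σ w j) (runList I D L v R σ w j) (winBase w j) j s) :
    Ends I σ (windowProg p D L) s
      (winCard w j * (itemCost p I.kappa + 1) + windowCost p I.kappa)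
      (Base I σ A1 A2 (winCard w) m (sol I R (runHist I D L v R σ w (j + 1)))
        (runHist I D L v R σ w (j + 1)) (runList I D L v R σ w (j + 1)) (winBase w (j + 1))
        (j + 1)) := by
  set S := sol I R (runHist I D L v R σ w j) with hSdef
  set h := runHist I D L v R σ w j with hhdef
  set it : ℕ → Fin n := fun r => itemPos σ (winBase w j + r) with hit
  have hnd : S.Nodup := sol_runHist_nodup j
  have hfe : I.Feasible S.toFinset := sol_feasible _ _
  have hpos : ∀ e ∈ S, (σ.symm e : ℕ) < winBase w j := fun e he => sol_runHist_pos j he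
  have hbase := winBase_succ w j
  refine Ends.seq_le (b := winCard w j * (itemCost p I.kappa + 1) +
      (searchCost p I.kappa p + (takeProg p).len + applyCost p I.kappa + 35))
    (ends_exec_eq (by refine ⟨?_, ?_, ?_, ?_, ?_, ?_⟩ <;> trivial) s) ?_
    (by simp only [Prog.len, startProg, windowCost]; omega)
  rintro s1 rfl
  refine Ends.seq_le (b := searchCost p I.kappa p + (takeProg p).len + applyCost p I.kappa + 30)
    (ends_loop (winCard w j) (fun _ => itemCost p I.kappa)
      (InWindow I σ A1 A2 (winCard w) m S h (runList I D L v R σ w j) (winBase w j) j D L v it)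
      ?_ ?_ _ (exec_startProg hb)) ?_
    (by rw [Finset.sum_const, Finset.card_range, smul_eq_mul]; omega)
  · intro r hr s2 hs2
    refine ⟨?_, ends_itemProg hv (symm_window_item hr) hj hnd hfe hpos hs2⟩
    simp only [Cond.holds, Expr.eval, hs2.items, hs2.base.window, hs2.base.count j hj]
    exact hr
  · intro s2 hs2
    simp only [Cond.holds, Expr.eval, hs2.items, hs2.base.window, hs2.base.count j hj]
    exact lt_irrefl _
  intro s2 hs2
  have hb2 := hs2.base
  rw [← hbase] at hb2
  have hx : ∀ e, (scan I D L (winCard w j) v S it (winCard w j)).1 = some e →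
      (σ.symm e : ℕ) < winBase w (j + 1) := by
    intro e he
    rw [hbase]
    exact (scan_pos le_rfl he).2
  refine Ends.seq_le (b := applyCost p I.kappa + 5)
    (ends_againProg hb2 hs2.cand hnd hfe (fun e he => by have := hpos e he; omega)
      (fun e he => by have := runHist_pos j he; omega) hx) ?_ (by omega)
  rintro s3 ⟨hb3, h10, y, hy, hnext⟩
  refine Ends.seq_le (b := 3) (ends_applyProg ⟨hb3.lists, hb3.inS, hb3.set⟩ hb3.size
    (by rw [hb3.arrived]; exact hy) hnd hfe (fun e he => ?_)) ?_ (by omega)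
  · rw [hb3.arrived]
    have := hpos e he
    omega
  rintro s4 ⟨hk, hsol⟩
  refine (ends_exec (P := finishProg) (by constructor <;> trivial) ?_).mono
    (by simp [finishProg, Prog.len]) fun s' h => h
  have hlen : h.length = j := length_runHist j
  have := exec_finishProg hb3 hk hsol h10 hlen
  rw [← hnext] at this
  have hsol' : sol I R (runHist I D L v R σ w (j + 1)) = nextSol I S
      (scan I D L (winCard w j) v S it (winCard w j)).1 (entry h (A2 j 0)) := by
    rw [runHist, sol, ← hhdef, ← hSdef, hlen, hR j hj]
  rw [hsol', runList_succ]
  exact this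

/-- Process all windows. -/
def windowsProg (p D L : ℕ) : Prog :=
  .loop (.lt (.reg 6) (.add (.reg 2) (.lit 1))) (windowProg p D L)

theorem ends_windowsProg (hv : ∀ e, v e = A1 (σ.symm e) 0) (hR : ∀ j < m, R j = A2 j 0)
    {s : State n} (hb : Base I σ A1 A2 (winCard w) m [] [] ∅ 0 0 s) :
    Ends I σ (windowsProg p D L) s
      (n * (itemCost p I.kappa + 1) + m * (windowCost p I.kappa + 1) + 1)
      (Base I σ A1 A2 (winCard w) m (sol I R (runHist I D L v R σ w m))
        (runHist I D L v R σ w m) (runList I D L v R σ w m) n m) := by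
  have h := ends_loop (I := I) (σ := σ) (c := .lt (.reg 6) (.add (.reg 2) (.lit 1)))
    (P := windowProg p D L) m
    (fun j => winCard w j * (itemCost p I.kappa + 1) + windowCost p I.kappa)
    (fun j => Base I σ A1 A2 (winCard w) m (sol I R (runHist I D L v R σ w j))
      (runHist I D L v R σ w j) (runList I D L v R σ w j) (winBase w j) j)
    (fun j hj s hs => ⟨?_, ends_windowProg hv hR hj hs⟩) (fun s hs => ?_) s
    (by rw [winBase_zero]; exact hb)
  · refine h.mono ?_ fun s' hs' => by rwa [winBase_top] at hs'
    -- Every arrival is processed in exactly one window, so the costs per item add up to `n` times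
    -- the cost of an item.
    have hsum : ∑ j ∈ Finset.range m, winCard w j = n := by
      have : ∀ i, ∑ j ∈ Finset.range i, winCard w j = winBase w i := by
        intro i
        induction i with
        | zero => simp [winBase_zero]
        | succ i ih => rw [Finset.sum_range_succ, ih, winBase_succ]
      rw [this, winBase_top]
    simp only [add_assoc]
    rw [Finset.sum_add_distrib, ← Finset.sum_mul, hsum, Finset.sum_const, Finset.card_range,
      smul_eq_mul, add_assoc]
  · simp only [Cond.holds, Expr.eval, hs.window, hs.windows]
    exact hj
  · simp only [Cond.holds, Expr.eval, hs.window, hs.windows]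
    exact lt_irrefl m

/-- Return the shortlisted items of the solution. -/
def outputProg : Prog :=
  .seq (.assign 4 (.lit 0)) <| .loop (.lt (.reg 4) (.reg 0)) <|
    .seq (.ite (.lt (.lit 0) (.arr 7 (.reg 4) (.lit 0)))
      (.ite (.lt (.lit 0) (.arr 8 (.reg 4) (.lit 0))) (.insert 0 (.reg 4)) .skip) .skip)
    (.assign 4 (.add (.reg 4) (.lit 1)))

theorem ends_outputProg {cnt : ℕ → ℕ} {S : List (Fin n)} {h : List (Option (Fin n))}
    {A : Finset (Fin n)} {j : ℕ} {s : State n} (hb : Base I σ A1 A2 cnt m S h A n j s) :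
    Ends I σ outputProg s (8 * n + 5) fun s' =>
      s'.shortlist = A ∧ s'.set 0 = S.toFinset ∩ A := by
  let J : ℕ → State n → Prop := fun t s' => s'.reg 4 = t ∧ s'.reg 0 = n ∧ s'.arrived = n ∧
    s'.arr = s.arr ∧ s'.shortlist = A ∧
    s'.set 0 = (S.toFinset ∩ A).filter fun e => (σ.symm e : ℕ) < t
  refine Ends.seq_le (b := 8 * n + 1) (Q := J 0) (ends_exec (by trivial) ?_) ?_
    (by simp only [Prog.len]; omega)
  · refine ⟨?_, ?_, hb.arrived, rfl, hb.shortlist, ?_⟩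
    · simp [exec, Expr.eval]
    · simpa [exec] using hb.size
    · simpa [exec] using hb.out
  intro s1 hs1
  refine (ends_loop n (fun _ => 7) J ?_ ?_ s1 hs1).mono
    (by rw [Finset.sum_const, Finset.card_range, smul_eq_mul]; omega) ?_
  · rintro t ht s2 ⟨h4, h0, harr, ha, hA, hset⟩
    refine ⟨by simpa [Cond.holds, Expr.eval, h4, h0] using ht, ?_⟩
    refine (ends_exec (Q := J (t + 1)) ?_ ?_).mono (by simp [Prog.len]) fun s' h => h
    · refine ⟨⟨⟨?_, ?_⟩, ?_⟩, ?_⟩ <;> trivial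
    · set e : Fin n := itemPos σ t with he
      have het : (σ.symm e : ℕ) = t := symm_itemPos σ ht
      have h7 := hb.inS e
      have h8 := hb.inA e
      rw [het, ← ha] at h7 h8
      have hat : itemAt σ s2 t = {e} := by
        rw [← het]
        exact itemAt_symm (by rw [harr]; omega)
      have hsplit : ∀ x, (σ.symm x : ℕ) < t + 1 ↔ (σ.symm x : ℕ) < t ∨ x = e := by
        intro x
        have : x = e ↔ (σ.symm x : ℕ) = t := by
          rw [← het, ← Fin.ext_iff, σ.symm.injective.eq_iff]
        rw [this]
        omega
      rw [exec_seq, exec_ite, exec_ite]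
      have hc7 : (Cond.lt (.lit 0) (.arr 7 (.reg 4) (.lit 0))).holds I σ s2 ↔ e ∈ S := by
        simp only [Cond.holds, Expr.eval, h4, h7]
        split_ifs with hm <;> simp [hm]
      have hc8 : (Cond.lt (.lit 0) (.arr 8 (.reg 4) (.lit 0))).holds I σ s2 ↔ e ∈ A := by
        simp only [Cond.holds, Expr.eval, h4, h8]
        split_ifs with hm <;> simp [hm]
      by_cases hin : e ∈ S ∧ e ∈ A
      · rw [if_pos (hc7.2 hin.1), if_pos (hc8.2 hin.2)]
        refine ⟨?_, ?_, ?_, ?_, ?_, ?_⟩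
        · simp [exec, Expr.eval, h4]
        · simpa [exec] using h0
        · exact harr
        · exact ha
        · exact hA
        · simp only [exec, Expr.eval, h4, hat, Function.update_self, hset]
          ext x
          simp only [Finset.mem_union, Finset.mem_filter, Finset.mem_inter, List.mem_toFinset,
            Finset.mem_singleton, hsplit]
          constructor
          · rintro (⟨h1, h2⟩ | rfl)
            · exact ⟨h1, Or.inl h2⟩
            · exact ⟨hin, Or.inr rfl⟩
          · rintro ⟨h1, h2 | h2⟩
            · exact Or.inl ⟨h1, h2⟩
            · exact Or.inr h2
      · have hskip : ∀ s3 : State n, s3 = s2 →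
            J (t + 1) (exec I σ (.assign 4 (.add (.reg 4) (.lit 1))) s3) := by
          rintro s3 rfl
          refine ⟨?_, ?_, harr, ha, hA, ?_⟩
          · simp [exec, Expr.eval, h4]
          · simpa [exec] using h0
          · simp only [exec, hset]
            refine Finset.filter_congr fun x hx => ?_
            rw [hsplit, or_iff_left]
            rintro rfl
            rw [Finset.mem_inter, List.mem_toFinset] at hx
            exact hin hx
        refine hskip _ ?_
        by_cases h1 : e ∈ S
        · rw [if_pos (hc7.2 h1), if_neg fun hh => hin ⟨h1, hc8.1 hh⟩]
          rfl
        · rw [if_neg fun hh => h1 (hc7.1 hh)]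
          rfl
  · rintro s2 ⟨h4, h0, -⟩
    simp only [Cond.holds, Expr.eval, h4, h0]
    exact lt_irrefl n
  · rintro s2 ⟨-, -, -, -, hA, hset⟩
    refine ⟨hA, ?_⟩
    rw [hset, Finset.filter_true_of_mem]
    exact fun e _ => (σ.symm e).2

/-- Count the draws for each window. -/
def tallyProg : Prog :=
  .seq (.assign 4 (.lit 0)) <| .loop (.lt (.reg 4) (.reg 0)) <|
    .seq (.store 3 (.arr 0 (.reg 4) (.lit 0)) (.lit 0)
      (.add (.arr 3 (.arr 0 (.reg 4) (.lit 0)) (.lit 0)) (.lit 1)))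
    (.assign 4 (.add (.reg 4) (.lit 1)))

omit [NeZero n] in
theorem ends_tallyProg {s : State n} (h0 : s.reg 0 = n) (hw : ∀ t : Fin n, s.arr 0 t 0 = w t)
    (h3 : ∀ i, s.arr 3 i 0 = 0) :
    Ends I σ tallyProg s (5 * n + 5) fun s' => Agree [4] [3] [] s s' ∧
      ∀ i, s'.arr 3 i 0 = winCard w i := by
  let J : ℕ → State n → Prop := fun t s' => Agree [4] [3] [] s s' ∧ s'.reg 4 = t ∧
    ∀ i, s'.arr 3 i 0 = (Finset.univ.filter fun x : Fin n => (w x : ℕ) = i ∧ (x : ℕ) < t).card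
  refine Ends.seq_le (b := 5 * n + 1) (Q := J 0) (ends_exec (by trivial) ?_) ?_
    (by simp only [Prog.len]; omega)
  · refine ⟨agree_exec (by simp [Prog.Writes]) s, by simp [exec, Expr.eval], fun i => ?_⟩
    simpa [exec] using h3 i
  intro s1 hs1
  refine (ends_loop n (fun _ => 4) J ?_ ?_ s1 hs1).mono
    (by rw [Finset.sum_const, Finset.card_range, smul_eq_mul]; omega) ?_
  · rintro t ht s2 ⟨ha, h4, hcnt⟩
    refine ⟨by simpa [Cond.holds, Expr.eval, h4, ha.reg 0, h0] using ht, ?_⟩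
    have hwr : (Prog.seq (.store 3 (.arr 0 (.reg 4) (.lit 0)) (.lit 0)
        (.add (.arr 3 (.arr 0 (.reg 4) (.lit 0)) (.lit 0)) (.lit 1)))
        (.assign 4 (.add (.reg 4) (.lit 1)))).Writes [4] [3] [] := by simp [Prog.Writes]
    refine (ends_exec (Q := J (t + 1)) hwr.simple ?_).mono (by simp [Prog.len]) fun s' h => h
    have hwt : s2.arr 0 t 0 = w ⟨t, ht⟩ := by
      rw [ha.arr 0 (by simp)]
      exact hw ⟨t, ht⟩
    have hx : (Expr.arr 0 (.reg 4) (.lit 0)).eval I σ s2 = w ⟨t, ht⟩ := by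
      simpa [Expr.eval, h4] using hwt
    have hz : (Expr.add (.arr 3 (.arr 0 (.reg 4) (.lit 0)) (.lit 0)) (.lit 1)).eval I σ s2 =
        s2.arr 3 (w ⟨t, ht⟩) 0 + 1 := by
      simp [Expr.eval, h4, hwt]
    have h0' : (Expr.lit 0).eval I σ s2 = 0 := rfl
    refine ⟨ha.trans (agree_exec hwr s2), ?_, fun i => ?_⟩
    · simp [exec, Expr.eval, h4]
    · rw [exec_seq, exec_store hx h0' hz]
      have hset : (Finset.univ.filter fun x : Fin n => (w x : ℕ) = i ∧ (x : ℕ) < t + 1) =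
          if (w ⟨t, ht⟩ : ℕ) = i then
            insert ⟨t, ht⟩ (Finset.univ.filter fun x : Fin n => (w x : ℕ) = i ∧ (x : ℕ) < t)
          else Finset.univ.filter fun x : Fin n => (w x : ℕ) = i ∧ (x : ℕ) < t := by
        ext x
        have hxt : x = ⟨t, ht⟩ ↔ (x : ℕ) = t := Fin.ext_iff
        split_ifs with hi
        · simp only [Finset.mem_filter, Finset.mem_univ, true_and, Finset.mem_insert, hxt]
          constructor
          · rintro ⟨h1, h2⟩
            by_cases h3 : (x : ℕ) = t
            · exact Or.inl h3
            · exact Or.inr ⟨h1, by omega⟩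
          · rintro (h1 | ⟨h1, h2⟩)
            · rw [hxt.2 h1]
              exact ⟨hi, Nat.lt_succ_self t⟩
            · exact ⟨h1, by omega⟩
        · simp only [Finset.mem_filter, Finset.mem_univ, true_and]
          refine and_congr_right fun h1 => ⟨fun h2 => ?_, fun h2 => by omega⟩
          rcases lt_or_eq_of_le (Nat.le_of_lt_succ h2) with h3 | h3
          · exact h3
          · rw [hxt.2 h3] at h1
            exact absurd h1 hi
      rw [hset]
      by_cases hi : (w ⟨t, ht⟩ : ℕ) = i
      · rw [if_pos hi, Finset.card_insert_of_notMem (by simp), ← hcnt]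
        simp [exec, hi]
      · rw [if_neg hi, ← hcnt]
        simp [exec, Ne.symm hi]
  · rintro s2 ⟨ha, h4, -⟩
    simp only [Cond.holds, Expr.eval, h4, ha.reg 0 (by simp), h0]
    exact lt_irrefl n
  · rintro s2 ⟨ha, -, hcnt⟩
    refine ⟨ha, fun i => ?_⟩
    rw [hcnt, winCard]
    congr 1
    refine Finset.filter_congr fun x _ => ?_
    simp

end Windows

/-! ### Drawing the random numbers -/

section Random

variable {p n q : ℕ} {I : Problem p n q} {σ : Equiv.Perm (Fin n)}

theorem runFor_succ {P : Prog} {K K' : List Prog} {s s' : State n}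
    (h : step I σ (P :: K, s) = PMF.pure (K', s')) (t : ℕ) :
    runFor I σ (t + 1) (P :: K, s) = runFor I σ t (K', s') := by
  rw [runFor, h, PMF.pure_bind]

theorem uniform_cons (α : Type*) [Fintype α] [Nonempty α] (k : ℕ) :
    PMF.uniformOfFintype (Fin (k + 1) → α) = (PMF.uniformOfFintype α).bind fun r =>
      (PMF.uniformOfFintype (Fin k → α)).map fun x => (Fin.cons r x : Fin (k + 1) → α) := by
  classical
  ext f
  rw [PMF.bind_apply, tsum_fintype, Finset.sum_eq_single (f 0)]
  · rw [PMF.map_apply, tsum_fintype, Finset.sum_eq_single (Fin.tail f)]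
    · rw [if_pos (Fin.cons_self_tail f).symm]
      simp only [PMF.uniformOfFintype_apply, Fintype.card_fun, Fintype.card_fin]
      rw [pow_succ, Nat.cast_mul, mul_comm, ENNReal.mul_inv] <;> simp
    · intro x _ hx
      refine if_neg fun hh => hx ?_
      rw [hh, Fin.tail_cons]
    · simp
  · intro r _ hr
    rw [PMF.map_apply, tsum_fintype, Finset.sum_eq_zero, mul_zero]
    intro x _
    refine if_neg fun hh => hr ?_
    rw [hh, Fin.cons_zero]
  · simp

/-- Fill the array `a` with `len` random numbers in `{0, …, bound}`. -/
def fillLoop (a : ℕ) (len bound : Expr) : Prog :=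
  .loop (.lt (.reg 4) len) (.seq (.rand 15 bound)
    (.seq (.store a (.reg 4) (.lit 0) (.reg 15)) (.assign 4 (.add (.reg 4) (.lit 1)))))

/-- Each round takes exactly six steps whatever is drawn, so at a fixed time the law of the
configuration is the image of a uniform vector. All the randomness of the algorithm is drawn in
advance in this way. -/
theorem runFor_fillLoop (a : ℕ) (len bound : Expr) (B k i : ℕ) (s : State n) (hs : s.reg 4 = i)
    (hlen : ∀ s', Agree [4, 15] [a] [] s s' → len.eval I σ s' = i + k)
    (hbound : ∀ s', Agree [4, 15] [a] [] s s' → bound.eval I σ s' = B) :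
    ∃ g : (Fin k → Fin (B + 1)) → State n, (∀ x, Agree [4, 15] [a] [] s (g x) ∧
      (∀ j : Fin k, (g x).arr a (i + j) 0 = x j) ∧ ∀ l < i, (g x).arr a l 0 = s.arr a l 0) ∧
      ∀ K, runFor I σ (6 * k + 1) (fillLoop a len bound :: K, s) =
        (PMF.uniformOfFintype (Fin k → Fin (B + 1))).map fun x => (K, g x) := by
  induction k generalizing i s with
  | zero =>
    refine ⟨fun _ => s, fun x => ⟨Agree.refl _ _ _ s, fun j => j.elim0, fun _ _ => rfl⟩,
      fun K => ?_⟩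
    have hc : ¬ (Cond.lt (.reg 4) len).holds I σ s := by
      simp [Cond.holds, Expr.eval, hs, hlen s (Agree.refl _ _ _ s)]
    rw [runFor_succ (K' := K) (s' := s) (by rw [fillLoop, step, if_neg hc])]
    exact (PMF.map_const _ _).symm
  | succ k ih =>
    -- the state after the first draw
    let s1 : Fin (B + 1) → State n := fun r =>
      { s with reg := Function.update s.reg 15 r.val }
    let s2 : Fin (B + 1) → State n := fun r =>
      exec I σ (.seq (.store a (.reg 4) (.lit 0) (.reg 15))
        (.assign 4 (.add (.reg 4) (.lit 1)))) (s1 r)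
    have ha : ∀ r, Agree [4, 15] [a] [] s (s2 r) := by
      intro r
      have h1 : Agree [4, 15] [a] [] s (s1 r) := by
        refine ⟨rfl, rfl, rfl, fun x hx => ?_, fun _ _ => rfl, fun _ _ => rfl⟩
        simp only [List.mem_cons, not_or] at hx
        simp [s1, hx]
      exact h1.trans (agree_exec (by simp [Prog.Writes]) _)
    have h4 : ∀ r, (s2 r).reg 4 = i + 1 := fun r => by
      simp [s2, s1, exec, Expr.eval, hs]
    have harr : ∀ r, (s2 r).arr a i 0 = r := fun r => by
      simp [s2, s1, exec, Expr.eval, hs]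
    have harr' : ∀ r, ∀ l < i, (s2 r).arr a l 0 = s.arr a l 0 := fun r l hl => by
      simp [s2, s1, exec, Expr.eval, hs, hl.ne]
    choose g hg hrun using fun r => ih (i + 1) (s2 r) (h4 r)
      (fun s' h' => by rw [hlen s' ((ha r).trans h')]; ring)
      (fun s' h' => hbound s' ((ha r).trans h'))
    refine ⟨fun x => g (x 0) (Fin.tail x), fun x => ⟨(ha _).trans (hg _ _).1, fun j => ?_,
      fun l hl => ?_⟩, fun K => ?_⟩
    · refine Fin.cases ?_ (fun j => ?_) j
      · have := (hg (x 0) (Fin.tail x)).2.2 i (Nat.lt_succ_self i)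
        simpa [harr] using this
      · have := (hg (x 0) (Fin.tail x)).2.1 j
        rw [Fin.val_succ, show i + ((j : ℕ) + 1) = i + 1 + j by ring, this]
        rfl
    · rw [(hg (x 0) (Fin.tail x)).2.2 l (by omega), harr' _ l hl]
    · have hc : (Cond.lt (.reg 4) len).holds I σ s := by
        simp [Cond.holds, Expr.eval, hs, hlen s (Agree.refl _ _ _ s)]
      have hrand : runFor I σ (6 * (k + 1) + 1) (fillLoop a len bound :: K, s) =
          (PMF.uniformOfFintype (Fin (B + 1))).bind fun r =>
            runFor I σ (6 * k + 4) (.seq (.store a (.reg 4) (.lit 0) (.reg 15))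
              (.assign 4 (.add (.reg 4) (.lit 1))) :: fillLoop a len bound :: K, s1 r) := by
        have hb := hbound s (Agree.refl _ _ _ s)
        rw [show 6 * (k + 1) + 1 = 6 * k + 4 + 1 + 1 + 1 by ring,
          runFor_succ (s' := s) (by rw [fillLoop, step, if_pos hc]),
          runFor_succ (s' := s) (by rw [step]), runFor, step, PMF.bind_map]
        subst hb
        rfl
      rw [hrand, uniform_cons, PMF.map_bind]
      congr 1
      funext r
      rw [PMF.map_comp, runFor_succ (s' := s1 r) (by rw [step]),
        runFor_succ (t := 6 * k + 2) (s' := exec I σ (.store a (.reg 4) (.lit 0) (.reg 15)) (s1 r)) rfl,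
        runFor_succ (t := 6 * k + 1) (s' := s2 r) rfl]
      rw [hrun r K]
      congr 1

/-- Fill the array `a` with `len` random numbers in `{0, …, bound}`. -/
def fillProg (a : ℕ) (len bound : Expr) : Prog :=
  .seq (.assign 4 (.lit 0)) (fillLoop a len bound)

theorem runFor_fillProg (a : ℕ) (len bound : Expr) (B k : ℕ) (s : State n)
    (hlen : ∀ s', Agree [4, 15] [a] [] s s' → len.eval I σ s' = k)
    (hbound : ∀ s', Agree [4, 15] [a] [] s s' → bound.eval I σ s' = B) :
    ∃ g : (Fin k → Fin (B + 1)) → State n, (∀ x, Agree [4, 15] [a] [] s (g x) ∧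
      ∀ j : Fin k, (g x).arr a j 0 = x j) ∧
      ∀ K, runFor I σ (6 * k + 3) (fillProg a len bound :: K, s) =
        (PMF.uniformOfFintype (Fin k → Fin (B + 1))).map fun x => (K, g x) := by
  have ha : Agree [4, 15] [a] [] s (exec I σ (.assign 4 (.lit 0)) s) :=
    agree_exec (by simp [Prog.Writes]) s
  obtain ⟨g, hg, hrun⟩ := runFor_fillLoop (I := I) (σ := σ) a len bound B k 0
    (exec I σ (.assign 4 (.lit 0)) s) (by simp [exec, Expr.eval])
    (fun s' h' => by rw [hlen s' (ha.trans h'), zero_add]) (fun s' h' => hbound s' (ha.trans h'))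
  refine ⟨g, fun x => ⟨ha.trans (hg x).1, fun j => by simpa using (hg x).2.1 j⟩, fun K => ?_⟩
  rw [runFor_succ (t := 6 * k + 2) (s' := s) (by rw [fillProg, step]),
    runFor_succ (t := 6 * k + 1) (s' := exec I σ (.assign 4 (.lit 0)) s) rfl]
  exact hrun K

end Random

/-! ### The complete program -/

section Main

variable {p n q : ℕ} {I : Problem p n q} {σ : Equiv.Perm (Fin n)}

/-- Compute the number of windows and the range of the priorities. -/
def setupProg (α : ℕ) : Prog :=
  .seq (.assign 2 (.sub (times α (.reg 1)) (.lit 1))) <|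
  .loop (.lt (.reg 4) (.reg 0))
    (.seq (.assign 3 (.add (.reg 3) (times α (.reg 0)))) (.assign 4 (.add (.reg 4) (.lit 1))))

/-- The machine cannot multiply two registers, so the range of the priorities is accumulated by `n`
additions. -/
theorem ends_setupProg (α : ℕ) : Ends I σ (setupProg α) (State.init n I.k) (4 * n + 3)
    fun s => Agree [2, 3, 4] [] [] (State.init n I.k) s ∧ s.reg 2 = α * I.k - 1 ∧
      s.reg 3 = n * (α * n) := by
  let J : ℕ → State n → Prop := fun t s => Agree [2, 3, 4] [] [] (State.init n I.k) s ∧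
    s.reg 2 = α * I.k - 1 ∧ s.reg 3 = t * (α * n) ∧ s.reg 4 = t
  refine Ends.seq_le (b := 4 * n + 1) (Q := J 0) (ends_exec (by trivial) ?_) ?_
    (by simp only [Prog.len]; omega)
  · refine ⟨agree_exec (by simp [Prog.Writes]) _, ?_, ?_, ?_⟩
    · simp only [exec, Expr.eval, eval_times, Function.update_self]
      simp [State.init]
    · simp [exec, State.init]
    · simp [exec, State.init]
  intro s1 hs1
  refine (ends_loop n (fun _ => 3) J ?_ ?_ s1 hs1).mono
    (by rw [Finset.sum_const, Finset.card_range, smul_eq_mul]; omega) fun s' h => ⟨h.1, h.2.1, h.2.2.1⟩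
  · rintro t ht s2 ⟨ha, h2, h3, h4⟩
    have h0 : s2.reg 0 = n := by
      rw [ha.reg 0 (by simp)]; simp [State.init]
    refine ⟨by simpa [Cond.holds, Expr.eval, h4, h0] using ht, ?_⟩
    have hw : (Prog.seq (.assign 3 (.add (.reg 3) (times α (.reg 0))))
      (.assign 4 (.add (.reg 4) (.lit 1)))).Writes [2, 3, 4] [] [] := by simp [Prog.Writes]
    refine ends_exec (Q := J (t + 1)) hw.simple ⟨ha.trans (agree_exec hw _), ?_, ?_, ?_⟩
    · simpa [exec] using h2
    · simp only [exec, Expr.eval, eval_times]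
      simp [h0, h3]
      ring
    · simp [exec, Expr.eval, h4]
  · rintro s2 ⟨ha, h2, h3, h4⟩
    have h0 : s2.reg 0 = n := by
      rw [ha.reg 0 (by simp)]; simp [State.init]
    simp [Cond.holds, Expr.eval, h4, h0]

/-- The algorithm after all random numbers are drawn. -/
def coreProg (p D L : ℕ) : Prog := .seq tallyProg (.seq (windowsProg p D L) outputProg)

/-- The algorithm. -/
def mainProg (p α L : ℕ) : Prog :=
  .seq (setupProg α) <| .seq (fillProg 0 (.reg 0) (.reg 2)) <|
  .seq (fillProg 1 (.reg 0) (.reg 3)) <|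
  .seq (fillProg 2 (.add (.reg 2) (.lit 1)) (.reg 2)) (coreProg p α L)

/-- A bound on the running time of `coreProg`. -/
def coreCost (p κ n m : ℕ) : ℕ :=
  n * (itemCost p κ + 14) + m * (windowCost p κ + 1) + 20

theorem ends_coreProg [NeZero n] {D L m : ℕ} {w : Fin n → Fin m} {v : Fin n → ℕ} {R : ℕ → ℕ}
    {s : State n} (ha : Agree [2, 3, 4, 15] [0, 1, 2] [] (State.init n I.k) s)
    (hm : s.reg 2 + 1 = m) (hw : ∀ t : Fin n, s.arr 0 t 0 = w t)
    (hv : ∀ e, v e = s.arr 1 (σ.symm e) 0) (hR : ∀ j < m, R j = s.arr 2 j 0) :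
    Ends I σ (coreProg p D L) s (coreCost p I.kappa n m) fun s' =>
      s'.shortlist = runList I D L v R σ w m ∧
      s'.set 0 = (sol I R (runHist I D L v R σ w m)).toFinset ∩ runList I D L v R σ w m := by
  have h0 : s.reg 0 = n := by
    rw [ha.reg 0 (by simp)]; simp [State.init]
  have harr : ∀ a, a ∉ [0, 1, 2] → ∀ i j, s.arr a i j = 0 := by
    intro a ha' i j
    rw [ha.arr a ha']; rfl
  refine Ends.seq_le (b := n * (itemCost p I.kappa + 9) + m * (windowCost p I.kappa + 1) + 12)
    (ends_tallyProg h0 hw (fun i => harr 3 (by simp) i 0)) ?_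
    (by simp only [coreCost, Nat.mul_add]; omega)
  rintro s1 ⟨ha1, hcnt⟩
  have hb : Base I σ (s.arr 1) (s.arr 2) (winCard w) m [] [] ∅ 0 0 s1 := by
    constructor
    · rw [ha1.reg 0 (by simp), h0]
    · rw [ha1.reg 2 (by simp), hm]
    · rw [ha1.reg 6 (by simp), ha.reg 6 (by simp)]; rfl
    · rw [ha1.reg 5 (by simp), ha.reg 5 (by simp)]; rfl
    · rw [ha1.arrived, ha.arrived]; rfl
    · rw [ha1.arr 1 (by simp)]
    · rw [ha1.arr 2 (by simp)]
    · exact fun i _ => hcnt i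
    · intro x
      rw [ha1.arr 4 (by simp), harr 4 (by simp)]
      simp [entry, pcode]
    · intro l
      rw [ha1.arr 5 (by simp), harr 5 (by simp)]
      simp [listIn]
    · intro e
      rw [ha1.arr 7 (by simp), harr 7 (by simp)]
      simp
    · intro e
      rw [ha1.arr 8 (by simp), harr 8 (by simp)]
      simp
    · rw [ha1.shortlist, ha.shortlist]; rfl
    · rw [ha1.set, ha.set]; rfl
    · rw [ha1.set, ha.set]; rfl
  refine Ends.seq_le (b := 8 * n + 5) (ends_windowsProg hv hR hb) ?_
    (by simp only [Nat.mul_add]; omega)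
  intro s2 hs2
  exact ends_outputProg hs2

/-- The law of the final configuration. -/
theorem run_mainProg [NeZero n] (α L : ℕ) {T m N : ℕ}
    (hm : m = α * I.k - 1) (hN : N = n * (α * n))
    (hT : 20 * n + 6 * (m + 1) + coreCost p I.kappa n (m + 1) + 40 ≤ T) :
    ∃ G : (Fin n → Fin (m + 1)) → (Fin n → Fin (N + 1)) → (Fin (m + 1) → Fin (m + 1)) → State n,
      (∀ w v R,
        (G w v R).shortlist = runList I α L (fun e => v (σ.symm e)) (toNatFun R) σ w (m + 1) ∧
        (G w v R).set 0 = (sol I (toNatFun R) (runHist I α L (fun e => v (σ.symm e))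
          (toNatFun R) σ w (m + 1))).toFinset ∩
          runList I α L (fun e => v (σ.symm e)) (toNatFun R) σ w (m + 1)) ∧
      runFor I σ T ([mainProg p α L], State.init n I.k) =
        (PMF.uniformOfFintype (Fin n → Fin (m + 1))).bind fun w =>
        (PMF.uniformOfFintype (Fin n → Fin (N + 1))).bind fun v =>
        (PMF.uniformOfFintype (Fin (m + 1) → Fin (m + 1))).map fun R => ([], G w v R) := by
  obtain ⟨t0, ht0, s0, ⟨ha0, h2, h3⟩, hrun0⟩ := ends_setupProg (I := I) (σ := σ) α
  rw [← hm] at h2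
  rw [← hN] at h3
  have h0 : s0.reg 0 = n := by
    rw [ha0.reg 0 (by simp)]; simp [State.init]
  obtain ⟨g1, hg1, hrun1⟩ := runFor_fillProg (I := I) (σ := σ) 0 (.reg 0) (.reg 2) m n s0
    (fun s' h => by rw [Expr.eval, h.reg 0 (by simp), h0])
    (fun s' h => by rw [Expr.eval, h.reg 2 (by simp), h2])
  choose g2 hg2 hrun2 using fun w => runFor_fillProg (I := I) (σ := σ) 1 (.reg 0) (.reg 3) N n
    (g1 w)
    (fun s' h => by rw [Expr.eval, h.reg 0 (by simp), (hg1 w).1.reg 0 (by simp), h0])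
    (fun s' h => by rw [Expr.eval, h.reg 3 (by simp), (hg1 w).1.reg 3 (by simp), h3])
  have h2' : ∀ w v s', Agree [4, 15] [2] [] (g2 w v) s' → s'.reg 2 = m := fun w v s' h => by
    rw [h.reg 2 (by simp), (hg2 w v).1.reg 2 (by simp), (hg1 w).1.reg 2 (by simp), h2]
  choose g3 hg3 hrun3 using fun w v => runFor_fillProg (I := I) (σ := σ) 2
    (.add (.reg 2) (.lit 1)) (.reg 2) m (m + 1) (g2 w v)
    (fun s' h => by simp only [Expr.eval]; rw [h2' w v s' h])
    (fun s' h => by rw [Expr.eval, h2' w v s' h])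
  have hcore : ∀ w v R, Ends I σ (coreProg p α L) (g3 w v R) (coreCost p I.kappa n (m + 1)) fun s' =>
      s'.shortlist = runList I α L (fun e => v (σ.symm e)) (toNatFun R) σ w (m + 1) ∧
      s'.set 0 = (sol I (toNatFun R) (runHist I α L (fun e => v (σ.symm e)) (toNatFun R) σ w
        (m + 1))).toFinset ∩ runList I α L (fun e => v (σ.symm e)) (toNatFun R) σ w (m + 1) := by
    intro w v R
    have a3 := (hg3 w v R).1
    have a2 := (hg2 w v).1
    have a1 := (hg1 w).1
    refine ends_coreProg ?_ ?_ (fun t => ?_) (fun e => ?_) (fun j hj => ?_)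
    · exact (ha0.mono (by simp) (by simp) (by simp)).trans
        ((a1.mono (by simp) (by simp) (by simp)).trans
        ((a2.mono (by simp) (by simp) (by simp)).trans (a3.mono (by simp) (by simp) (by simp))))
    · rw [h2' w v _ a3]
    · rw [a3.arr 0 (by simp), a2.arr 0 (by simp), (hg1 w).2 t]
    · rw [a3.arr 1 (by simp), (hg2 w v).2]
    · rw [toNatFun, dif_pos hj]
      exact ((hg3 w v R).2 ⟨j, hj⟩).symm
  choose tc htc G hG hrunc using hcore
  refine ⟨G, hG, ?_⟩
  -- The setup and the three fills take times that do not depend on the draws. The rest may depend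
  -- on them, but it halts within the remaining `Tc` steps, and a halted machine stays as it is.
  obtain ⟨Tc, rfl⟩ : ∃ Tc, T = 1 + (t0 + (1 + (6 * n + 3 + (1 + (6 * n + 3 + (1 +
      (6 * (m + 1) + 3 + Tc))))))) := ⟨T - (1 + (t0 + (1 + (6 * n + 3 + (1 + (6 * n + 3 + (1 +
      (6 * (m + 1) + 3)))))))), by omega⟩
  have hseq : ∀ P Q K s, runFor I σ 1 (.seq P Q :: K, s) = PMF.pure (P :: Q :: K, s) := by
    intro P Q K s
    rw [runFor_succ (t := 0) (s' := s) (K' := P :: Q :: K) (by rw [step])]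
    rfl
  have hTc : coreCost p I.kappa n (m + 1) ≤ Tc := by omega
  rw [mainProg, runFor_add, hseq, PMF.pure_bind, runFor_add, hrun0, PMF.pure_bind, runFor_add,
    hseq, PMF.pure_bind, runFor_add, hrun1, PMF.bind_map]
  congr 1
  funext w
  rw [Function.comp_apply, runFor_add, hseq, PMF.pure_bind, runFor_add, hrun2, PMF.bind_map]
  congr 1
  funext v
  rw [Function.comp_apply, runFor_add, hseq, PMF.pure_bind, runFor_add, hrun3, PMF.bind_map,
    ← PMF.bind_pure_comp]
  congr 1
  funext R
  obtain ⟨d, hd⟩ := Nat.exists_eq_add_of_le ((htc w v R).trans hTc)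
  rw [Function.comp_apply, Function.comp_apply, hd, runFor_add, hrunc, PMF.pure_bind, runFor_nil]

end Main

/-! ### Expectations as finite sums, and collisions of priorities -/

section Expectation

theorem sum_uniform_bind {A β : Type*} [Fintype A] [Nonempty A] [Fintype β] (f : A → PMF β)
    (F : β → ℝ) : ∑ b, (((PMF.uniformOfFintype A).bind f) b).toReal * F b =
      (∑ a, ∑ b, (f a b).toReal * F b) / Fintype.card A := by
  have h : ∀ b, (((PMF.uniformOfFintype A).bind f) b).toReal =
      (∑ a, (f a b).toReal) / Fintype.card A := by
    intro b
    rw [PMF.bind_apply, tsum_fintype, ENNReal.toReal_sum, Finset.sum_div]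
    · refine Finset.sum_congr rfl fun a _ => ?_
      rw [PMF.uniformOfFintype_apply, ENNReal.toReal_mul, ENNReal.toReal_inv,
        ENNReal.toReal_natCast, inv_mul_eq_div]
    · intro a _
      exact ENNReal.mul_ne_top (PMF.apply_ne_top _ _) (PMF.apply_ne_top _ _)
  simp only [h]
  rw [Finset.sum_comm, Finset.sum_div]
  refine Finset.sum_congr rfl fun b _ => ?_
  rw [div_mul_eq_mul_div, Finset.sum_mul]

theorem sum_pure {β : Type*} [Fintype β] (b : β) (F : β → ℝ) :
    ∑ c, (PMF.pure b c).toReal * F c = F b := by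
  classical
  rw [Finset.sum_eq_single b]
  · simp [PMF.pure_apply]
  · intro c _ hc
    simp [PMF.pure_apply, hc]
  · simp

theorem sum_uniform_map {A β : Type*} [Fintype A] [Nonempty A] [Fintype β] (f : A → β)
    (F : β → ℝ) : ∑ b, (((PMF.uniformOfFintype A).map f) b).toReal * F b =
      (∑ a, F (f a)) / Fintype.card A := by
  rw [← PMF.bind_pure_comp, sum_uniform_bind]
  simp only [Function.comp_apply, sum_pure]

variable {p n q : ℕ} {I : Problem p n q}

theorem f_le_best {A S : Finset (Fin n)} (h : S ⊆ A) (hS : I.Feasible S) :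
    I.f S ≤ I.best A := by
  classical
  refine Finset.le_sup' I.f ?_
  rw [Problem.feasibleIn, Finset.mem_filter, Finset.mem_powerset]
  exact ⟨h, hS⟩

theorem k_le : I.k ≤ n := by
  refine Finset.sup_le fun S _ => ?_
  simpa using Finset.card_le_univ S

theorem opt_eq_of_k_eq_zero (h : I.k = 0) : I.opt = I.f ∅ := by
  obtain ⟨O, -, hO, hf⟩ := exists_opt I
  rw [h, Nat.le_zero, Finset.card_eq_zero] at hO
  rw [← hf, hO]

/-- Union bound over the pairs of items: a given pair of distinct items collides with probability `1
/ (N + 1)`. -/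
theorem card_injective_ge (n N : ℕ) :
    (1 - (n * n : ℝ) / (N + 1)) * Fintype.card (Fin n → Fin (N + 1)) ≤
      (Finset.univ.filter fun v : Fin n → Fin (N + 1) => Function.Injective v).card := by
  classical
  have hpair : ∀ i j : Fin n, i ≠ j →
      (N + 1 : ℝ) * (Finset.univ.filter fun v : Fin n → Fin (N + 1) => v i = v j).card =
        Fintype.card (Fin n → Fin (N + 1)) := by
    intro i j hij
    have h := sum_resample_univ (κ := Fin (N + 1)) i fun v : Fin n → Fin (N + 1) =>
      if v i = v j then (1 : ℝ) else 0
    rw [Fintype.card_fin] at h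
    simp only [Function.update_self, Function.update_of_ne hij.symm, Finset.sum_ite_eq',
      Finset.mem_univ, if_true] at h
    rw [Finset.sum_boole, Finset.sum_const, Finset.card_univ, nsmul_eq_mul, mul_one] at h
    rw [h]
    push_cast
    ring
  have hunion : (Finset.univ.filter fun v : Fin n → Fin (N + 1) => ¬ Function.Injective v) ⊆
      (Finset.univ : Finset (Fin n × Fin n)).biUnion fun x =>
        if x.1 ≠ x.2 then Finset.univ.filter fun v : Fin n → Fin (N + 1) => v x.1 = v x.2
        else ∅ := by
    intro v hv
    simp only [Finset.mem_filter, Finset.mem_univ, true_and, Function.Injective, not_forall] at hv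
    obtain ⟨i, j, h1, h2⟩ := hv
    refine Finset.mem_biUnion.2 ⟨(i, j), Finset.mem_univ _, ?_⟩
    rw [if_pos h2]
    simpa using h1
  have hN : (0 : ℝ) < N + 1 := by positivity
  have hbad : ((Finset.univ.filter fun v : Fin n → Fin (N + 1) =>
      ¬ Function.Injective v).card : ℝ) ≤
      (n * n : ℝ) / (N + 1) * Fintype.card (Fin n → Fin (N + 1)) := by
    have h1 := (Finset.card_le_card hunion).trans Finset.card_biUnion_le
    have h2 : ((∑ x : Fin n × Fin n, (if x.1 ≠ x.2 then
        Finset.univ.filter fun v : Fin n → Fin (N + 1) => v x.1 = v x.2 else ∅).card : ℕ) : ℝ) ≤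
        ∑ x : Fin n × Fin n, (Fintype.card (Fin n → Fin (N + 1)) : ℝ) / (N + 1) := by
      push_cast
      refine Finset.sum_le_sum fun x _ => ?_
      split_ifs with hx
      · rw [le_div_iff₀ hN, mul_comm, hpair _ _ hx]
      · simp only [Finset.card_empty, Nat.cast_zero]
        positivity
    rw [Finset.sum_const, Finset.card_univ, Fintype.card_prod, Fintype.card_fin,
      nsmul_eq_mul] at h2
    refine (Nat.cast_le.2 h1).trans (h2.trans (le_of_eq ?_))
    push_cast
    ring
  have htot := Finset.card_filter_add_card_filter_not (s := Finset.univ)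
    (fun v : Fin n → Fin (N + 1) => Function.Injective v)
  rw [Finset.card_univ] at htot
  have htot' : ((Finset.univ.filter fun v : Fin n → Fin (N + 1) => Function.Injective v).card : ℝ)
      + (Finset.univ.filter fun v : Fin n → Fin (N + 1) => ¬ Function.Injective v).card =
      Fintype.card (Fin n → Fin (N + 1)) := by exact_mod_cast htot
  linarith

end Expectation

/-! ### The value of the returned set on average -/

section Average

variable {p n q : ℕ} {I : Problem p n q} [NeZero n]

/-- The value of the returned set. -/
noncomputable def gameValue (I : Problem p n q) (D L : ℕ) {m N : ℕ} (σ : Equiv.Perm (Fin n))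
    (w : Fin n → Fin m) (v : Fin n → Fin N) (R : Fin m → Fin m) : ℝ :=
  I.f ((sol I (toNatFun R) (runHist I D L (fun e => v e) (toNatFun R) σ w m)).toFinset ∩
    runList I D L (fun e => v e) (toNatFun R) σ w m)

/-- Outcomes with colliding priorities are discarded, which is allowed as `f` is nonnegative. For
injective priorities, the loss from missed items is applied for each `R` and `w`; the sum over `w`
and `σ` then becomes a sum over uniform window assignments. -/
theorem sum_gameValue_ge {D L m N : ℕ} (hD : 0 < D) (hm : 0 < m) (hk : I.k ≤ m)
    (hφ : (1 / D + D / 2 ^ (L + 1) : ℝ) ≤ 1) :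
    (n.factorial * Fintype.card (Fin n → Fin m) * Fintype.card (Fin m → Fin m) *
      (Finset.univ.filter fun v : Fin n → Fin N => Function.Injective v).card : ℝ) *
      ((1 - (1 / D + D / 2 ^ (L + 1))) *
        (I.opt / (p + 1) * (1 - Real.exp (-((1 - I.k / m) * (p + 1)))))) ≤
    ∑ v : Fin n → Fin N, ∑ R : Fin m → Fin m, ∑ w : Fin n → Fin m, ∑ σ : Equiv.Perm (Fin n),
      gameValue I D L σ w v R := by
  classical
  set φ : ℝ := 1 / D + D / 2 ^ (L + 1) with hφdef
  set c : ℝ := I.opt / (p + 1) * (1 - Real.exp (-((1 - I.k / m) * (p + 1)))) with hc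
  have h1 : ∑ v ∈ Finset.univ.filter fun v : Fin n → Fin N => Function.Injective v,
      ∑ R : Fin m → Fin m, ∑ w : Fin n → Fin m, ∑ σ : Equiv.Perm (Fin n),
        gameValue I D L σ w v R ≤
      ∑ v : Fin n → Fin N, ∑ R : Fin m → Fin m, ∑ w : Fin n → Fin m, ∑ σ : Equiv.Perm (Fin n),
        gameValue I D L σ w v R :=
    Finset.sum_le_sum_of_subset_of_nonneg (Finset.filter_subset _ _) fun v _ _ =>
      Finset.sum_nonneg fun R _ => Finset.sum_nonneg fun w _ => Finset.sum_nonneg fun σ _ =>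
        I.nonneg _
  refine le_trans ?_ h1
  have h2 : ∀ v ∈ Finset.univ.filter fun v : Fin n → Fin N => Function.Injective v,
      (n.factorial * Fintype.card (Fin n → Fin m) * Fintype.card (Fin m → Fin m) : ℝ) *
        ((1 - φ) * c) ≤ ∑ R : Fin m → Fin m, ∑ w : Fin n → Fin m, ∑ σ : Equiv.Perm (Fin n),
        gameValue I D L σ w v R := by
    intro v hv
    have hinj : Function.Injective fun e => (v e : ℕ) :=
      Fin.val_injective.comp (Finset.mem_filter.1 hv).2
    have h3 : ∀ R : Fin m → Fin m, (1 - φ) * (n.factorial * ∑ W : Fin n → Fin m,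
        I.f (sol I (toNatFun R) (hist I (fun e => v e) (toNatFun R) W m)).toFinset) ≤
        ∑ w : Fin n → Fin m, ∑ σ : Equiv.Perm (Fin n), gameValue I D L σ w v R := by
      intro R
      rw [← sum_windowOf fun W : Fin n → Fin m =>
        I.f (sol I (toNatFun R) (hist I (fun e => v e) (toNatFun R) W m)).toFinset, Finset.mul_sum]
      exact Finset.sum_le_sum fun w _ => sum_shortlisted_ge hD hinj w
    refine le_trans ?_ (Finset.sum_le_sum fun R _ => h3 R)
    rw [← Finset.mul_sum, ← Finset.mul_sum]
    have h4 := ideal_bound (I := I) hinj hm hk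
    rw [← hc] at h4
    have h5 := mul_le_mul_of_nonneg_left h4
      (mul_nonneg (sub_nonneg.2 hφ) (Nat.cast_nonneg (α := ℝ) n.factorial))
    refine le_trans (le_of_eq ?_) (h5.trans (le_of_eq ?_)) <;> ring
  refine le_trans (le_of_eq ?_) (Finset.card_nsmul_le_sum _ _ _ h2)
  rw [nsmul_eq_mul]
  ring

end Average

/-! ### Running time -/

section Time

/-- The additive `10` absorbs the overhead of each loop level, so that the recursion becomes
geometric. -/
theorem searchCost_le (p κ j : ℕ) :
    searchCost p κ j + 10 ≤ ((tryProg p).len + 10) * (4 * max κ 1) ^ j := by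
  induction j with
  | zero => simp [searchCost]
  | succ j ih =>
    set x := max κ 1 with hx
    have h1 : κ + 1 ≤ 2 * x := by omega
    have h2 : 1 ≤ x := by omega
    rw [searchCost, pow_succ, ← mul_assoc]
    have h3 := Nat.mul_le_mul_right (searchCost p κ j + 5) h1
    have h4 := Nat.mul_le_mul_right (4 * x) ih
    nlinarith [Nat.zero_le (x * searchCost p κ j)]

/-- The search dominates with order `max κ 1 ^ p`; updating the lists is linear in `κ`, which is no
more because `p ≥ 1`. Both the `n` items and the `m ≤ α * n` windows are charged this amount. -/
theorem exists_time (p α : ℕ) (hp : 1 ≤ p) : ∃ K : ℕ, ∀ n κ m, 1 ≤ n → m ≤ α * n →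
    20 * n + 6 * m + coreCost p κ n m + 41 ≤ K * (n * max κ 1 ^ p) := by
  set s0 := ((tryProg p).len + 10) * 4 ^ p with hs0
  set a0 := p * (p * 22 + 9) + p * 5 + 10 with ha0
  set C1 := s0 + (takeProg p).len + 54 with hC1
  set C2 := s0 + (takeProg p).len + a0 + 51 with hC2
  refine ⟨C1 + α * C2 + 6 * α + 81, fun n κ m hn hm => ?_⟩
  set x := max κ 1 with hx
  have hx1 : 1 ≤ x := le_max_right _ _
  have hκ : κ ≤ x := le_max_left _ _
  set X := x ^ p with hX
  have hX1 : 1 ≤ X := Nat.one_le_pow _ _ hx1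
  have hxX : x ≤ X := Nat.le_self_pow (by omega) x
  have hs : searchCost p κ p ≤ s0 * X := by
    have h := searchCost_le p κ p
    rw [mul_pow, ← mul_assoc, ← hx, ← hX, ← hs0] at h
    omega
  have hscale : ∀ c, c ≤ c * X := fun c => Nat.le_mul_of_pos_right c hX1
  have hitem : itemCost p κ + 14 ≤ C1 * X := by
    have := hscale ((takeProg p).len + 54)
    rw [hC1, itemCost, add_assoc s0, add_mul]
    omega
  have happly : applyCost p κ ≤ a0 * X := by
    have h1 : 10 * κ + 12 ≤ 22 * X := by omega
    have h2 : p * (10 * κ + 12) + 9 ≤ (p * 22 + 9) * X := by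
      have := Nat.mul_le_mul_left p h1
      nlinarith [hscale 9]
    have h3 := Nat.mul_le_mul_left p h2
    rw [applyCost, ha0]
    nlinarith [hscale (p * 5 + 10)]
  have hwin : windowCost p κ + 1 ≤ C2 * X := by
    have := hscale ((takeProg p).len + 51)
    rw [hC2, windowCost, show s0 + (takeProg p).len + a0 + 51 =
      s0 + (((takeProg p).len + 51) + a0) by ring, add_mul, add_mul]
    omega
  have h1 := Nat.mul_le_mul_left n hitem
  have h2 := Nat.mul_le_mul hm hwin
  have h3 : n ≤ n * X := hscale n
  have h4 : 1 ≤ n * X := hn.trans h3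
  rw [coreCost]
  have h5 := Nat.mul_le_mul_left α h3
  have h6 : α * n * (C2 * X) = α * C2 * (n * X) := by ring
  have h7 : n * (C1 * X) = C1 * (n * X) := by ring
  have h8 : (C1 + α * C2 + 6 * α + 81) * (n * X) = C1 * (n * X) + α * C2 * (n * X) +
      6 * (α * (n * X)) + 81 * (n * X) := by ring
  rw [h8]
  omega

end Time

/-! ### Numerical estimates -/

section Numbers

theorem le_exp_half (y : ℝ) : y ≤ Real.exp (y / 2) := by
  have h1 := Real.add_one_le_exp (y / 2 - 1)
  have h2 : Real.exp (y / 2) = Real.exp 1 * Real.exp (y / 2 - 1) := by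
    rw [← Real.exp_add]; congr 1; ring
  have h3 := Real.add_one_le_exp (1 : ℝ)
  have h4 := Real.exp_pos (y / 2 - 1)
  rw [h2]
  nlinarith

/-- The two factors cost at most `3 * η`. Weakening the exponent from `y` to `(1 - η) * y` costs at
most `η`, uniformly in `y`, because `y * exp (-y / 2) ≤ 1`; so the error does not grow with `p`. -/
theorem ratio_bound {η y : ℝ} (h0 : 0 ≤ η) (h1 : η ≤ 1 / 2) (hy : 0 ≤ y) :
    1 - Real.exp (-y) - 4 * η ≤
      (1 - η) * ((1 - 2 * η) * (1 - Real.exp (-((1 - η) * y)))) := by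
  set x := Real.exp (-((1 - η) * y)) with hx
  have hx0 : 0 < x := Real.exp_pos _
  have hx1 : x ≤ 1 := Real.exp_le_one_iff.2 (by nlinarith)
  have hdiff : x - Real.exp (-y) ≤ η := by
    have e1 : Real.exp (-y) = x * Real.exp (-(η * y)) := by
      rw [hx, ← Real.exp_add]; congr 1; ring
    have e2 := Real.add_one_le_exp (-(η * y))
    have e3 : x ≤ Real.exp (-(y / 2)) := Real.exp_le_exp.2 (by nlinarith)
    have e4 : y * x ≤ 1 := by
      refine (mul_le_mul_of_nonneg_left e3 hy).trans ?_
      rw [Real.exp_neg, ← div_eq_mul_inv, div_le_one (Real.exp_pos _)]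
      exact le_exp_half y
    rw [e1]
    nlinarith [mul_le_mul_of_nonneg_left e2 hx0.le, mul_le_mul_of_nonneg_left e4 h0]
  have h2 : (1 - 3 * η) * (1 - x) ≤ (1 - η) * ((1 - 2 * η) * (1 - x)) := by
    nlinarith [mul_nonneg (mul_nonneg h0 h0) (sub_nonneg.2 hx1)]
  nlinarith [mul_nonneg h0 hx0.le]

theorem exists_pow {ε : ℝ} (h0 : 0 < ε) (h1 : ε < 1) :
    ∃ a : ℕ, 1 ≤ a ∧ 4 / ε ≤ 2 ^ a ∧ (2 ^ a : ℝ) ≤ 8 / ε := by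
  have h4 : 1 ≤ 4 / ε := by
    rw [le_div_iff₀ h0]; linarith
  obtain ⟨b, hb1, hb2⟩ := exists_nat_pow_near h4 (one_lt_two (α := ℝ))
  refine ⟨b + 1, by omega, hb2.le, ?_⟩
  rw [pow_succ]
  calc (2 : ℝ) ^ b * 2 ≤ 4 / ε * 2 := by linarith
    _ = 8 / ε := by ring

theorem exponent_le {ε : ℝ} {a : ℕ} (h0 : 0 < ε) (ha : (2 ^ a : ℝ) ≤ 8 / ε) :
    (a : ℝ) ≤ 8 * Real.log (2 + 1 / ε) := by
  have hpos : 0 < 1 / ε := by positivity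
  have hl2 : (1 / 2 : ℝ) ≤ Real.log 2 := by
    have := Real.log_two_gt_d9
    linarith
  have h1 : (a : ℝ) * Real.log 2 ≤ Real.log (8 / ε) := by
    rw [← Real.log_pow]
    exact Real.log_le_log (by positivity) ha
  have h2 : Real.log (8 / ε) = 3 * Real.log 2 + Real.log (1 / ε) := by
    rw [show (8 : ℝ) / ε = 2 ^ 3 * (1 / ε) by ring, Real.log_mul (by positivity) hpos.ne',
      Real.log_pow]
    norm_num
  have h3 : Real.log 2 ≤ Real.log (2 + 1 / ε) := Real.log_le_log (by norm_num) (by linarith)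
  have h4 : Real.log (1 / ε) ≤ Real.log (2 + 1 / ε) := Real.log_le_log hpos (by linarith)
  have h5 : (a : ℝ) * (1 / 2) ≤ a * Real.log 2 :=
    mul_le_mul_of_nonneg_left hl2 (Nat.cast_nonneg a)
  linarith

end Numbers

/-! ### Choice of the parameters -/

section Final

variable {p n q : ℕ} {I : Problem p n q}

/-- The algorithm, where a problem with `k = 0` is treated separately. -/
def shortlistProg (p α L : ℕ) : Prog := .ite (.lt (.lit 0) (.reg 1)) (mainProg p α L) .skip

theorem sum_law {P : Prog} {T : ℕ} {X Y Z : Type} [Fintype X] [Fintype Y] [Fintype Z] [Nonempty X]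
    [Nonempty Y] [Nonempty Z] (G : Equiv.Perm (Fin n) → X → Y → Z → State n)
    (hrun : ∀ σ, run I σ P T = (PMF.uniformOfFintype X).bind fun x =>
      (PMF.uniformOfFintype Y).bind fun y => (PMF.uniformOfFintype Z).map fun z => ([], G σ x y z))
    (F : Finset (Fin n) × Finset (Fin n) → ℝ) :
    ∑ r, (law I P T r).toReal * F r =
      (∑ σ, ∑ x, ∑ y, ∑ z, F ((G σ x y z).shortlist, (G σ x y z).set 0)) /
        (n.factorial * Fintype.card X * Fintype.card Y * Fintype.card Z) := by
  rw [law, sum_uniform_bind]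
  simp only [hrun, PMF.map_bind, PMF.map_comp, sum_uniform_bind, sum_uniform_map,
    ← Finset.sum_div, div_div, Function.comp_apply, Config.result, Fintype.card_perm,
    Fintype.card_fin]
  congr 1
  ring

theorem runFor_shortlistProg {σ : Equiv.Perm (Fin n)} {α L T : ℕ} (hk : 0 < I.k) :
    run I σ (shortlistProg p α L) (T + 1) =
      runFor I σ T ([mainProg p α L], State.init n I.k) := by
  have hc : (Cond.lt (.lit 0) (.reg 1)).holds I σ (State.init n I.k) := by
    simpa [Cond.holds, Expr.eval, State.init] using hk
  rw [run, runFor_succ (s' := State.init n I.k) (K' := [mainProg p α L])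
    (by rw [shortlistProg, step, if_pos hc])]

theorem runFor_shortlistProg_of_k_eq_zero {σ : Equiv.Perm (Fin n)} {α L T : ℕ} (hk : I.k = 0)
    (hT : 2 ≤ T) :
    run I σ (shortlistProg p α L) T = PMF.pure ([], State.init n I.k) := by
  have hc : ¬ (Cond.lt (.lit 0) (.reg 1)).holds I σ (State.init n I.k) := by
    simp [Cond.holds, Expr.eval, State.init, hk]
  obtain ⟨T, rfl⟩ := Nat.exists_eq_add_of_le' hT
  rw [run, runFor_succ (t := T + 1) (s' := State.init n I.k) (K' := [.skip])
    (by rw [shortlistProg, step, if_neg hc]), runFor_succ (s' := State.init n I.k) (K' := []) rfl,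
    runFor_nil]

theorem sum_law_pure {P : Prog} {T : ℕ} {s : State n} (hrun : ∀ σ, run I σ P T = PMF.pure ([], s))
    (F : Finset (Fin n) × Finset (Fin n) → ℝ) :
    ∑ r, (law I P T r).toReal * F r = F (s.shortlist, s.set 0) := by
  simp only [law, hrun, PMF.pure_map, PMF.bind_const, sum_pure]
  rfl

/-- The average value of the returned set. -/
theorem average_ge [NeZero n] {a : ℕ} (ha : 1 ≤ a) (hk : 0 < I.k) {m N : ℕ}
    (hm : m = 2 ^ a * I.k - 1) (hN : N = n * (2 ^ a * n)) :
    I.opt / (p + 1) * (1 - Real.exp (-((p : ℝ) + 1)) - 4 / 2 ^ a) ≤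
      (∑ σ : Equiv.Perm (Fin n), ∑ w : Fin n → Fin (m + 1), ∑ v : Fin n → Fin (N + 1),
        ∑ R : Fin (m + 1) → Fin (m + 1),
          gameValue I (2 ^ a) (2 * a - 1) σ w (fun e => v (σ.symm e)) R) /
        (n.factorial * Fintype.card (Fin n → Fin (m + 1)) * Fintype.card (Fin n → Fin (N + 1)) *
          Fintype.card (Fin (m + 1) → Fin (m + 1))) := by
  have hm1 : m + 1 = 2 ^ a * I.k := by
    have : 0 < 2 ^ a * I.k := by positivity
    omega
  have hα : (0 : ℝ) < 2 ^ a := by positivity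
  have hα2 : (2 : ℝ) ≤ 2 ^ a := by
    calc (2 : ℝ) = 2 ^ 1 := by norm_num
      _ ≤ 2 ^ a := pow_le_pow_right₀ (by norm_num) ha
  have hreorder : ∑ σ : Equiv.Perm (Fin n), ∑ w : Fin n → Fin (m + 1),
      ∑ v : Fin n → Fin (N + 1), ∑ R : Fin (m + 1) → Fin (m + 1),
        gameValue I (2 ^ a) (2 * a - 1) σ w (fun e => v (σ.symm e)) R =
      ∑ v : Fin n → Fin (N + 1), ∑ R : Fin (m + 1) → Fin (m + 1), ∑ w : Fin n → Fin (m + 1),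
        ∑ σ : Equiv.Perm (Fin n), gameValue I (2 ^ a) (2 * a - 1) σ w v R := by
    -- The program draws priorities for positions, the analysis needs them attached to items. For
    -- each arrival order this is a relabelling of uniform vectors, so the priorities are
    -- independent of the order.
    have h1 : ∀ (σ : Equiv.Perm (Fin n)) (w : Fin n → Fin (m + 1)),
        ∑ v : Fin n → Fin (N + 1), ∑ R : Fin (m + 1) → Fin (m + 1),
          gameValue I (2 ^ a) (2 * a - 1) σ w (fun e => v (σ.symm e)) R =
        ∑ v : Fin n → Fin (N + 1), ∑ R : Fin (m + 1) → Fin (m + 1),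
          gameValue I (2 ^ a) (2 * a - 1) σ w v R := fun σ w =>
      (σ.arrowCongr (Equiv.refl (Fin (N + 1)))).sum_comp fun v =>
        ∑ R : Fin (m + 1) → Fin (m + 1), gameValue I (2 ^ a) (2 * a - 1) σ w v R
    simp only [h1]
    rw [Finset.sum_comm]
    have h2 : ∀ w : Fin n → Fin (m + 1), ∑ σ : Equiv.Perm (Fin n), ∑ v : Fin n → Fin (N + 1),
        ∑ R : Fin (m + 1) → Fin (m + 1), gameValue I (2 ^ a) (2 * a - 1) σ w v R =
        ∑ v : Fin n → Fin (N + 1), ∑ R : Fin (m + 1) → Fin (m + 1),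
          ∑ σ : Equiv.Perm (Fin n), gameValue I (2 ^ a) (2 * a - 1) σ w v R := fun w => by
      rw [Finset.sum_comm]
      exact Finset.sum_congr rfl fun v _ => Finset.sum_comm
    simp only [h2]
    rw [Finset.sum_comm]
    exact Finset.sum_congr rfl fun v _ => Finset.sum_comm
  rw [hreorder]
  set η : ℝ := 1 / 2 ^ a with hη
  have hη0 : 0 ≤ η := by positivity
  have hη1 : η ≤ 1 / 2 := one_div_le_one_div_of_le (by norm_num) hα2
  -- The choice `L = 2 * a - 1` balances the two ways of missing the best item of a window.
  have hφ : (1 / (2 ^ a : ℕ) + (2 ^ a : ℕ) / 2 ^ (2 * a - 1 + 1) : ℝ) = 2 * η := by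
    rw [show 2 * a - 1 + 1 = a + a by omega, pow_add]
    push_cast
    rw [hη]
    field_simp
    norm_num
  have hkm : (I.k : ℝ) / ((m + 1 : ℕ) : ℝ) = η := by
    rw [hm1]
    push_cast
    have : (I.k : ℝ) ≠ 0 := by exact_mod_cast hk.ne'
    rw [hη]
    field_simp
  have hmain := sum_gameValue_ge (I := I) (D := 2 ^ a) (L := 2 * a - 1) (m := m + 1) (N := N + 1)
    (by positivity) (Nat.succ_pos m)
    (by rw [hm1]; exact Nat.le_mul_of_pos_left _ (by positivity)) (by rw [hφ]; linarith)
  rw [hφ, hkm] at hmain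
  have hcoll := card_injective_ge n N
  -- The range `N = 2 ^ a * n ^ 2` is chosen to make collisions this rare.
  have hδ : (n * n : ℝ) / (N + 1) ≤ η := by
    rw [hη, div_le_div_iff₀ (by positivity) hα, hN]
    push_cast
    nlinarith
  have hopt : 0 ≤ I.opt := by
    obtain ⟨O, -, -, h⟩ := exists_opt I
    exact h ▸ I.nonneg O
  have hp0 : (0 : ℝ) < p + 1 := by positivity
  set c : ℝ := I.opt / (p + 1) with hc
  have hc0 : 0 ≤ c := by positivity
  set x : ℝ := 1 - Real.exp (-((1 - η) * (p + 1))) with hx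
  have hx0 : 0 ≤ x := by
    have : Real.exp (-((1 - η) * (p + 1))) ≤ 1 := Real.exp_le_one_iff.2 (by nlinarith)
    linarith
  have hratio := ratio_bound hη0 hη1 hp0.le
  rw [← hx] at hratio
  have hB : 0 ≤ (1 - 2 * η) * (c * x) := mul_nonneg (by linarith) (mul_nonneg hc0 hx0)
  rw [le_div_iff₀ (by positivity)]
  refine le_trans ?_ hmain
  set cV : ℝ := ((Fintype.card (Fin n → Fin (N + 1)) : ℕ) : ℝ) with hcV
  have hcV0 : 0 ≤ cV := Nat.cast_nonneg _
  have h1 : (1 - η) * cV ≤ ((Finset.univ.filter fun v : Fin n → Fin (N + 1) =>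
      Function.Injective v).card : ℝ) :=
    le_trans (mul_le_mul_of_nonneg_right (by linarith) hcV0) hcoll
  set M : ℝ := n.factorial * Fintype.card (Fin n → Fin (m + 1)) *
    Fintype.card (Fin (m + 1) → Fin (m + 1)) with hM
  have hM0 : 0 ≤ M := by positivity
  have h2 : c * (1 - Real.exp (-((p : ℝ) + 1)) - 4 / 2 ^ a) ≤
      (1 - η) * ((1 - 2 * η) * (c * x)) := by
    have := mul_le_mul_of_nonneg_left hratio hc0
    rw [show (4 : ℝ) / 2 ^ a = 4 * η by rw [hη]; ring]
    linarith
  calc c * (1 - Real.exp (-((p : ℝ) + 1)) - 4 / 2 ^ a) *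
      (n.factorial * Fintype.card (Fin n → Fin (m + 1)) * cV *
          Fintype.card (Fin (m + 1) → Fin (m + 1)))
      = M * (cV * (c * (1 - Real.exp (-((p : ℝ) + 1)) - 4 / 2 ^ a))) := by rw [hM]; ring
    _ ≤ M * (cV * ((1 - η) * ((1 - 2 * η) * (c * x)))) :=
        mul_le_mul_of_nonneg_left (mul_le_mul_of_nonneg_left h2 hcV0) hM0
    _ = M * (((1 - η) * cV) * ((1 - 2 * η) * (c * x))) := by ring
    _ ≤ M * (_ * ((1 - 2 * η) * (c * x))) :=
        mul_le_mul_of_nonneg_left (mul_le_mul_of_nonneg_right h1 hB) hM0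
    _ = _ := by ring

end Final

/-! ### The guarantees and the degenerate cases -/

section Guarantee

variable {p n q : ℕ} (I : Problem p n q)

theorem opt_nonneg : 0 ≤ I.opt := by
  obtain ⟨O, -, -, h⟩ := exists_opt I
  exact h ▸ I.nonneg O

/-- The guarantees for the program `P`, stopped after `T` steps: it halts, the shortlist has at most
`s` items, the returned set is a feasible subset of it, and the values are at least `v`. -/
def Guarantee (P : Prog) (T : ℕ) (s v : ℝ) : Prop :=
  (∀ σ : Equiv.Perm (Fin n), ∀ z ∈ (run I σ P T).support, z.1 = [] ∧
    ((z.2.shortlist.card : ℕ) : ℝ) ≤ s ∧ z.2.set 0 ⊆ z.2.shortlist ∧ I.Feasible (z.2.set 0)) ∧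
  v ≤ algValue I P T ∧ v ≤ outValue I P T

variable {I}

theorem guarantee_of_run_eq_pure {P : Prog} {T : ℕ} {s v : ℝ} (hs : 0 ≤ s) (hv : v ≤ I.f ∅)
    (hrun : ∀ σ, run I σ P T = PMF.pure ([], State.init n I.k)) : Guarantee I P T s v := by
  refine ⟨fun σ z hz => ?_, ?_, ?_⟩
  · rw [hrun, PMF.support_pure, Set.mem_singleton_iff] at hz
    subst hz
    exact ⟨rfl, by simpa [State.init] using hs, Finset.Subset.refl _, I.feasible_empty⟩
  · rw [algValue, sum_law_pure hrun fun r => I.best r.1]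
    exact hv.trans (f_le_best (Finset.empty_subset _) I.feasible_empty)
  · rw [outValue, sum_law_pure hrun fun r => I.f r.2]
    exact hv

theorem guarantee_shortlistProg [NeZero n] {a T : ℕ} (ha : 1 ≤ a) (hk : 0 < I.k)
    (hT : 20 * n + 6 * (2 ^ a * I.k) + coreCost p I.kappa n (2 ^ a * I.k) + 40 ≤ T) :
    Guarantee I (shortlistProg p (2 ^ a) (2 * a - 1)) (T + 1)
      ((2 ^ a * I.k * (2 * a - 1) : ℕ) : ℝ)
      (I.opt / (p + 1) * (1 - Real.exp (-((p : ℝ) + 1)) - 4 / 2 ^ a)) := by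
  have hpos : 0 < 2 ^ a * I.k := by positivity
  obtain ⟨m, hm⟩ : ∃ m, m = 2 ^ a * I.k - 1 := ⟨_, rfl⟩
  have hm1 : m + 1 = 2 ^ a * I.k := by omega
  choose G hG hrun using fun σ => run_mainProg (I := I) (σ := σ) (2 ^ a) (2 * a - 1) hm rfl
    (T := T) (by rw [hm1]; exact hT)
  have hrun' : ∀ σ, run I σ (shortlistProg p (2 ^ a) (2 * a - 1)) (T + 1) = _ := fun σ =>
    (runFor_shortlistProg hk).trans (hrun σ)
  have hsub : ∀ σ w v R, (G σ w v R).set 0 ⊆ (G σ w v R).shortlist := fun σ w v R => by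
    rw [(hG σ w v R).1, (hG σ w v R).2]
    exact Finset.inter_subset_right
  have hfeas : ∀ σ w v R, I.Feasible ((G σ w v R).set 0) := fun σ w v R => by
    rw [(hG σ w v R).2]
    exact (sol_feasible _ _).subset Finset.inter_subset_left
  have hout : I.opt / (p + 1) * (1 - Real.exp (-((p : ℝ) + 1)) - 4 / 2 ^ a) ≤
      outValue I (shortlistProg p (2 ^ a) (2 * a - 1)) (T + 1) := by
    rw [outValue, sum_law G hrun' fun r => I.f r.2]
    refine (average_ge ha hk hm rfl).trans (le_of_eq ?_)
    simp only [(hG _ _ _ _).2]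
    rfl
  refine ⟨fun σ z hz => ?_, ?_, hout⟩
  · rw [hrun' σ] at hz
    simp only [PMF.mem_support_bind_iff, PMF.mem_support_map_iff] at hz
    obtain ⟨w, -, v, -, R, -, rfl⟩ := hz
    refine ⟨rfl, ?_, hsub σ w v R, hfeas σ w v R⟩
    rw [(hG σ w v R).1, ← hm1]
    exact_mod_cast card_runList_le _
  · refine hout.trans ?_
    rw [outValue, algValue, sum_law G hrun' fun r => I.f r.2, sum_law G hrun' fun r => I.best r.1]
    refine div_le_div_of_nonneg_right ?_ (by positivity)
    exact Finset.sum_le_sum fun σ _ => Finset.sum_le_sum fun w _ => Finset.sum_le_sum fun v _ =>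
      Finset.sum_le_sum fun R _ => f_le_best (hsub σ w v R) (hfeas σ w v R)

theorem Guarantee.mono {P : Prog} {T : ℕ} {s s' v v' : ℝ} (h : Guarantee I P T s v) (hs : s ≤ s')
    (hv : v' ≤ v) : Guarantee I P T s' v' :=
  ⟨fun σ z hz => ⟨(h.1 σ z hz).1, (h.1 σ z hz).2.1.trans hs, (h.1 σ z hz).2.2⟩,
    hv.trans h.2.1, hv.trans h.2.2⟩

theorem target_le {ε : ℝ} (h0 : 0 < ε) :
    1 / ((p : ℝ) + 1) * (1 - 1 / Real.exp ((p : ℝ) + 1) - ε) * I.opt ≤ I.opt := by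
  have hp : (0 : ℝ) < p + 1 := by positivity
  have h1 : 1 / ((p : ℝ) + 1) ≤ 1 := by
    rw [div_le_one hp]
    linarith [(Nat.cast_nonneg p : (0 : ℝ) ≤ p)]
  have h2 : 1 - 1 / Real.exp ((p : ℝ) + 1) - ε ≤ 1 := by
    have : 0 < 1 / Real.exp ((p : ℝ) + 1) := by positivity
    linarith
  have h3 : 1 / ((p : ℝ) + 1) * (1 - 1 / Real.exp ((p : ℝ) + 1) - ε) ≤ 1 := by
    have := mul_le_mul_of_nonneg_left h2 (by positivity : 0 ≤ 1 / ((p : ℝ) + 1))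
    linarith
  exact mul_le_of_le_one_left (opt_nonneg I) h3

theorem target_nonpos {ε : ℝ} (h1 : 1 ≤ ε) :
    1 / ((p : ℝ) + 1) * (1 - 1 / Real.exp ((p : ℝ) + 1) - ε) * I.opt ≤ 0 := by
  have h2 : 0 < 1 / Real.exp ((p : ℝ) + 1) := by positivity
  exact mul_nonpos_of_nonpos_of_nonneg
    (mul_nonpos_of_nonneg_of_nonpos (by positivity) (by linarith)) (opt_nonneg I)

theorem target_le_of_pow {ε : ℝ} {a : ℕ} (h0 : 0 < ε) (ha : 4 / ε ≤ 2 ^ a) :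
    1 / ((p : ℝ) + 1) * (1 - 1 / Real.exp ((p : ℝ) + 1) - ε) * I.opt ≤
      I.opt / (p + 1) * (1 - Real.exp (-((p : ℝ) + 1)) - 4 / 2 ^ a) := by
  have h1 : (4 : ℝ) / 2 ^ a ≤ ε := by
    rw [div_le_iff₀ h0] at ha
    rw [div_le_iff₀ (by positivity)]
    linarith
  have h2 : 0 ≤ I.opt / ((p : ℝ) + 1) := div_nonneg (opt_nonneg I) (by positivity)
  rw [Real.exp_neg, ← one_div]
  calc 1 / ((p : ℝ) + 1) * (1 - 1 / Real.exp ((p : ℝ) + 1) - ε) * I.opt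
      = I.opt / (p + 1) * (1 - 1 / Real.exp ((p : ℝ) + 1) - ε) := by ring
    _ ≤ _ := mul_le_mul_of_nonneg_left (by linarith) h2

theorem size_nonneg {ε : ℝ} (h0 : 0 < ε) :
    0 ≤ 128 * ((I.k : ℝ) / ε) * Real.log (2 + 1 / ε) ^ 1 := by
  have : 0 < 1 / ε := by positivity
  have := Real.log_nonneg (by linarith : (1 : ℝ) ≤ 2 + 1 / ε)
  positivity

theorem size_le {ε : ℝ} {a k : ℕ} (h0 : 0 < ε) (ha : (2 ^ a : ℝ) ≤ 8 / ε) :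
    ((2 ^ a * k * (2 * a - 1) : ℕ) : ℝ) ≤ 128 * ((k : ℝ) / ε) * Real.log (2 + 1 / ε) ^ 1 := by
  have h1 : ((2 * a - 1 : ℕ) : ℝ) ≤ 2 * (8 * Real.log (2 + 1 / ε)) := by
    have h2 : ((2 * a - 1 : ℕ) : ℝ) ≤ 2 * a := by exact_mod_cast Nat.sub_le _ _
    linarith [exponent_le h0 ha]
  rw [Nat.cast_mul, Nat.cast_mul, Nat.cast_pow, Nat.cast_ofNat]
  calc (2 : ℝ) ^ a * k * ((2 * a - 1 : ℕ) : ℝ)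
      ≤ 8 / ε * k * (2 * (8 * Real.log (2 + 1 / ε))) :=
        mul_le_mul (mul_le_mul_of_nonneg_right ha (Nat.cast_nonneg k)) h1 (Nat.cast_nonneg _)
          (by positivity)
    _ = _ := by ring

end Guarantee

end Shortlist

theorem mainTheorem3 :
    ∃ (C : ℝ) (c : ℕ), ∀ p : ℕ, 1 ≤ p → ∀ ε : ℝ, 0 < ε →
      ∃ (P : Shortlist.Prog) (K : ℝ), ∀ (n q : ℕ) (I : Shortlist.Problem p n q), 1 ≤ n →
        ∃ T : ℕ,
          -- the running time, in the worst case over the arrival order and the random bits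
          (T : ℝ) ≤ K * ((n : ℝ) * ((max I.kappa 1 : ℕ) : ℝ) ^ p) ∧
          (∀ σ : Equiv.Perm (Fin n), ∀ z ∈ (Shortlist.run I σ P T).support,
            -- the machine has halted
            z.1 = [] ∧
            -- the size of the shortlist
            ((z.2.shortlist.card : ℕ) : ℝ) ≤
              C * ((I.k : ℝ) / ε) * Real.log (2 + 1 / ε) ^ c ∧
            -- the returned set is a feasible subset of the shortlist
            z.2.set 0 ⊆ z.2.shortlist ∧ I.Feasible (z.2.set 0)) ∧
          -- the competitive ratio
          1 / ((p : ℝ) + 1) * (1 - 1 / Real.exp ((p : ℝ) + 1) - ε) * I.opt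
            ≤ Shortlist.algValue I P T ∧
          1 / ((p : ℝ) + 1) * (1 - 1 / Real.exp ((p : ℝ) + 1) - ε) * I.opt
            ≤ Shortlist.outValue I P T := by
  -- There are `2 ^ a * k ≤ 8 * k / ε` windows with at most `2 * a ≤ 16 * log (2 + 1 / ε)`
  -- shortlisted items each, and `8 * 16 = 128`.
  refine ⟨128, 1, fun p hp ε h0 => ?_⟩
  rcases le_or_gt 1 ε with h1 | h1
  -- For `ε ≥ 1` the required value is not positive, and the empty set is good enough.
  · refine ⟨.skip, 1, fun n q I hn => ⟨1, ?_, ?_⟩⟩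
    · have h2 : 1 ≤ n * max I.kappa 1 ^ p :=
        Nat.mul_pos hn (pow_pos (lt_of_lt_of_le one_pos (le_max_right _ _)) p)
      rw [one_mul]
      exact_mod_cast h2
    · refine Shortlist.guarantee_of_run_eq_pure (Shortlist.size_nonneg h0)
        ((Shortlist.target_nonpos h1).trans (I.nonneg _)) fun σ => ?_
      rw [Shortlist.run, Shortlist.runFor_succ (s' := Shortlist.State.init n I.k) (K' := []) rfl,
        Shortlist.runFor_nil]
  · obtain ⟨a, ha, ha4, ha8⟩ := Shortlist.exists_pow h0 h1
    obtain ⟨K, hK⟩ := Shortlist.exists_time p (2 ^ a) hp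
    refine ⟨Shortlist.shortlistProg p (2 ^ a) (2 * a - 1), K, fun n q I hn =>
      ⟨20 * n + 6 * (2 ^ a * I.k) + Shortlist.coreCost p I.kappa n (2 ^ a * I.k) + 40 + 1,
        ?_, ?_⟩⟩
    · exact_mod_cast hK n I.kappa _ hn (Nat.mul_le_mul_left _ Shortlist.k_le)
    · have : NeZero n := ⟨by omega⟩
      rcases Nat.eq_zero_or_pos I.k with hk | hk
      -- For `k = 0` only the empty set is feasible, so the optimum is `f ∅` and nothing may be
      -- shortlisted.
      · exact Shortlist.guarantee_of_run_eq_pure (Shortlist.size_nonneg h0)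
          ((Shortlist.target_le h0).trans (Shortlist.opt_eq_of_k_eq_zero hk).le)
          fun σ => Shortlist.runFor_shortlistProg_of_k_eq_zero hk (by omega)
      · exact (Shortlist.guarantee_shortlistProg ha hk le_rfl).mono
          (Shortlist.size_le h0 ha8) (Shortlist.target_le_of_pow h0 ha4)
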